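/- **Setting.** *Space.* Let $(X,d)$ be a proper metric space (closed balls are compact) which is unbounded, of bounded geometry (there is $\varepsilon>0$ such that for every $r>0$ there is $N_r\in\mathbb N$ such that every open ball of radius $r$ is covered by at most $N_r$ open balls of radius $\varepsilon$) and has property A$'$: for every $t>0$ there are non-zero measurable functions $\varrho_{j,t}\colon X\to[0,1]$ ($j\in\mathbb N$) with - $\sum_j\varrho_{j,t}(x)=1$ for all $x\in X$; - $\sup_j\operatorname{diam}(\operatorname{spt}\varrho_{j,t})<\infty$; - $\sum_j|\varrho_{j,t}(x)-\varrho_{j,t}(y)|<t$ whenever $d(x,y)\le 1/t$; - for all $x\in X$ and $s>0$, only finitely many $\operatorname{spt}\varrho_{j,t}$ meet the ball $B(x,s)$. Let $\mu$ be a Radon measure on $X$, let $\beta X$ be the Stone–Čech compactification of $X$, and let $1<p<\infty$. $L_p(X,\mu)$ is the complex space, and $M_{\mathbb 1_K}$ is multiplication by the indicator function of a measurable set $K\subseteq X$. *Band-dominated operators.* The propagation of a bounded operator $B$ on $L_p(X,\mu)$ is $\sup\{\operatorname{dist}(K,K') : K,K'\subseteq X \text{ measurable},\ M_{\mathbb 1_{K'}}BM_{\mathbb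 1_K}\ne0\}\in[0,\infty]$. Let $\mathrm{BDO}^p$ be the norm closure in $\mathcal L(L_p(X,\mu))$ of the operators of finite propagation. *Subspace and projection.* Let $M^p\subseteq L_p(X,\mu)$ be a closed subspace and $P\in\mathrm{BDO}^p$ a bounded projection onto $M^p$ such that $M_{\mathbb 1_K}P$ and $PM_{\mathbb 1_K}$ are compact for every compact $K\subseteq X$. Let $\mathcal A^p$ be the set of all $A\in\mathcal L(M^p)$ with $AP\in\mathrm{BDO}^p$. *Shifts.* Fix $x_0\in X$. For every $x\in X$ let $\phi_x\colon X\to X$ be a bijective isometry with $\phi_x(x_0)=x$ and $\mu\circ\phi_x\ll\mu\ll\mu\circ\phi_x$, and let $h_x\colon X\to\mathbb C$ be measurable with $|h_x|^p=\frac{d(\mu\circ\phi_x)}{d\mu}$ $\mu$-almost everywhere. Assume that for $\mu$-almost every $y\in X$ the maps $x\mapsto\phi_x(y)$ and $x\mapsto h_x(y)$ are continuous. Let $U_x f:=(f\circ\phi_x)\cdot h_x$, a surjective linear isometry of $L_p(X,\mu)$. Assume that for all compact $K,K'\subseteq X$ the map $x\mapsto M_{\mathbb 1_K}U_xPU_x^{-1}M_{\mathbb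 1_{K'}}$ extends to a map $\beta X\to\mathcal L(L_p(X,\mu))$ which is continuous for the operator norm. **Proposition.** Let $\tilde X$ be a (Hausdorff) compactification of $X$, $\partial X:=\tilde X\setminus X$, and let $A\in\mathcal A^p$. Assume that for every $y\in\partial X$ and all nets $(y_\iota)$ in $X$ with $y_\iota\to y$ the limits $$P_y:=\operatorname*{w-lim}_{y_\iota\to y}U_{y_\iota}PU_{y_\iota}^{-1},\qquad A_y:=\operatorname*{w-lim}_{y_\iota\to y}U_{y_\iota}APU_{y_\iota}^{-1}\big|_{\operatorname{ran}(P_y)}$$ exist in the weak operator topology. Then each $A_y$ maps $\operatorname{ran}(P_y)$ into itself, and, with $A_y$ regarded as a bounded operator on $\operatorname{ran}(P_y)$: 1. $A$ is a Fredholm operator on $M^p$ if and only if $A_y$ is invertible for all $y\in\partial X$; 2. $\displaystyle\bigcup_{y\in\partial X}\sigma(A_y)=\sigma_{\rm ess}(A)$, where $\sigma_{\rm ess}(A)$ is the set of all $\lambda\in\mathbb C$ such that $A-\lambda$ is not Fredholm on $M^p$. -/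

import Mathlib

open MeasureTheory Filter Topology Set
open scoped ENNReal

namespace LimitOp

/-! ### Geometry -/

/-- Bounded geometry: for some `ε > 0`, every ball of radius `r` is covered by at most `N r` open
balls of radius `ε`, where `N r` does not depend on the centre. -/
def BoundedGeometry (X : Type*) [PseudoMetricSpace X] : Prop :=
  ∃ ε : ℝ, 0 < ε ∧ ∀ r : ℝ, 0 < r → ∃ N : ℕ, ∀ x : X, ∃ s : Finset X,
    s.card ≤ N ∧ Metric.ball x r ⊆ ⋃ y ∈ s, Metric.ball y ε

/-- Property A': for every `t > 0` there is a countable measurable partition of unity with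
uniformly bounded, locally finite supports and `ℓ¹`-variation less than `t` at scale `1 / t`. -/
def PropertyA' (X : Type*) [MetricSpace X] [MeasurableSpace X] : Prop :=
  ∀ t : ℝ, 0 < t → ∃ ρ : ℕ → X → ℝ,
    (∀ j, Measurable (ρ j) ∧ ρ j ≠ 0 ∧ ∀ x, ρ j x ∈ Icc (0 : ℝ) 1) ∧
    (∀ x, HasSum (fun j => ρ j x) 1) ∧
    (⨆ j, Metric.ediam (tsupport (ρ j))) < ∞ ∧
    (∀ x y, dist x y ≤ 1 / t →
      Summable (fun j => |ρ j x - ρ j y|) ∧ ∑' j, |ρ j x - ρ j y| < t) ∧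
    (∀ (x : X) (s : ℝ), 0 < s → {j | (tsupport (ρ j) ∩ Metric.ball x s).Nonempty}.Finite)

/-- The distance between two sets, with values in `[0, ∞]`. -/
noncomputable def setDist {X : Type*} [PseudoMetricSpace X] (K K' : Set X) : ℝ≥0∞ :=
  ⨅ x ∈ K, ⨅ y ∈ K', edist x y

/-! ### Multiplication by indicators and band-dominated operators -/

section Operators

variable {X : Type*} [MeasurableSpace X] {μ : Measure X} {p : ℝ≥0∞}

theorem memLp_indicator {K : Set X} (hK : MeasurableSet K) (f : Lp ℂ p μ) :
    MemLp (K.indicator (f : X → ℂ)) p μ :=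
  MemLp.indicator hK (Lp.memLp f)

variable [Fact (1 ≤ p)]

/-- The multiplication operator `f ↦ 𝟙_K f` on `L_p`. -/
noncomputable def mulInd (K : Set X) (hK : MeasurableSet K) : Lp ℂ p μ →L[ℂ] Lp ℂ p μ :=
  LinearMap.mkContinuous
    { toFun := fun f => (memLp_indicator hK f).toLp (K.indicator (f : X → ℂ))
      map_add' := by
        intro f g
        apply Lp.ext
        filter_upwards [MemLp.coeFn_toLp (memLp_indicator hK (f + g)),
          MemLp.coeFn_toLp (memLp_indicator hK f),
          MemLp.coeFn_toLp (memLp_indicator hK g), Lp.coeFn_add f g,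
          Lp.coeFn_add ((memLp_indicator hK f).toLp _)
            ((memLp_indicator hK g).toLp _)] with x h1 h2 h3 h4 h5
        rw [h1, h5, Pi.add_apply, h2, h3]
        by_cases hx : x ∈ K
        · rw [indicator_of_mem hx, indicator_of_mem hx, indicator_of_mem hx, h4, Pi.add_apply]
        · rw [indicator_of_notMem hx, indicator_of_notMem hx, indicator_of_notMem hx, add_zero]
      map_smul' := by
        intro c f
        apply Lp.ext
        filter_upwards [MemLp.coeFn_toLp (memLp_indicator hK (c • f)),
          MemLp.coeFn_toLp (memLp_indicator hK f), Lp.coeFn_smul c f,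
          Lp.coeFn_smul c ((memLp_indicator hK f).toLp _)] with x h1 h2 h4 h5
        rw [h1, RingHom.id_apply, h5, Pi.smul_apply, h2]
        by_cases hx : x ∈ K <;> simp [hx, h4] }
    1 (by
      intro f
      rw [one_mul]
      apply Lp.norm_le_norm_of_ae_le
      filter_upwards [MemLp.coeFn_toLp (memLp_indicator hK f)] with x h1
      simp only [LinearMap.coe_mk, AddHom.coe_mk]
      rw [h1]
      exact norm_indicator_le_norm_self _ _)

theorem coeFn_mulInd (K : Set X) (hK : MeasurableSet K) (f : Lp ℂ p μ) :
    mulInd K hK f =ᵐ[μ] K.indicator (f : X → ℂ) :=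
  MemLp.coeFn_toLp (memLp_indicator hK f)

end Operators

section BandDominated

variable {X : Type*} [MetricSpace X] [MeasurableSpace X] {μ : Measure X}
  {p : ℝ≥0∞} [Fact (1 ≤ p)]

/-- The propagation (band width) of `A`: the supremum of `dist (K, K')` over all measurable `K`,
`K'` such that `𝟙_{K'} A 𝟙_K ≠ 0`. -/
noncomputable def propagation (A : Lp ℂ p μ →L[ℂ] Lp ℂ p μ) : ℝ≥0∞ :=
  sSup {d | ∃ (K K' : Set X) (hK : MeasurableSet K) (hK' : MeasurableSet K'),
    mulInd K' hK' ∘L A ∘L mulInd K hK ≠ 0 ∧ d = setDist K K'}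

/-- The band-dominated operators on `L_p`: the norm closure of the operators of finite
propagation. -/
def BDO (μ : Measure X) (p : ℝ≥0∞) [Fact (1 ≤ p)] : Set (Lp ℂ p μ →L[ℂ] Lp ℂ p μ) :=
  closure {A | propagation A < ∞}

end BandDominated

/-! ### Shifts -/

section Shifts

variable {X : Type*} [MetricSpace X] [MeasurableSpace X] [BorelSpace X]

/-- A bijective isometry `φ` of `X` such that `μ ∘ φ` and `μ` are mutually absolutely continuous,
with a measurable weight `h` such that `|h|^p = d(μ ∘ φ)/dμ` almost everywhere. Here `μ ∘ φ`, the
measure `B ↦ μ (φ B)`, is the image of `μ` under `φ⁻¹`. -/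
structure WeightedShift (μ : Measure X) (p : ℝ≥0∞) where
  φ : X ≃ᵢ X
  h : X → ℂ
  measurable_h : Measurable h
  comp_ac : μ.map φ.symm ≪ μ
  ac_comp : μ ≪ μ.map φ.symm
  enorm_h : ∀ᵐ y ∂μ, ‖h y‖ₑ ^ p.toReal = (μ.map φ.symm).rnDeriv μ y

namespace WeightedShift

variable {μ : Measure X} {p : ℝ≥0∞} (S : WeightedShift μ p)

theorem qmp : Measure.QuasiMeasurePreserving S.φ μ μ := by
  refine ⟨S.φ.continuous.measurable, ?_⟩
  have h := S.ac_comp.map S.φ.continuous.measurable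
  rwa [Measure.map_map S.φ.continuous.measurable S.φ.symm.continuous.measurable,
    S.φ.self_comp_symm, Measure.map_id] at h

theorem qmp_symm : Measure.QuasiMeasurePreserving S.φ.symm μ μ :=
  ⟨S.φ.symm.continuous.measurable, S.comp_ac⟩

theorem aesm {g : X → ℂ} (hg : AEStronglyMeasurable g μ) :
    AEStronglyMeasurable (fun y => g (S.φ y) * S.h y) μ :=
  (hg.comp_quasiMeasurePreserving S.qmp).mul S.measurable_h.aestronglyMeasurable

variable [SigmaFinite μ]

theorem eLpNorm_eq [Fact (1 ≤ p)] (hp : p ≠ ∞) {g : X → ℂ} (hg : AEStronglyMeasurable g μ) :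
    eLpNorm (fun y => g (S.φ y) * S.h y) p μ = eLpNorm g p μ := by
  have hp0 : p ≠ 0 := (zero_lt_one.trans_le (Fact.out : 1 ≤ p)).ne'
  rw [eLpNorm_eq_lintegral_rpow_enorm_toReal hp0 hp, eLpNorm_eq_lintegral_rpow_enorm_toReal hp0 hp]
  congr 1
  have hm : AEMeasurable (fun y => ‖g (S.φ y)‖ₑ ^ p.toReal) μ :=
    ((hg.comp_quasiMeasurePreserving S.qmp).enorm).pow_const _
  have hsf : SigmaFinite (μ.map S.φ.symm) :=
    S.φ.symm.toHomeomorph.toMeasurableEquiv.sigmaFinite_map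
  calc ∫⁻ y, ‖g (S.φ y) * S.h y‖ₑ ^ p.toReal ∂μ
      = ∫⁻ y, (μ.map S.φ.symm).rnDeriv μ y * ‖g (S.φ y)‖ₑ ^ p.toReal ∂μ := by
        apply lintegral_congr_ae
        filter_upwards [S.enorm_h] with y hy
        rw [enorm_mul, ENNReal.mul_rpow_of_nonneg _ _ ENNReal.toReal_nonneg, hy, mul_comm]
    _ = ∫⁻ y, ‖g (S.φ y)‖ₑ ^ p.toReal ∂(μ.map S.φ.symm) := lintegral_rnDeriv_mul S.comp_ac hm
    _ = ∫⁻ y, ‖g (S.φ (S.φ.symm y))‖ₑ ^ p.toReal ∂μ :=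
        lintegral_map_equiv (fun y => ‖g (S.φ y)‖ₑ ^ p.toReal)
          S.φ.symm.toHomeomorph.toMeasurableEquiv
    _ = ∫⁻ y, ‖g y‖ₑ ^ p.toReal ∂μ := by simp

theorem memLp [Fact (1 ≤ p)] (hp : p ≠ ∞) (f : Lp ℂ p μ) :
    MemLp (fun y => f (S.φ y) * S.h y) p μ :=
  ⟨S.aesm (Lp.aestronglyMeasurable f), by
    rw [S.eLpNorm_eq hp (Lp.aestronglyMeasurable f)]; exact Lp.eLpNorm_lt_top f⟩

/-- The weighted shift `f ↦ (f ∘ φ) · h` as a linear isometry of `L_p`. -/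
noncomputable def isom [Fact (1 ≤ p)] (hp : p ≠ ∞) : Lp ℂ p μ →ₗᵢ[ℂ] Lp ℂ p μ where
  toFun f := (S.memLp hp f).toLp _
  map_add' f g := by
    apply Lp.ext
    filter_upwards [MemLp.coeFn_toLp (S.memLp hp (f + g)), MemLp.coeFn_toLp (S.memLp hp f),
      MemLp.coeFn_toLp (S.memLp hp g), S.qmp.ae (Lp.coeFn_add f g),
      Lp.coeFn_add ((S.memLp hp f).toLp _) ((S.memLp hp g).toLp _)] with x h1 h2 h3 h4 h5
    rw [h1, h5, Pi.add_apply, h2, h3, h4, Pi.add_apply, add_mul]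
  map_smul' c f := by
    apply Lp.ext
    filter_upwards [MemLp.coeFn_toLp (S.memLp hp (c • f)), MemLp.coeFn_toLp (S.memLp hp f),
      S.qmp.ae (Lp.coeFn_smul c f), Lp.coeFn_smul c ((S.memLp hp f).toLp _)] with x h1 h2 h4 h5
    rw [h1, RingHom.id_apply, h5, Pi.smul_apply, h2, h4, Pi.smul_apply, smul_mul_assoc]
  norm_map' f := by
    simp only [LinearMap.coe_mk, AddHom.coe_mk]
    rw [Lp.norm_toLp, S.eLpNorm_eq hp (Lp.aestronglyMeasurable f), Lp.norm_def]

theorem coeFn_isom [Fact (1 ≤ p)] (hp : p ≠ ∞) (f : Lp ℂ p μ) :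
    S.isom hp f =ᵐ[μ] fun y => f (S.φ y) * S.h y :=
  MemLp.coeFn_toLp (S.memLp hp f)

theorem isom_surjective [Fact (1 ≤ p)] (hp : p ≠ ∞) : Function.Surjective (S.isom hp) := by
  intro g
  have hp0 : 0 < p.toReal :=
    ENNReal.toReal_pos (zero_lt_one.trans_le (Fact.out : 1 ≤ p)).ne' hp
  have hsf : SigmaFinite (μ.map S.φ.symm) :=
    S.φ.symm.toHomeomorph.toMeasurableEquiv.sigmaFinite_map
  have hne : ∀ᵐ y ∂μ, S.h y ≠ 0 := by
    filter_upwards [S.enorm_h, Measure.rnDeriv_pos' S.ac_comp] with y h1 h2 h0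
    rw [h0, enorm_zero, ENNReal.zero_rpow_of_pos hp0] at h1
    exact h2.ne h1
  let f : X → ℂ := fun z => g (S.φ.symm z) * (S.h (S.φ.symm z))⁻¹
  have hf : AEStronglyMeasurable f μ :=
    ((Lp.aestronglyMeasurable g).mul
      S.measurable_h.inv.aestronglyMeasurable).comp_quasiMeasurePreserving S.qmp_symm
  have hfg : (fun y => f (S.φ y) * S.h y) =ᵐ[μ] g := by
    filter_upwards [hne] with y hy
    simp only [f, S.φ.symm_apply_apply]
    rw [mul_assoc, inv_mul_cancel₀ hy, mul_one]
  have hfm : MemLp f p μ := ⟨hf, by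
    rw [← S.eLpNorm_eq hp hf, eLpNorm_congr_ae hfg]; exact Lp.eLpNorm_lt_top g⟩
  refine ⟨hfm.toLp f, Lp.ext ?_⟩
  filter_upwards [S.coeFn_isom hp (hfm.toLp f), S.qmp.ae hfm.coeFn_toLp, hfg] with y h1 h2 h3
  rw [h1, h2, h3]

/-- The weighted shift `U f = (f ∘ φ) · h` on `L_p`, a surjective linear isometry. -/
noncomputable def U [Fact (1 ≤ p)] (hp : p ≠ ∞) : Lp ℂ p μ ≃ₗᵢ[ℂ] Lp ℂ p μ :=
  LinearIsometryEquiv.ofSurjective (S.isom hp) (S.isom_surjective hp)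

theorem coeFn_U [Fact (1 ≤ p)] (hp : p ≠ ∞) (f : Lp ℂ p μ) :
    S.U hp f =ᵐ[μ] fun y => f (S.φ y) * S.h y :=
  S.coeFn_isom hp f

/-- The shifted operator `U B U⁻¹`. -/
noncomputable def shifted [Fact (1 ≤ p)] (hp : p ≠ ∞) (B : Lp ℂ p μ →L[ℂ] Lp ℂ p μ) :
    Lp ℂ p μ →L[ℂ] Lp ℂ p μ :=
  (S.U hp).toContinuousLinearEquiv.toContinuousLinearMap ∘L B ∘L
    (S.U hp).symm.toContinuousLinearEquiv.toContinuousLinearMap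

end WeightedShift

end Shifts

/-! ### Operators on the range of a projection, limits, spectra -/

/-- For a projection `P` onto `M` and `A : M → M`, the operator `A P` on the whole space. -/
def extendByProj {E : Type*} [NormedAddCommGroup E] [NormedSpace ℂ E] {M : Submodule ℂ E}
    (P : E →L[ℂ] E) (hP : LinearMap.IsProj M (P : E →ₗ[ℂ] E)) (A : M →L[ℂ] M) : E →L[ℂ] E :=
  M.subtypeL ∘L A ∘L P.codRestrict M hP.map_mem

/-- `L` is the limit in the weak operator topology of `T x` as `x : X` tends to the point `y` of
the compactification `e : X → Y`, i.e. along the trace on `X` of the neighbourhood filter of `y`;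
equivalently, `T (x i)` tends weakly to `L` for every net `x i` in `X` with `e (x i) → y`. -/
def IsWeakLimitAt {X Y E F : Type*} [TopologicalSpace Y]
    [NormedAddCommGroup E] [NormedSpace ℂ E] [NormedAddCommGroup F] [NormedSpace ℂ F]
    (e : X → Y) (y : Y) (T : X → E →L[ℂ] F) (L : E →L[ℂ] F) : Prop :=
  Tendsto (fun x => ContinuousLinearMapWOT.ofCLM (T x)) (comap e (𝓝 y))
    (𝓝 (ContinuousLinearMapWOT.ofCLM L))

/-- The essential spectrum: all `z` such that `A - z` is not Fredholm. -/
def essSpectrum {E : Type*} [NormedAddCommGroup E] [NormedSpace ℂ E] (A : E →L[ℂ] E) : Set ℂ :=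
  {z | ¬ (A - z • ContinuousLinearMap.id ℂ E).IsFredholm}

end LimitOp

/-! Write `T = AP + (1 - P)`, a band-dominated operator on all of `L_p`. Unlike `A` it lives on a
space that is invariant under multiplication by indicators, and its limit operators are `A_y P_y +
(1 - P_y)`, which are invertible exactly when the `A_y` are invertible on `ran P_y`.

The weak limits first have to become norm limits after a cutoff on either side. For `P` the
extension to the Stone-Čech compactification gives norm limits of two-sided truncations, and the
off-diagonal decay, uniform over all shifts, removes one cutoff (`UnifBand.locTendsto`). For `AP`
the compactness of `P_y` times a cutoff upgrades weak convergence
(`UnifBand.locTendsto_of_compact`).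

If `A` is Fredholm, it has a regularizer modulo compact operators. Shifted compact operators vanish
at infinity, so the shifted identities `BA = 1 - K` and `AB = 1 - K'` pass to the limit and make
`A_y` bounded below and surjective, although the shifts of `B` need not converge
(`bijective_limit_of_regularizer`).

Conversely, let every `A_y` be invertible; no uniform bound on the inverses is assumed. By property
A', a band-dominated operator nearly attains its lower norm on vectors supported in balls of a fixed
radius (`Decomp.exists_localized`). If `T` were not bounded below on vectors supported far out,
repeated localization would give, around centres `z n` going to infinity, vectors at every scale `k`
with quotient at most `2 * (1 / 2) ^ k` and support radius depending on `k` only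
(`Decomp.exists_localized_chain`). A single limit operator at a cluster point of the centres would
then have lower norm zero, a contradiction (`Decomp.exists_far_lower_bound`).

All of this is done for an abstract `ℓ^s`-decomposition. The dual of an `ℓ^p`-decomposition is an
`ℓ^q`-decomposition (`Decomp.dual`), so the transpose of `T` is covered too. Since `P` times a
cutoff is compact, the two bounds say that `A` and its transpose are bounded below modulo compact
operators, whence `A` is Fredholm (`isFredholm_of_lower_bounds`). The spectral identity is the same
equivalence for `A - z`. -/

namespace LimitOp

/-! ### Decompositions of a Banach space as an `ℓ^s`-sum, and their duals -/

/-- The transpose `ψ ↦ ψ ∘ A` of an operator, acting on the dual space. -/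
noncomputable def transpose {F : Type*} [NormedAddCommGroup F] [NormedSpace ℂ F]
    (A : F →L[ℂ] F) : (F →L[ℂ] ℂ) →L[ℂ] (F →L[ℂ] ℂ) :=
  ContinuousLinearMap.precomp ℂ A

/-- A family of mutually orthogonal idempotents exhibiting `F` as an `ℓ^s`-sum of their ranges. -/
structure Decomp {L F : Type*} [NormedAddCommGroup F] [NormedSpace ℂ F] (s : ℝ)
    (Q : L → F →L[ℂ] F) : Prop where
  one_lt : 1 < s
  idem : ∀ l f, Q l (Q l f) = Q l f
  orth : ∀ l k, l ≠ k → ∀ f, Q l (Q k f) = 0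
  norm_eq : ∀ f, ‖f‖ₑ ^ s = ∑' l, ‖Q l f‖ₑ ^ s

namespace Decomp

variable {L F : Type*} [NormedAddCommGroup F] [NormedSpace ℂ F] {s : ℝ} {Q : L → F →L[ℂ] F}

theorem pos (hQ : Decomp s Q) : 0 < s := zero_lt_one.trans hQ.one_lt

theorem apply_sum [DecidableEq L] (hQ : Decomp s Q) (t : Finset L) (c : L → ℂ) (u : L → F) (k : L) :
    Q k (∑ l ∈ t, c l • Q l (u l)) = if k ∈ t then c k • Q k (u k) else 0 := by
  rw [map_sum]
  have : ∀ l ∈ t, Q k (c l • Q l (u l)) = if k = l then c k • Q k (u k) else 0 := by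
    intro l _
    rw [map_smul]
    split_ifs with h
    · subst h; rw [hQ.idem]
    · rw [hQ.orth k l h, smul_zero]
  rw [Finset.sum_congr rfl this, Finset.sum_ite_eq]

theorem enorm_sum (hQ : Decomp s Q) (t : Finset L) (c : L → ℂ) (u : L → F) :
    ‖∑ l ∈ t, c l • Q l (u l)‖ₑ ^ s = ∑ l ∈ t, ‖c l‖ₑ ^ s * ‖Q l (u l)‖ₑ ^ s := by
  classical
  rw [hQ.norm_eq, tsum_eq_sum (s := t)]
  · refine Finset.sum_congr rfl fun l hl => ?_
    rw [hQ.apply_sum, if_pos hl, enorm_smul, ENNReal.mul_rpow_of_nonneg _ _ hQ.pos.le]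
  · intro l hl
    rw [hQ.apply_sum, if_neg hl, enorm_zero, ENNReal.zero_rpow_of_pos hQ.pos]

theorem eq_zero (hQ : Decomp s Q) {f : F} (h : ∀ l, Q l f = 0) : f = 0 := by
  have := hQ.norm_eq f
  simp only [h, enorm_zero, ENNReal.zero_rpow_of_pos hQ.pos, tsum_zero] at this
  rw [ENNReal.rpow_eq_zero_iff_of_pos hQ.pos] at this
  simpa using this

theorem hasSum (hQ : Decomp s Q) (f : F) : HasSum (fun l => Q l f) f := by
  classical
  have hfin : ∑' l, ‖Q l f‖ₑ ^ s ≠ ∞ := by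
    rw [← hQ.norm_eq]
    exact ENNReal.rpow_ne_top_of_nonneg hQ.pos.le enorm_ne_top
  have h1 : ∀ t : Finset L, ‖∑ l ∈ t, Q l f - f‖ₑ ^ s = ∑' l : { x // x ∉ t }, ‖Q l f‖ₑ ^ s := by
    intro t
    rw [hQ.norm_eq]
    refine Eq.trans ?_ (tsum_subtype {x | x ∉ t} fun l => ‖Q l f‖ₑ ^ s).symm
    refine tsum_congr fun k => ?_
    have := hQ.apply_sum t (fun _ => 1) (fun _ => f) k
    simp only [one_smul] at this
    rw [map_sub, this]
    by_cases hk : k ∈ t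
    · simp [hk, ENNReal.zero_rpow_of_pos hQ.pos]
    · simp [hk]
  have h2 := ENNReal.tendsto_tsum_compl_atTop_zero hfin
  have h3 : Tendsto (fun t : Finset L => ‖∑ l ∈ t, Q l f - f‖ₑ) atTop (𝓝 0) := by
    have h4 : Tendsto (fun t : Finset L => (‖∑ l ∈ t, Q l f - f‖ₑ ^ s) ^ (1 / s)) atTop
        (𝓝 (0 ^ (1 / s))) := by
      simp_rw [h1]
      exact (ENNReal.continuous_rpow_const.tendsto _).comp h2
    rw [ENNReal.zero_rpow_of_pos (one_div_pos.2 hQ.pos)] at h4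
    refine h4.congr fun t => ?_
    rw [← ENNReal.rpow_mul, mul_one_div_cancel hQ.pos.ne', ENNReal.rpow_one]
  have h5 : Tendsto (fun t : Finset L => ‖∑ l ∈ t, Q l f - f‖) atTop (𝓝 0) := by
    have := (ENNReal.tendsto_toReal ENNReal.zero_ne_top).comp h3
    simpa [Function.comp_def] using this
  exact tendsto_iff_norm_sub_tendsto_zero.2 h5

theorem enorm_apply_le (hQ : Decomp s Q) (l : L) (f : F) : ‖Q l f‖ₑ ≤ ‖f‖ₑ := by
  rw [← ENNReal.rpow_le_rpow_iff hQ.pos, hQ.norm_eq f]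
  exact ENNReal.le_tsum (f := fun l => ‖Q l f‖ₑ ^ s) l

/-- The dual of an `ℓ^p`-decomposition is an `ℓ^q`-decomposition. -/
theorem dual {q : ℝ} (hQ : Decomp s Q) (hsq : s.HolderConjugate q) :
    Decomp q fun l => transpose (Q l) := by
  have hq := hsq.symm.lt
  have hq0 := hsq.symm.pos
  refine ⟨hq, fun l ψ => ?_, fun l k hlk ψ => ?_, fun ψ => le_antisymm ?_ ?_⟩
  · ext f; simp [transpose, hQ.idem]
  · ext f; simp [transpose, hQ.orth k l hlk.symm]
  · have key : ‖ψ‖ₑ ≤ (∑' l, ‖transpose (Q l) ψ‖ₑ ^ q) ^ (1 / q) := by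
      refine ContinuousLinearMap.opENorm_le_bound _ fun f => ?_
      calc ‖ψ f‖ₑ ≤ ∑' l, ‖ψ (Q l f)‖ₑ := by
            rw [← ((hQ.hasSum f).mapL ψ).tsum_eq]
            exact enorm_tsum_le_tsum_enorm
        _ ≤ ∑' l, ‖transpose (Q l) ψ‖ₑ * ‖Q l f‖ₑ := by
            refine ENNReal.tsum_le_tsum fun l => ?_
            have := (transpose (Q l) ψ).le_opENorm (Q l f)
            simpa [transpose, hQ.idem] using this
        _ ≤ (∑' l, ‖transpose (Q l) ψ‖ₑ ^ q) ^ (1 / q) * (∑' l, ‖Q l f‖ₑ ^ s) ^ (1 / s) := by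
            rw [ENNReal.tsum_eq_iSup_sum]
            refine iSup_le fun t => (ENNReal.inner_le_Lp_mul_Lq t _ _ hsq.symm).trans ?_
            gcongr
            · exact ENNReal.sum_le_tsum t
            · exact (one_div_pos.2 hQ.pos).le
            · exact ENNReal.sum_le_tsum t
        _ = (∑' l, ‖transpose (Q l) ψ‖ₑ ^ q) ^ (1 / q) * ‖f‖ₑ := by
            rw [← hQ.norm_eq, ← ENNReal.rpow_mul, mul_one_div_cancel hQ.pos.ne', ENNReal.rpow_one]
    calc ‖ψ‖ₑ ^ q ≤ ((∑' l, ‖transpose (Q l) ψ‖ₑ ^ q) ^ (1 / q)) ^ q := by gcongr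
      _ = _ := by rw [← ENNReal.rpow_mul, one_div_mul_cancel hq0.ne', ENNReal.rpow_one]
  · rw [ENNReal.tsum_eq_iSup_sum]
    refine iSup_le fun t => ?_
    set a : L → ℝ := fun l => ‖transpose (Q l) ψ‖ with ha
    have ha0 : ∀ l, 0 ≤ a l := fun l => norm_nonneg _
    have main : ∑ l ∈ t, a l ^ q ≤ ‖ψ‖ ^ q := by
      -- The components of `ψ` need not attain their norms. Nearly norming vectors cost a factor
      -- `θ`, which tends to 1 at the end.
      have hθ : ∀ θ ∈ Ioo (0 : ℝ) 1, θ ^ q * ∑ l ∈ t, a l ^ q ≤ ‖ψ‖ ^ q := by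
        intro θ hθ
        have hex : ∀ l, ∃ v : F, ‖Q l v‖ ≤ 1 ∧ ∃ b : ℝ, ψ (Q l v) = b ∧ θ * a l ≤ b := by
          intro l
          rcases (ha0 l).eq_or_lt with h0 | h0
          · exact ⟨0, by simp, 0, by simp [← h0]⟩
          · obtain ⟨v, hv1, hv2⟩ := (transpose (Q l) ψ).exists_lt_apply_of_lt_opNorm
              (r := θ * a l) (by have := hθ.2; have := h0; simp only [ha] at *; nlinarith)
            have hv2' : θ * a l < ‖ψ (Q l v)‖ := by simpa [transpose] using hv2
            have hpos : 0 < ‖ψ (Q l v)‖ := (mul_nonneg hθ.1.le (ha0 l)).trans_lt hv2'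
            have hQv : ‖Q l v‖ ≤ 1 := by
              have := hQ.enorm_apply_le l v
              rw [enorm_le_iff_norm_le] at this
              exact this.trans hv1.le
            refine ⟨((‖ψ (Q l v)‖ : ℂ) / ψ (Q l v)) • v, ?_, ‖ψ (Q l v)‖, ?_, hv2'.le⟩
            · rw [map_smul, norm_smul, norm_div, Complex.norm_real, norm_norm,
                div_self hpos.ne', one_mul]
              exact hQv
            · rw [map_smul, map_smul, smul_eq_mul, div_mul_cancel₀ _ (norm_pos_iff.1 hpos)]
        choose v hv b hb hab using hex
        have hb0 : ∀ l, 0 ≤ b l := fun l => (mul_nonneg hθ.1.le (ha0 l)).trans (hab l)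
        have hle : θ ^ q * ∑ l ∈ t, a l ^ q ≤ ∑ l ∈ t, b l ^ q := by
          rw [Finset.mul_sum]
          refine Finset.sum_le_sum fun l _ => ?_
          rw [← Real.mul_rpow hθ.1.le (ha0 l)]
          exact Real.rpow_le_rpow (mul_nonneg hθ.1.le (ha0 l)) (hab l) hq0.le
        refine hle.trans ?_
        set S := ∑ l ∈ t, b l ^ q with hS
        have hS0 : 0 ≤ S := Finset.sum_nonneg fun l _ => Real.rpow_nonneg (hb0 l) _
        -- The extremal vector of Hölder's inequality: since `(q - 1) * s = q`, both `ψ f = S` and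
        -- `‖f‖ ^ s ≤ S`.
        set f := ∑ l ∈ t, ((b l ^ (q - 1) : ℝ) : ℂ) • Q l (v l) with hf
        have hψf : ψ f = S := by
          rw [hf, map_sum, hS, Complex.ofReal_sum]
          refine Finset.sum_congr rfl fun l _ => ?_
          rw [map_smul, hb, smul_eq_mul, ← Complex.ofReal_mul]
          congr 1
          rcases (hb0 l).eq_or_lt with h0 | h0
          · rw [← h0, mul_zero, Real.zero_rpow hq0.ne']
          · rw [Real.rpow_sub_one h0.ne', div_mul_cancel₀ _ h0.ne']
        have hfS : ‖f‖ ^ s ≤ S := by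
          have h1 : ‖f‖ₑ ^ s ≤ ENNReal.ofReal S := by
            rw [hf, hQ.enorm_sum, hS, ENNReal.ofReal_sum_of_nonneg
              fun l _ => Real.rpow_nonneg (hb0 l) _]
            refine Finset.sum_le_sum fun l _ => ?_
            calc ‖((b l ^ (q - 1) : ℝ) : ℂ)‖ₑ ^ s * ‖Q l (v l)‖ₑ ^ s
                ≤ ‖((b l ^ (q - 1) : ℝ) : ℂ)‖ₑ ^ s * 1 := by
                  gcongr
                  refine ENNReal.rpow_le_one ?_ hQ.pos.le
                  rw [← ofReal_norm]
                  exact ENNReal.ofReal_le_one.2 (hv l)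
              _ = ENNReal.ofReal (b l ^ q) := by
                  rw [mul_one, ← ofReal_norm, Complex.norm_real, Real.norm_of_nonneg
                    (Real.rpow_nonneg (hb0 l) _), ENNReal.ofReal_rpow_of_nonneg
                    (Real.rpow_nonneg (hb0 l) _) hQ.pos.le, ← Real.rpow_mul (hb0 l)]
                  congr 2
                  have := hsq.symm.sub_one_mul_conj
                  exact this
          rw [← ofReal_norm, ENNReal.ofReal_rpow_of_nonneg (norm_nonneg _) hQ.pos.le,
            ENNReal.ofReal_le_ofReal_iff hS0] at h1
          exact h1
        have hfS' : ‖f‖ ≤ S ^ (1 / s) := by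
          calc ‖f‖ = (‖f‖ ^ s) ^ (1 / s) := by
                rw [← Real.rpow_mul (norm_nonneg _), mul_one_div_cancel hQ.pos.ne', Real.rpow_one]
            _ ≤ _ := Real.rpow_le_rpow (Real.rpow_nonneg (norm_nonneg _) _) hfS
              (one_div_pos.2 hQ.pos).le
        have hSψ : S ≤ ‖ψ‖ * S ^ (1 / s) := by
          calc S = ‖ψ f‖ := by rw [hψf, Complex.norm_real, Real.norm_of_nonneg hS0]
            _ ≤ ‖ψ‖ * ‖f‖ := ψ.le_opNorm f
            _ ≤ _ := by gcongr
        rcases hS0.eq_or_lt with h0 | h0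
        · rw [← h0]; exact Real.rpow_nonneg (norm_nonneg _) _
        · have h1 : S ^ (1 / q) ≤ ‖ψ‖ := by
            have h2 : S = S ^ (1 / q) * S ^ (1 / s) := by
              rw [← Real.rpow_add h0]
              have := hsq.symm.inv_add_inv_eq_one
              rw [one_div, one_div, this, Real.rpow_one]
            have h3 : S ^ (1 / q) * S ^ (1 / s) ≤ ‖ψ‖ * S ^ (1 / s) := h2 ▸ hSψ
            exact le_of_mul_le_mul_right h3 (Real.rpow_pos_of_pos h0 _)
          calc S = (S ^ (1 / q)) ^ q := by
                rw [← Real.rpow_mul hS0, one_div_mul_cancel hq0.ne', Real.rpow_one]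
            _ ≤ _ := Real.rpow_le_rpow (Real.rpow_nonneg hS0 _) h1 hq0.le
      have hlim : Tendsto (fun θ : ℝ => θ ^ q * ∑ l ∈ t, a l ^ q) (𝓝[<] 1)
          (𝓝 ((1 : ℝ) ^ q * ∑ l ∈ t, a l ^ q)) :=
        ((Real.continuousAt_rpow_const 1 q (Or.inl one_ne_zero)).tendsto.mono_left
          nhdsWithin_le_nhds).mul_const _
      rw [Real.one_rpow, one_mul] at hlim
      refine le_of_tendsto hlim ?_
      filter_upwards [Ioo_mem_nhdsLT (zero_lt_one (α := ℝ))] with θ h using hθ θ h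
    calc ∑ l ∈ t, ‖transpose (Q l) ψ‖ₑ ^ q = ENNReal.ofReal (∑ l ∈ t, a l ^ q) := by
          rw [ENNReal.ofReal_sum_of_nonneg fun l _ => Real.rpow_nonneg (ha0 l) _]
          refine Finset.sum_congr rfl fun l _ => ?_
          rw [← ofReal_norm, ENNReal.ofReal_rpow_of_nonneg (norm_nonneg _) hq0.le]
      _ ≤ ENNReal.ofReal (‖ψ‖ ^ q) := ENNReal.ofReal_le_ofReal main
      _ = ‖ψ‖ₑ ^ q := by
          rw [← ofReal_norm, ENNReal.ofReal_rpow_of_nonneg (norm_nonneg _) hq0.le]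

end Decomp

/-! ### Localization of the lower norm of band-dominated operators -/

/-- Uniform bound for the number of points in balls of a discrete space. -/
def UniformlyFinite (L : Type*) [PseudoMetricSpace L] : Prop :=
  ∀ r : ℝ, ∃ N : ℕ, ∀ k : L, ∃ h : (Metric.closedBall k r).Finite, h.toFinset.card ≤ N

/-- Property A in terms of partitions of unity on a discrete space. -/
def DiscretePropertyA (L : Type*) [PseudoMetricSpace L] : Prop :=
  ∀ t : ℝ, 0 < t → ∃ ρ : ℕ → L → ℝ,
    (∀ j l, 0 ≤ ρ j l) ∧
    (∀ l, ∑' j, ENNReal.ofReal (ρ j l) = 1) ∧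
    (∃ D : ℝ, ∀ j l k, ρ j l ≠ 0 → ρ j k ≠ 0 → dist l k ≤ D) ∧
    (∀ l k, dist l k ≤ 1 / t → ∑' j, ENNReal.ofReal |ρ j l - ρ j k| ≤ ENNReal.ofReal t)

section

variable {L F : Type*} [PseudoMetricSpace L] [NormedAddCommGroup F] [NormedSpace ℂ F]

/-- `T` is a norm limit of operators with finite propagation with respect to `Q`. -/
def BandDominated (Q : L → F →L[ℂ] F) (T : F →L[ℂ] F) : Prop :=
  ∀ η : ℝ, 0 < η → ∃ T' : F →L[ℂ] F,
    (∃ ω : ℝ, ∀ k l, ω < dist k l → Q k ∘L T' ∘L Q l = 0) ∧ ‖T - T'‖ ≤ η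

theorem BandDominated.transpose {Q : L → F →L[ℂ] F} {T : F →L[ℂ] F} (hT : BandDominated Q T) :
    BandDominated (fun l => transpose (Q l)) (transpose T) := by
  intro η hη
  obtain ⟨T', ⟨ω, hω⟩, h⟩ := hT η hη
  refine ⟨LimitOp.transpose T', ⟨ω, fun k l hkl => ?_⟩, ?_⟩
  · ext ψ f
    have := congrArg (fun B : F →L[ℂ] F => ψ (B f)) (hω l k (by rwa [dist_comm]))
    simpa [LimitOp.transpose] using this
  · refine ContinuousLinearMap.opNorm_le_bound _ hη.le fun ψ => ?_
    have : (LimitOp.transpose T - LimitOp.transpose T') ψ = ψ ∘L (T - T') := by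
      ext f; simp [LimitOp.transpose]
    rw [this, mul_comm]
    exact (ψ.opNorm_comp_le _).trans (by gcongr)

/-- Subadditivity of `t ↦ t ^ (1 / s)`. It turns the `ℓ¹`-variation of a partition of unity into
`ℓ^s`-variation of the roots `ρ ^ (1 / s)`, which serve as localizing weights. -/
theorem abs_rpow_sub_rpow_le {s a b : ℝ} (hs : 1 < s) (ha : 0 ≤ a) (hb : 0 ≤ b) :
    |a ^ (1 / s) - b ^ (1 / s)| ^ s ≤ |a - b| := by
  have hs0 : 0 < s := by linarith
  wlog hab : b ≤ a generalizing a b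
  · rw [abs_sub_comm, abs_sub_comm a b]
    exact this hb ha (le_of_not_ge hab)
  have h1 : a ^ (1 / s) ≤ (a - b) ^ (1 / s) + b ^ (1 / s) := by
    have := Real.rpow_add_le_add_rpow (sub_nonneg.2 hab) hb (one_div_pos.2 hs0).le
      ((div_le_one hs0).2 hs.le)
    simpa using this
  have h2 : b ^ (1 / s) ≤ a ^ (1 / s) := Real.rpow_le_rpow hb hab (one_div_pos.2 hs0).le
  rw [abs_of_nonneg (sub_nonneg.2 h2), abs_of_nonneg (sub_nonneg.2 hab)]
  calc (a ^ (1 / s) - b ^ (1 / s)) ^ s ≤ ((a - b) ^ (1 / s)) ^ s :=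
        Real.rpow_le_rpow (sub_nonneg.2 h2) (by linarith) hs0.le
    _ = a - b := by
        rw [← Real.rpow_mul (sub_nonneg.2 hab), one_div_mul_cancel hs0.ne', Real.rpow_one]

namespace Decomp

variable {s : ℝ} {Q : L → F →L[ℂ] F}

theorem apply_eq_sum_of_propagation (hQ : Decomp s Q) {T : F →L[ℂ] F} {ω : ℝ}
    (hω : ∀ k l, ω < dist k l → Q k ∘L T ∘L Q l = 0) (k : L) (t : Finset L)
    (ht : ∀ l, dist l k ≤ ω → l ∈ t) (u : F) :
    Q k (T u) = ∑ l ∈ t, Q k (T (Q l u)) := by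
  have h1 : HasSum (fun l => Q k (T (Q l u))) (Q k (T u)) :=
    (hQ.hasSum u).mapL (Q k ∘L T)
  refine h1.unique (hasSum_sum_of_ne_finset_zero fun l hl => ?_)
  have : ω < dist k l := by
    rw [dist_comm]; exact not_le.1 fun h => hl (ht l h)
  exact congrArg (fun B : F →L[ℂ] F => B u) (hω k l this)

/-- Commutators of a finite propagation operator with a slowly varying `ℓ^s`-partition of unity
are small. -/
theorem tsum_commutator_le (hQ : Decomp s Q) {T : F →L[ℂ] F} {ω t : ℝ} {N : ℕ}
    (hω : ∀ k l, ω < dist k l → Q k ∘L T ∘L Q l = 0)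
    (hN : ∀ k : L, ∃ h : (Metric.closedBall k ω).Finite, h.toFinset.card ≤ N)
    {ρ : ℕ → L → ℝ} (hρ0 : ∀ j l, 0 ≤ ρ j l)
    (hρ : ∀ l k, dist l k ≤ ω → ∑' j, ENNReal.ofReal |ρ j l - ρ j k| ≤ ENNReal.ofReal t)
    (f : F) (g h : ℕ → F)
    (hg : ∀ j k, Q k (g j) = ((ρ j k ^ (1 / s) : ℝ) : ℂ) • Q k f)
    (hh : ∀ j k, Q k (h j) = ((ρ j k ^ (1 / s) : ℝ) : ℂ) • Q k (T f)) :
    ∑' j, ‖T (g j) - h j‖ₑ ^ s ≤ (N : ℝ≥0∞) ^ s * ENNReal.ofReal t * (‖T‖ₑ * ‖f‖ₑ) ^ s := by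
  classical
  have hs0 := hQ.pos
  have hs1 : 0 ≤ s - 1 := by linarith [hQ.one_lt]
  set n : L → Finset L := fun k => (hN k).choose.toFinset with hn
  have hmem : ∀ k l, l ∈ n k ↔ dist l k ≤ ω := fun k l => by simp [hn]
  have hcard : ∀ k, (n k).card ≤ N := fun k => (hN k).choose_spec
  have hstep : ∀ j k, ‖Q k (T (g j) - h j)‖ₑ ^ s ≤ (N : ℝ≥0∞) ^ (s - 1) *
      ∑ l ∈ n k, ENNReal.ofReal |ρ j l - ρ j k| * (‖T‖ₑ * ‖Q l f‖ₑ) ^ s := by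
    intro j k
    -- The `(k, l)` entry of the commutator is the entry of `T` times the difference of the weights
    -- at `l` and `k`. Finite propagation leaves at most `N` values of `l`.
    have h1 : Q k (T (g j) - h j) = ∑ l ∈ n k,
        (((ρ j l ^ (1 / s) - ρ j k ^ (1 / s) : ℝ) : ℂ) • Q k (T (Q l f))) := by
      rw [map_sub, hh, hQ.apply_eq_sum_of_propagation hω k (n k) (fun l hl => (hmem k l).2 hl),
        hQ.apply_eq_sum_of_propagation hω k (n k) (fun l hl => (hmem k l).2 hl) f,
        Finset.smul_sum, ← Finset.sum_sub_distrib]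
      refine Finset.sum_congr rfl fun l _ => ?_
      rw [hg, map_smul, map_smul, ← sub_smul, Complex.ofReal_sub]
    rw [h1]
    calc ‖∑ l ∈ n k, (((ρ j l ^ (1 / s) - ρ j k ^ (1 / s) : ℝ) : ℂ) • Q k (T (Q l f)))‖ₑ ^ s
        ≤ (∑ l ∈ n k, ‖((ρ j l ^ (1 / s) - ρ j k ^ (1 / s) : ℝ) : ℂ)‖ₑ *
            (‖T‖ₑ * ‖Q l f‖ₑ)) ^ s := by
          gcongr
          refine (enorm_sum_le _ _).trans (Finset.sum_le_sum fun l _ => ?_)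
          rw [enorm_smul]
          gcongr
          exact (hQ.enorm_apply_le _ _).trans (T.le_opENorm _)
      _ ≤ ((n k).card : ℝ≥0∞) ^ (s - 1) * ∑ l ∈ n k,
            (‖((ρ j l ^ (1 / s) - ρ j k ^ (1 / s) : ℝ) : ℂ)‖ₑ * (‖T‖ₑ * ‖Q l f‖ₑ)) ^ s :=
          ENNReal.rpow_sum_le_const_mul_sum_rpow _ _ hQ.one_lt.le
      _ ≤ _ := by
          gcongr with l _
          · exact_mod_cast hcard k
          · rw [ENNReal.mul_rpow_of_nonneg _ _ hs0.le]
            gcongr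
            rw [← ofReal_norm, Complex.norm_real, Real.norm_eq_abs,
              ENNReal.ofReal_rpow_of_nonneg (abs_nonneg _) hs0.le]
            exact ENNReal.ofReal_le_ofReal
              (abs_rpow_sub_rpow_le hQ.one_lt (hρ0 j l) (hρ0 j k))
  have hstep2 : ∀ k, ∑' j, ‖Q k (T (g j) - h j)‖ₑ ^ s ≤ (N : ℝ≥0∞) ^ (s - 1) *
      (ENNReal.ofReal t * ∑ l ∈ n k, (‖T‖ₑ * ‖Q l f‖ₑ) ^ s) := by
    intro k
    calc ∑' j, ‖Q k (T (g j) - h j)‖ₑ ^ s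
        ≤ ∑' j, (N : ℝ≥0∞) ^ (s - 1) *
          ∑ l ∈ n k, ENNReal.ofReal |ρ j l - ρ j k| * (‖T‖ₑ * ‖Q l f‖ₑ) ^ s :=
          ENNReal.tsum_le_tsum fun j => hstep j k
      _ = (N : ℝ≥0∞) ^ (s - 1) *
          ∑ l ∈ n k, (∑' j, ENNReal.ofReal |ρ j l - ρ j k|) * (‖T‖ₑ * ‖Q l f‖ₑ) ^ s := by
          rw [ENNReal.tsum_mul_left, Summable.tsum_finsetSum fun _ _ => ENNReal.summable]
          simp_rw [ENNReal.tsum_mul_right]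
      _ ≤ _ := by
          rw [Finset.mul_sum (n k) _ (ENNReal.ofReal t)]
          gcongr with l hl
          exact hρ l k ((hmem k l).1 hl)
  -- Each `l` lies in `n k` for at most `N` indices `k`. This factor `N` and the factor `N ^ (s -
  -- 1)` from the power mean inequality make up `N ^ s`.
  have hcount : ∑' k, ∑ l ∈ n k, (‖T‖ₑ * ‖Q l f‖ₑ) ^ s ≤ N * (‖T‖ₑ * ‖f‖ₑ) ^ s := by
    have h1 : ∀ k, ∑ l ∈ n k, (‖T‖ₑ * ‖Q l f‖ₑ) ^ s =
        ∑' l, (if k ∈ n l then 1 else 0) * (‖T‖ₑ * ‖Q l f‖ₑ) ^ s := by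
      intro k
      have hsymm : ∀ l, k ∈ n l ↔ l ∈ n k := fun l => by rw [hmem, hmem, dist_comm]
      rw [tsum_eq_sum (s := n k)]
      · refine Finset.sum_congr rfl fun l hl => ?_
        rw [if_pos ((hsymm l).2 hl), one_mul]
      · intro l hl
        rw [if_neg fun h => hl ((hsymm l).1 h), zero_mul]
    simp_rw [h1]
    rw [ENNReal.tsum_comm]
    calc ∑' l, ∑' k, (if k ∈ n l then 1 else 0) * (‖T‖ₑ * ‖Q l f‖ₑ) ^ s
        ≤ ∑' l, (N : ℝ≥0∞) * (‖T‖ₑ * ‖Q l f‖ₑ) ^ s := by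
          refine ENNReal.tsum_le_tsum fun l => ?_
          rw [ENNReal.tsum_mul_right]
          gcongr
          rw [tsum_eq_sum (s := n l) fun k hk => if_neg hk,
            Finset.sum_congr rfl fun k hk => if_pos hk]
          simpa using hcard l
      _ = N * (‖T‖ₑ * ‖f‖ₑ) ^ s := by
          rw [ENNReal.tsum_mul_left]
          simp_rw [ENNReal.mul_rpow_of_nonneg _ _ hs0.le]
          rw [ENNReal.tsum_mul_left, hQ.norm_eq f]
  calc ∑' j, ‖T (g j) - h j‖ₑ ^ s = ∑' k, ∑' j, ‖Q k (T (g j) - h j)‖ₑ ^ s := by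
        rw [ENNReal.tsum_comm]
        exact tsum_congr fun j => hQ.norm_eq _
    _ ≤ ∑' k, (N : ℝ≥0∞) ^ (s - 1) *
      (ENNReal.ofReal t * ∑ l ∈ n k, (‖T‖ₑ * ‖Q l f‖ₑ) ^ s) :=
        ENNReal.tsum_le_tsum hstep2
    _ ≤ (N : ℝ≥0∞) ^ (s - 1) * (ENNReal.ofReal t * (N * (‖T‖ₑ * ‖f‖ₑ) ^ s)) := by
        rw [ENNReal.tsum_mul_left, ENNReal.tsum_mul_left]
        gcongr
    _ = _ := by
        have : (N : ℝ≥0∞) ^ s = (N : ℝ≥0∞) ^ (s - 1) * N := by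
          rcases Nat.eq_zero_or_pos N with h0 | h0
          · subst h0
            simp [ENNReal.zero_rpow_of_pos hs0]
          · have hN0 : (N : ℝ≥0∞) ≠ 0 := by exact_mod_cast h0.ne'
            conv_rhs => rw [← ENNReal.rpow_one (N : ℝ≥0∞)]
            rw [ENNReal.rpow_one, ← ENNReal.rpow_one (N : ℝ≥0∞), ← ENNReal.rpow_mul,
              ← ENNReal.rpow_mul, ← ENNReal.rpow_add _ _ (by simpa using hN0) (by simp)]
            congr 1; ring
        rw [this]; ring

omit [PseudoMetricSpace L] in
theorem exists_weighted (hQ : Decomp s Q) (w : L → ℝ) (t : Finset L) (ht : ∀ l, w l ≠ 0 → l ∈ t)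
    (f : F) : ∃ g : F, ∀ k, Q k g = (w k : ℂ) • Q k f := by
  classical
  refine ⟨∑ l ∈ t, (w l : ℂ) • Q l f, fun k => ?_⟩
  rw [hQ.apply_sum t (fun l => (w l : ℂ)) (fun _ => f)]
  split_ifs with h
  · rfl
  · have : w k = 0 := by_contra fun h' => h (ht k h')
    rw [this, Complex.ofReal_zero, zero_smul]

omit [PseudoMetricSpace L] in
-- The exponent `1 / s` makes the `s`-th powers of the weights sum to 1 over `j`; interchanging the
-- sums over `j` and `k` does the rest.
theorem tsum_weighted (hQ : Decomp s Q) {ρ : ℕ → L → ℝ} (hρ0 : ∀ j l, 0 ≤ ρ j l)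
    (hρ1 : ∀ l, ∑' j, ENNReal.ofReal (ρ j l) = 1) (f : F) (g : ℕ → F)
    (hg : ∀ j k, Q k (g j) = ((ρ j k ^ (1 / s) : ℝ) : ℂ) • Q k f) :
    ∑' j, ‖g j‖ₑ ^ s = ‖f‖ₑ ^ s := by
  have hs0 := hQ.pos
  have h1 : ∀ j k, ‖Q k (g j)‖ₑ ^ s = ENNReal.ofReal (ρ j k) * ‖Q k f‖ₑ ^ s := by
    intro j k
    rw [hg, enorm_smul, ENNReal.mul_rpow_of_nonneg _ _ hs0.le, ← ofReal_norm, Complex.norm_real,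
      Real.norm_of_nonneg (Real.rpow_nonneg (hρ0 j k) _),
      ENNReal.ofReal_rpow_of_nonneg (Real.rpow_nonneg (hρ0 j k) _) hs0.le,
      ← Real.rpow_mul (hρ0 j k), one_div_mul_cancel hs0.ne', Real.rpow_one]
  rw [tsum_congr fun j => hQ.norm_eq (g j), ENNReal.tsum_comm, hQ.norm_eq f]
  refine tsum_congr fun k => ?_
  rw [tsum_congr fun j => h1 j k, ENNReal.tsum_mul_right, hρ1, one_mul]

/-- A band-dominated operator nearly attains its lower norm on uniformly localized vectors. -/
theorem exists_localized (hQ : Decomp s Q) (hL : UniformlyFinite L) (hA : DiscretePropertyA L)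
    {T : F →L[ℂ] F} (hT : BandDominated Q T) {δ : ℝ} (hδ : 0 < δ) :
    ∃ r : ℝ, ∀ (f : F) (c : ℝ), f ≠ 0 → 0 ≤ c → ‖T f‖ ≤ c * ‖f‖ →
      ∃ g : F, g ≠ 0 ∧ (∀ l, Q l f = 0 → Q l g = 0) ∧
        (∃ z, ∀ l, Q l g ≠ 0 → dist l z ≤ r) ∧ ‖T g‖ ≤ (c + δ) * ‖g‖ := by
  have hs0 := hQ.pos
  -- Three errors of size `η` occur below: two from replacing `T` by `T'`, one from the commutator.
  -- So anything below `δ / 3` contradicts the excess `δ`.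
  set η : ℝ := δ / 4 with hη
  have hη0 : 0 < η := by positivity
  obtain ⟨T', ⟨ω, hω⟩, hTT'⟩ := hT η hη0
  obtain ⟨N, hN⟩ := hL ω
  -- The scale `1 / t` must cover the propagation of `T'`, and the commutator bound `N ^ s * t *
  -- ‖T'‖ ^ s` must not exceed `η ^ s`.
  obtain ⟨t, ht0, htω, htN⟩ : ∃ t : ℝ, 0 < t ∧ ω ≤ 1 / t ∧
      (N : ℝ) ^ s * t * ‖T'‖ ^ s ≤ η ^ s := by
    set a : ℝ := (N : ℝ) ^ s * ‖T'‖ ^ s with ha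
    have ha0 : 0 ≤ a := by positivity
    have hηs : 0 < η ^ s := Real.rpow_pos_of_pos hη0 _
    refine ⟨min (1 / (|ω| + 1)) (η ^ s / (a + 1)), by positivity, ?_, ?_⟩
    · have h1 : |ω| + 1 ≤ 1 / min (1 / (|ω| + 1)) (η ^ s / (a + 1)) := by
        rw [le_one_div (by positivity) (by positivity)]
        exact min_le_left _ _
      linarith [le_abs_self ω]
    · calc (N : ℝ) ^ s * min (1 / (|ω| + 1)) (η ^ s / (a + 1)) * ‖T'‖ ^ s
          = a * min (1 / (|ω| + 1)) (η ^ s / (a + 1)) := by rw [ha]; ring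
        _ ≤ a * (η ^ s / (a + 1)) := by gcongr; exact min_le_right _ _
        _ = η ^ s * (a / (a + 1)) := by ring
        _ ≤ η ^ s * 1 := by
            gcongr
            rw [div_le_one (by positivity)]; linarith
        _ = η ^ s := mul_one _
  obtain ⟨ρ, hρ0, hρ1, ⟨D, hD⟩, hρt⟩ := hA t ht0
  refine ⟨D, fun f c hf hc hTf => ?_⟩
  -- Otherwise every localized piece `g j` of `f` has quotient above `c + δ`. Summing `s`-th powers
  -- over `j` transfers this to `f`.
  by_contra! hcon
  have hfin : ∀ j, ∃ t : Finset L, ∀ l, ρ j l ^ (1 / s) ≠ 0 → l ∈ t := by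
    intro j
    by_cases hj : ∃ k, ρ j k ≠ 0
    · obtain ⟨k, hk⟩ := hj
      obtain ⟨M, hM⟩ := hL D
      refine ⟨(hM k).choose.toFinset, fun l hl => ?_⟩
      have : ρ j l ≠ 0 := fun h => hl (by rw [h, Real.zero_rpow (one_div_pos.2 hs0).ne'])
      simpa using hD j l k this hk
    · push Not at hj
      exact ⟨∅, fun l hl => (hl (by rw [hj, Real.zero_rpow (one_div_pos.2 hs0).ne'])).elim⟩
  choose tf htf using hfin
  choose g hg using fun j => hQ.exists_weighted (fun l => ρ j l ^ (1 / s)) (tf j) (htf j) f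
  choose h hh using fun j => hQ.exists_weighted (fun l => ρ j l ^ (1 / s)) (tf j) (htf j) (T' f)
  have hlow : ∀ j, (c + δ) * ‖g j‖ ≤ ‖T (g j)‖ := by
    intro j
    by_cases hgj : g j = 0
    · simp [hgj]
    · refine (hcon (g j) hgj (fun l hl => by rw [hg, hl, smul_zero]) ?_).le
      have : ∃ k, Q k (g j) ≠ 0 := by
        by_contra! h0
        exact hgj (hQ.eq_zero h0)
      obtain ⟨k, hk⟩ := this
      have hne : ∀ l, Q l (g j) ≠ 0 → ρ j l ≠ 0 := by
        intro l hl h0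
        apply hl
        rw [hg, h0, Real.zero_rpow (one_div_pos.2 hs0).ne', Complex.ofReal_zero, zero_smul]
      exact ⟨k, fun l hl => hD j l k (hne l hl) (hne k hk)⟩
  have hsum_g := hQ.tsum_weighted hρ0 hρ1 f g hg
  have hsum_h := hQ.tsum_weighted hρ0 hρ1 (T' f) h hh
  have hsum_d : ∑' j, ‖T' (g j) - h j‖ₑ ^ s ≤ (ENNReal.ofReal η * ‖f‖ₑ) ^ s := by
    refine (hQ.tsum_commutator_le hω hN hρ0
      (fun l k hlk => hρt l k (hlk.trans htω)) f g h hg hh).trans ?_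
    rw [ENNReal.mul_rpow_of_nonneg _ _ hs0.le, ENNReal.mul_rpow_of_nonneg _ _ hs0.le, ← mul_assoc]
    gcongr
    rw [← ofReal_norm, ENNReal.ofReal_rpow_of_nonneg (norm_nonneg _) hs0.le,
      ENNReal.ofReal_rpow_of_nonneg hη0.le hs0.le, ← ENNReal.ofReal_natCast,
      ENNReal.ofReal_rpow_of_nonneg (Nat.cast_nonneg _) hs0.le,
      ← ENNReal.ofReal_mul (by positivity), ← ENNReal.ofReal_mul (by positivity)]
    exact ENNReal.ofReal_le_ofReal htN
  have root : ∀ a : ℝ≥0∞, (a ^ s) ^ (1 / s) = a := fun a => by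
    rw [← ENNReal.rpow_mul, mul_one_div_cancel hs0.ne', ENNReal.rpow_one]
  -- Minkowski's inequality in `ℓ^s` for `T (g j) = (T - T') (g j) + (T' (g j) - h j) + h j`, over
  -- finite index sets.
  have hmain : ENNReal.ofReal (c + δ) * ‖f‖ₑ ≤
      ENNReal.ofReal η * ‖f‖ₑ + ENNReal.ofReal η * ‖f‖ₑ + ‖T' f‖ₑ := by
    rw [← ENNReal.rpow_le_rpow_iff hs0, ENNReal.mul_rpow_of_nonneg _ _ hs0.le, ← hsum_g,
      ← ENNReal.tsum_mul_left, ENNReal.tsum_eq_iSup_sum]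
    refine iSup_le fun J => ?_
    have hJ1 : (∑ j ∈ J, (ENNReal.ofReal η * ‖g j‖ₑ) ^ s) ^ (1 / s) ≤ ENNReal.ofReal η * ‖f‖ₑ := by
      rw [← root (ENNReal.ofReal η * ‖f‖ₑ)]
      gcongr
      rw [ENNReal.mul_rpow_of_nonneg _ _ hs0.le, ← hsum_g, ← ENNReal.tsum_mul_left]
      simp_rw [ENNReal.mul_rpow_of_nonneg _ _ hs0.le]
      exact ENNReal.sum_le_tsum J
    have hJ2 : (∑ j ∈ J, ‖T' (g j) - h j‖ₑ ^ s) ^ (1 / s) ≤ ENNReal.ofReal η * ‖f‖ₑ := by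
      rw [← root (ENNReal.ofReal η * ‖f‖ₑ)]
      gcongr
      exact (ENNReal.sum_le_tsum J).trans hsum_d
    have hJ3 : (∑ j ∈ J, ‖h j‖ₑ ^ s) ^ (1 / s) ≤ ‖T' f‖ₑ := by
      rw [← root ‖T' f‖ₑ]
      gcongr
      exact (ENNReal.sum_le_tsum J).trans hsum_h.le
    have hpt : ∀ j, ENNReal.ofReal (c + δ) ^ s * ‖g j‖ₑ ^ s ≤
        ((ENNReal.ofReal η * ‖g j‖ₑ + ‖T' (g j) - h j‖ₑ) + ‖h j‖ₑ) ^ s := by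
      intro j
      rw [← ENNReal.mul_rpow_of_nonneg _ _ hs0.le]
      gcongr
      calc ENNReal.ofReal (c + δ) * ‖g j‖ₑ ≤ ‖T (g j)‖ₑ := by
            rw [← ofReal_norm, ← ofReal_norm, ← ENNReal.ofReal_mul (by positivity)]
            exact ENNReal.ofReal_le_ofReal (hlow j)
        _ = ‖(T - T') (g j) + (T' (g j) - h j) + h j‖ₑ := by
            congr 1; rw [sub_apply]; abel
        _ ≤ ‖(T - T') (g j)‖ₑ + ‖T' (g j) - h j‖ₑ + ‖h j‖ₑ :=
            (enorm_add_le _ _).trans (by gcongr; exact enorm_add_le _ _)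
        _ ≤ _ := by
            gcongr
            refine ((T - T').le_opENorm _).trans ?_
            gcongr
            rw [← ofReal_norm]
            exact ENNReal.ofReal_le_ofReal hTT'
    rw [← ENNReal.rpow_le_rpow_iff (one_div_pos.2 hs0), root]
    calc _ ≤ (∑ j ∈ J, ((ENNReal.ofReal η * ‖g j‖ₑ + ‖T' (g j) - h j‖ₑ) + ‖h j‖ₑ) ^ s) ^
          (1 / s) := by
          gcongr with j _
          exact hpt j
      _ ≤ _ := (ENNReal.Lp_add_le J _ _ hQ.one_lt.le).trans
          (add_le_add ((ENNReal.Lp_add_le J _ _ hQ.one_lt.le).trans (add_le_add hJ1 hJ2)) hJ3)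
  have hreal : (c + δ) * ‖f‖ ≤ η * ‖f‖ + η * ‖f‖ + ‖T' f‖ := by
    simp_rw [← ofReal_norm] at hmain
    rw [← ENNReal.ofReal_mul (by positivity), ← ENNReal.ofReal_mul (by positivity),
      ← ENNReal.ofReal_add (by positivity) (by positivity),
      ← ENNReal.ofReal_add (by positivity) (by positivity),
      ENNReal.ofReal_le_ofReal_iff (by positivity)] at hmain
    exact hmain
  have hT'f : ‖T' f‖ ≤ η * ‖f‖ + c * ‖f‖ := by
    have h1 : T' f = T f - (T - T') f := by rw [sub_apply]; abel
    have h2 := (T - T').le_opNorm f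
    have h3 : ‖(T - T') f‖ ≤ η * ‖f‖ := h2.trans (by gcongr)
    rw [h1]
    linarith [norm_sub_le (T f) ((T - T') f)]
  have hf0 : 0 < ‖f‖ := norm_pos_iff.2 hf
  have : δ * ‖f‖ ≤ 3 * η * ‖f‖ := by linarith
  have : δ ≤ 3 * η := le_of_mul_le_mul_right this hf0
  linarith

end Decomp

end

section

variable {L F : Type*} [PseudoMetricSpace L] [NormedAddCommGroup F] [NormedSpace ℂ F]

/-- Iterated localization: a vector with small quotient `‖T f‖ / ‖f‖` gives rise, around a common
centre, to vectors supported in balls of prescribed radii with prescribed small quotients. -/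
theorem Decomp.exists_localized_chain {s : ℝ} {Q : L → F →L[ℂ] F} (hQ : Decomp s Q)
    (hL : UniformlyFinite L) (hA : DiscretePropertyA L) {T : F →L[ℂ] F} (hT : BandDominated Q T) :
    ∃ R : ℕ → ℝ, ∀ (n : ℕ) (f : F), f ≠ 0 → ‖T f‖ ≤ (1 / 2) ^ n * ‖f‖ →
      ∃ z : L, (∃ l, dist l z ≤ R 0 ∧ Q l f ≠ 0) ∧ ∀ k ≤ n, ∃ g : F, g ≠ 0 ∧
        (∀ l, Q l g ≠ 0 → dist l z ≤ R k) ∧ ‖T g‖ ≤ 2 * (1 / 2) ^ k * ‖g‖ := by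
  have hex : ∀ g : F, g ≠ 0 → ∃ l, Q l g ≠ 0 := fun g hg => by
    by_contra! h; exact hg (hQ.eq_zero h)
  -- With tolerance `(1 / 2) ^ k`, a quotient of at most `(1 / 2) ^ k` doubles at worst, which is
  -- the input needed for tolerance `(1 / 2) ^ (k - 1)`.
  choose r hr using fun k : ℕ => hQ.exists_localized hL hA hT (δ := (1 / 2) ^ k) (by positivity)
  -- Localization only shrinks supports. The last vector `h` is therefore supported inside all the
  -- earlier ones and provides a common centre.
  have key : ∀ (n : ℕ) (f : F), f ≠ 0 → ‖T f‖ ≤ (1 / 2) ^ n * ‖f‖ →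
      ∃ h : F, h ≠ 0 ∧ (∀ l, Q l f = 0 → Q l h = 0) ∧ (∃ z, ∀ l, Q l h ≠ 0 → dist l z ≤ r 0) ∧
        ∀ k ≤ n, ∃ g : F, g ≠ 0 ∧ (∀ l, Q l g = 0 → Q l h = 0) ∧
          (∃ w, ∀ l, Q l g ≠ 0 → dist l w ≤ r k) ∧ ‖T g‖ ≤ 2 * (1 / 2) ^ k * ‖g‖ := by
    intro n
    induction n with
    | zero =>
      intro f hf hTf
      obtain ⟨g, hg, hgf, hgz, hTg⟩ := hr 0 f _ hf (by positivity) hTf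
      refine ⟨g, hg, hgf, hgz, fun k hk => ⟨g, hg, fun _ h => h, ?_, ?_⟩⟩
      · rwa [Nat.le_zero.1 hk]
      · rw [Nat.le_zero.1 hk]
        refine hTg.trans_eq ?_
        norm_num
    | succ n ih =>
      intro f hf hTf
      obtain ⟨g, hg, hgf, hgz, hTg⟩ := hr (n + 1) f _ hf (by positivity) hTf
      have hq : ‖T g‖ ≤ (1 / 2) ^ n * ‖g‖ := hTg.trans_eq (by ring)
      obtain ⟨h, hh, hhg, hhz, hall⟩ := ih g hg hq
      refine ⟨h, hh, fun l hl => hhg l (hgf l hl), hhz, fun k hk => ?_⟩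
      rcases Nat.le_succ_iff.1 hk with hk | hk
      · exact hall k hk
      · subst hk
        exact ⟨g, hg, hhg, hgz, hTg.trans_eq (by rw [Nat.succ_eq_add_one]; ring)⟩
  -- A point of the support of `g` and a point `l₀` of the support of `h` both lie within `r k` of
  -- the centre of `g`, and `l₀` lies within `r 0` of `z`.
  refine ⟨fun k => 2 * r k + r 0, fun n f hf hTf => ?_⟩
  obtain ⟨h, hh, hhf, ⟨z, hz⟩, hall⟩ := key n f hf hTf
  obtain ⟨l₀, hl₀⟩ := hex h hh
  refine ⟨z, ⟨l₀, ?_, fun h0 => hl₀ (hhf _ h0)⟩, fun k hk => ?_⟩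
  · have := hz l₀ hl₀
    have := dist_nonneg (x := l₀) (y := z)
    dsimp only
    linarith
  · obtain ⟨g, hg, hgh, ⟨w, hw⟩, hTg⟩ := hall k hk
    refine ⟨g, hg, fun l hl => ?_, hTg⟩
    have h1 := hw l hl
    have h2 := hw l₀ fun h0 => hl₀ (hgh _ h0)
    have h3 := hz l₀ hl₀
    have h4 := dist_triangle4 l w l₀ z
    rw [dist_comm w l₀] at h4
    dsimp only
    linarith

end

/-! ### A Fredholm criterion from lower bounds modulo compact operators -/

section Fredholm

variable {M E E' : Type*} [NormedAddCommGroup M] [NormedSpace ℂ M]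
  [NormedAddCommGroup E] [NormedSpace ℂ E] [NormedAddCommGroup E'] [NormedSpace ℂ E']

/-- Hahn–Banach: a point outside a closed subspace is separated from it by a functional. -/
theorem exists_functional_of_notMem {W : Submodule ℂ M} (hW : IsClosed (W : Set M)) {x : M}
    (hx : x ∉ W) : ∃ ψ : M →L[ℂ] ℂ, ψ x ≠ 0 ∧ ∀ w ∈ W, ψ w = 0 := by
  have : IsClosed (W : Set M) := hW
  obtain ⟨φ, _, hφ⟩ := exists_dual_vector'' ℂ (W.mkQL x)
  refine ⟨φ ∘L W.mkQL, ?_, fun w hw => ?_⟩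
  · rw [ContinuousLinearMap.comp_apply, hφ]
    have : W.mkQL x ≠ 0 := fun h => hx ((Submodule.Quotient.mk_eq_zero W).1 h)
    simpa using this
  · have : W.mkQL w = 0 := (Submodule.Quotient.mk_eq_zero W).2 hw
    rw [ContinuousLinearMap.comp_apply, this, map_zero]

/-- A compact operator is small on a closed subspace of finite codimension. -/
theorem exists_cofg_norm_le {K : M →L[ℂ] E} (hK : IsCompactOperator K) {η : ℝ} (hη : 0 < η) :
    ∃ V : Submodule ℂ M, IsClosed (V : Set M) ∧ V.CoFG ∧ ∀ f ∈ V, ‖K f‖ ≤ η * ‖f‖ := by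
  have hc : IsCompact (closure (K '' Metric.closedBall 0 1)) :=
    IsCompactOperator.isCompact_closure_image_closedBall (f := (K : M →ₗ[ℂ] E)) hK 1
  obtain ⟨t, ht, hcov⟩ := Metric.totallyBounded_iff.1
    (hc.totallyBounded.subset subset_closure) (η / 2) (by positivity)
  -- Norming functionals of the net points. If all of them annihilate `K u` and `v` is the net point
  -- near `K u`, then `‖v‖ = ‖φ v (K u - v)‖ ≤ η / 2`, so `‖K u‖ ≤ η`.
  choose φ hφ1 hφ2 using fun v : E => exists_dual_vector'' ℂ v
  have := ht.fintype
  let Φ : M →L[ℂ] (t → ℂ) := ContinuousLinearMap.pi fun v => φ v ∘L K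
  refine ⟨Φ.ker, Φ.isClosed_ker, Submodule.CoFG.ker _, fun f hf => ?_⟩
  have hΦ : ∀ v ∈ t, φ v (K f) = 0 := fun v hv => congrFun (LinearMap.mem_ker.1 hf) ⟨v, hv⟩
  rcases eq_or_ne f 0 with rfl | hf0
  · simp
  have hn : 0 < ‖f‖ := norm_pos_iff.2 hf0
  set u : M := ((‖f‖⁻¹ : ℝ) : ℂ) • f with hu
  have hu1 : ‖u‖ = 1 := by
    rw [hu, norm_smul, Complex.norm_real, norm_inv, norm_norm, inv_mul_cancel₀ hn.ne']
  have hKu : K u ∈ ⋃ y ∈ t, Metric.ball y (η / 2) :=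
    hcov ⟨u, by simp [hu1], rfl⟩
  simp only [mem_iUnion, Metric.mem_ball, dist_eq_norm] at hKu
  obtain ⟨v, hv, hvu⟩ := hKu
  have h0 : φ v (K u) = 0 := by rw [hu, map_smul, map_smul, hΦ v hv, smul_zero]
  have h1 : ‖v‖ ≤ ‖K u - v‖ := by
    calc ‖v‖ = ‖φ v (K u - v)‖ := by rw [map_sub, h0, zero_sub, norm_neg, hφ2]; simp
      _ ≤ ‖φ v‖ * ‖K u - v‖ := (φ v).le_opNorm _
      _ ≤ 1 * ‖K u - v‖ := by gcongr; exact hφ1 v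
      _ = _ := one_mul _
  have h2 : ‖K u‖ ≤ η := by
    have : ‖K u‖ ≤ ‖K u - v‖ + ‖v‖ := by simpa using norm_add_le (K u - v) v
    linarith
  rw [hu, map_smul, norm_smul, Complex.norm_real, norm_inv, norm_norm] at h2
  rwa [inv_mul_le_iff₀ hn, mul_comm] at h2

/-- A functional bound modulo a compact operator forces the annihilator of the range to be
separated by finitely many vectors. -/
theorem exists_finite_separating {A : M →L[ℂ] M} {K : E' →L[ℂ] M} (hK : IsCompactOperator K)
    {C : ℝ} (h : ∀ ψ : M →L[ℂ] ℂ, ‖ψ‖ ≤ C * ‖ψ ∘L A‖ + ‖ψ ∘L K‖) :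
    ∃ t : Set M, t.Finite ∧ ∀ ψ : M →L[ℂ] ℂ, ψ ∘L A = 0 → (∀ v ∈ t, ψ v = 0) → ψ = 0 := by
  have hc : IsCompact (closure (K '' Metric.closedBall 0 1)) :=
    IsCompactOperator.isCompact_closure_image_closedBall (f := (K : E' →ₗ[ℂ] M)) hK 1
  obtain ⟨t, ht, hcov⟩ := Metric.totallyBounded_iff.1
    (hc.totallyBounded.subset subset_closure) (1 / 2) (by positivity)
  refine ⟨t, ht, fun ψ hψA hψ => ?_⟩
  -- A functional vanishing on a `1 / 2`-net of the image of the unit ball has at most half its norm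
  -- there, so this term is absorbed on the left of `h`.
  have hb : ‖ψ ∘L K‖ ≤ ‖ψ‖ * (1 / 2) := by
    refine ContinuousLinearMap.opNorm_le_of_unit_norm (by positivity) fun u hu => ?_
    have hKu : K u ∈ ⋃ y ∈ t, Metric.ball y (1 / 2) := hcov ⟨u, by simp [hu], rfl⟩
    simp only [mem_iUnion, Metric.mem_ball, dist_eq_norm] at hKu
    obtain ⟨v, hv, hvu⟩ := hKu
    calc ‖ψ (K u)‖ = ‖ψ (K u - v)‖ := by rw [map_sub, hψ v hv, sub_zero]
      _ ≤ ‖ψ‖ * ‖K u - v‖ := ψ.le_opNorm _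
      _ ≤ _ := by gcongr
  have h1 := h ψ
  rw [hψA, norm_zero, mul_zero, zero_add] at h1
  have : ‖ψ‖ ≤ 0 := by linarith
  exact norm_le_zero_iff.1 this

/-- A criterion for Fredholmness: lower bounds modulo compact operators for `A` and its
transpose. -/
theorem isFredholm_of_lower_bounds [CompleteSpace M] {A : M →L[ℂ] M} {K : M →L[ℂ] E}
    {K' : E' →L[ℂ] M} (hK : IsCompactOperator K) (hK' : IsCompactOperator K') {C C' : ℝ}
    (h : ∀ f, ‖f‖ ≤ C * ‖A f‖ + ‖K f‖)
    (h' : ∀ ψ : M →L[ℂ] ℂ, ‖ψ‖ ≤ C' * ‖ψ ∘L A‖ + ‖ψ ∘L K'‖) : A.IsFredholm := by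
  -- On `V` the compact term is at most `‖f‖ / 2` and can be absorbed, so `A` is bounded below
  -- there. This gives closed range, and a finite-dimensional kernel because the kernel meets `V`
  -- trivially.
  obtain ⟨V, hVc, hVf, hV⟩ := exists_cofg_norm_le hK (η := 1 / 2) (by norm_num)
  have hlow : ∀ f ∈ V, ‖f‖ ≤ (2 * |C|) * ‖A f‖ := by
    intro f hf
    have h1 := h f
    have h2 := hV f hf
    have h3 : C * ‖A f‖ ≤ |C| * ‖A f‖ := by gcongr; exact le_abs_self C
    linarith
  have : CompleteSpace V := hVc.completeSpace_coe
  have hanti : AntilipschitzWith (Real.toNNReal (2 * |C|)) (A.domRestrict V) := by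
    refine ContinuousLinearMap.antilipschitz_of_bound _ fun f => ?_
    rw [Real.coe_toNNReal _ (by positivity)]
    exact hlow f f.2
  have hemb : IsClosedEmbedding (A.domRestrict V) :=
    hanti.isClosedEmbedding (A.domRestrict V).uniformContinuous
  have hstr := (A.isStrictMap_isClosed_range_iff_restrict V hVc).2
    ⟨hemb.isEmbedding.isStrictMap, by
      rw [LinearMap.coe_range]; exact hemb.isClosed_range⟩
  have hdisj : Disjoint A.ker V := by
    rw [Submodule.disjoint_def]
    intro f hf hfV
    have := hlow f hfV
    rw [show A f = 0 from hf, norm_zero, mul_zero] at this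
    exact norm_le_zero_iff.1 this
  have hker : FiniteDimensional ℂ A.ker := by
    rw [← Submodule.fg_iff_finiteDimensional]
    exact hVf.fg_of_disjoint hdisj
  refine ⟨hstr.1, hstr.2, hker, ?_, Submodule.ClosedComplemented.of_finiteDimensional A.ker⟩
  obtain ⟨t, ht, hsep⟩ := exists_finite_separating hK' h'
  set W : Submodule ℂ M := Submodule.span ℂ t with hW
  have hWf : FiniteDimensional ℂ W := FiniteDimensional.span_of_finite ℂ ht
  -- The sum is closed, as `W` is finite-dimensional. A functional annihilating it kills both the
  -- range and the separating vectors, hence is zero.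
  have htop : A.range ⊔ W = ⊤ := by
    have hcl : IsClosed ((A.range ⊔ W : Submodule ℂ M) : Set M) :=
      Submodule.isClosed_sup_finiteDimensional _ _ hstr.2
    by_contra hne
    obtain ⟨x, hx⟩ : ∃ x, x ∉ A.range ⊔ W := by
      by_contra! hall
      exact hne (eq_top_iff.2 fun x _ => hall x)
    obtain ⟨ψ, hψx, hψ⟩ := exists_functional_of_notMem hcl hx
    refine hψx ?_
    rw [hsep ψ ?_ fun v hv => hψ v (Submodule.mem_sup_right (Submodule.subset_span hv)),
      zero_apply]
    ext f
    exact hψ _ (Submodule.mem_sup_left ⟨f, rfl⟩)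
  exact Submodule.FG.cofg_of_codisjoint (codisjoint_iff.2 (sup_comm A.range W ▸ htop))
    (Submodule.fg_iff_finiteDimensional W |>.2 hWf)

end Fredholm

/-! ### Weak, strong and local norm convergence of operator families -/

section Limits

variable {ι E : Type*} [NormedAddCommGroup E] [NormedSpace ℂ E]

/-- Pointwise weak convergence of operators along a filter. -/
def WeakLim (l : Filter ι) (T : ι → E →L[ℂ] E) (B : E →L[ℂ] E) : Prop :=
  ∀ (f : E) (ψ : E →L[ℂ] ℂ), Tendsto (fun x => ψ (T x f)) l (𝓝 (ψ (B f)))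

/-- Norm convergence after truncation by any `m r`, from either side. -/
structure LocTendsto (m : ℕ → E →L[ℂ] E) (l : Filter ι) (T : ι → E →L[ℂ] E) (B : E →L[ℂ] E) :
    Prop where
  left : ∀ r, Tendsto (fun x => m r ∘L T x) l (𝓝 (m r ∘L B))
  right : ∀ r, Tendsto (fun x => T x ∘L m r) l (𝓝 (B ∘L m r))

/-- A bounded family of operators whose matrix entries decay uniformly off the diagonal. -/
structure UnifBand (m : ℕ → E →L[ℂ] E) (T : ι → E →L[ℂ] E) : Prop where
  bdd : ∃ C, ∀ x, ‖T x‖ ≤ C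
  left : ∀ (r : ℕ) (η : ℝ), 0 < η → ∃ R, ∀ x,
    ‖m r ∘L T x ∘L (ContinuousLinearMap.id ℂ E - m R)‖ ≤ η
  right : ∀ (r : ℕ) (η : ℝ), 0 < η → ∃ R, ∀ x,
    ‖(ContinuousLinearMap.id ℂ E - m R) ∘L T x ∘L m r‖ ≤ η

variable {l : Filter ι} {T : ι → E →L[ℂ] E} {B : E →L[ℂ] E} {m : ℕ → E →L[ℂ] E}

theorem WeakLim.comp (h : WeakLim l T B) (G H : E →L[ℂ] E) :
    WeakLim l (fun x => G ∘L T x ∘L H) (G ∘L B ∘L H) :=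
  fun f ψ => h (H f) (ψ ∘L G)

theorem WeakLim.norm_le [l.NeBot] (h : WeakLim l T B) {C : ℝ} (hC : ∀ x, ‖T x‖ ≤ C) :
    ‖B‖ ≤ C := by
  have hC0 : 0 ≤ C := by
    obtain ⟨x⟩ := l.nonempty_of_neBot
    exact (norm_nonneg _).trans (hC x)
  refine ContinuousLinearMap.opNorm_le_bound _ hC0 fun f => ?_
  refine NormedSpace.norm_le_dual_bound ℂ _ (by positivity) fun ψ => ?_
  refine le_of_tendsto (h f ψ).norm (Eventually.of_forall fun x => ?_)
  calc ‖ψ (T x f)‖ ≤ ‖ψ‖ * ‖T x f‖ := ψ.le_opNorm _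
    _ ≤ ‖ψ‖ * (C * ‖f‖) := by
        gcongr
        exact (T x).le_of_opNorm_le (hC x) f
    _ = _ := by ring

theorem WeakLim.unique [l.NeBot] (h : WeakLim l T B) {B' : E →L[ℂ] E} (h' : WeakLim l T B') :
    B = B' := by
  ext f
  refine (SeparatingDual.eq_iff_forall_dual_eq (R := ℂ)).2 fun ψ => ?_
  exact tendsto_nhds_unique (h f ψ) (h' f ψ)

theorem WeakLim.of_strong (h : ∀ f, Tendsto (fun x => T x f) l (𝓝 (B f))) : WeakLim l T B :=
  fun f ψ => (ψ.continuous.tendsto _).comp (h f)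

theorem LocTendsto.sub {T' : ι → E →L[ℂ] E} {B' : E →L[ℂ] E} (h : LocTendsto m l T B)
    (h' : LocTendsto m l T' B') : LocTendsto m l (fun x => T x - T' x) (B - B') where
  left r := by
    simp only [ContinuousLinearMap.comp_sub]
    exact (h.left r).sub (h'.left r)
  right r := by
    simp only [ContinuousLinearMap.sub_comp]
    exact (h.right r).sub (h'.right r)

theorem LocTendsto.add {T' : ι → E →L[ℂ] E} {B' : E →L[ℂ] E} (h : LocTendsto m l T B)
    (h' : LocTendsto m l T' B') : LocTendsto m l (fun x => T x + T' x) (B + B') where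
  left r := by
    simp only [ContinuousLinearMap.comp_add]
    exact (h.left r).add (h'.left r)
  right r := by
    simp only [ContinuousLinearMap.add_comp]
    exact (h.right r).add (h'.right r)

theorem LocTendsto.const : LocTendsto m l (fun _ => B) B :=
  ⟨fun _ => tendsto_const_nhds, fun _ => tendsto_const_nhds⟩

/-- Convergence of all truncations from both sides gives convergence of one-sided truncations. -/
theorem UnifBand.locTendsto [l.NeBot] (hT : UnifBand m T) (hB : WeakLim l T B)
    (h : ∀ r s, Tendsto (fun x => m r ∘L T x ∘L m s) l (𝓝 (m r ∘L B ∘L m s))) :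
    LocTendsto m l T B := by
  constructor
  · intro r
    rw [Metric.tendsto_nhds]
    intro ε hε
    obtain ⟨R, hR⟩ := hT.left r (ε / 4) (by positivity)
    -- The tail bound is uniform in `x`, so it passes to the weak limit.
    have hR' := (hB.comp (m r) (ContinuousLinearMap.id ℂ E - m R)).norm_le hR
    filter_upwards [(Metric.tendsto_nhds.1 (h r R)) (ε / 4) (by positivity)] with x hx
    rw [dist_eq_norm] at hx ⊢
    have : m r ∘L T x - m r ∘L B = (m r ∘L T x ∘L m R - m r ∘L B ∘L m R)
        + (m r ∘L T x ∘L (ContinuousLinearMap.id ℂ E - m R)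
          - m r ∘L B ∘L (ContinuousLinearMap.id ℂ E - m R)) := by
      ext f; simp; abel
    rw [this]
    have h1 := norm_add_le (m r ∘L T x ∘L m R - m r ∘L B ∘L m R)
      (m r ∘L T x ∘L (ContinuousLinearMap.id ℂ E - m R)
          - m r ∘L B ∘L (ContinuousLinearMap.id ℂ E - m R))
    have h2 := norm_sub_le (m r ∘L T x ∘L (ContinuousLinearMap.id ℂ E - m R))
      (m r ∘L B ∘L (ContinuousLinearMap.id ℂ E - m R))
    linarith [hR x]
  · intro r
    rw [Metric.tendsto_nhds]
    intro ε hε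
    obtain ⟨R, hR⟩ := hT.right r (ε / 4) (by positivity)
    have hR' := (hB.comp (ContinuousLinearMap.id ℂ E - m R) (m r)).norm_le hR
    filter_upwards [(Metric.tendsto_nhds.1 (h R r)) (ε / 4) (by positivity)] with x hx
    rw [dist_eq_norm] at hx ⊢
    have : T x ∘L m r - B ∘L m r = (m R ∘L T x ∘L m r - m R ∘L B ∘L m r)
        + ((ContinuousLinearMap.id ℂ E - m R) ∘L T x ∘L m r
          - (ContinuousLinearMap.id ℂ E - m R) ∘L B ∘L m r) := by
      ext f; simp; abel
    rw [this]
    have h1 := norm_add_le (m R ∘L T x ∘L m r - m R ∘L B ∘L m r)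
      ((ContinuousLinearMap.id ℂ E - m R) ∘L T x ∘L m r
          - (ContinuousLinearMap.id ℂ E - m R) ∘L B ∘L m r)
    have h2 := norm_sub_le ((ContinuousLinearMap.id ℂ E - m R) ∘L T x ∘L m r)
      ((ContinuousLinearMap.id ℂ E - m R) ∘L B ∘L m r)
    linarith [hR x]

theorem tendsto_of_truncations {f : E} (hm : Tendsto (fun r => m r f) atTop (𝓝 f))
    (hT : ∃ C, ∀ x, ‖T x‖ ≤ C) (h : ∀ r, Tendsto (fun x => T x (m r f)) l (𝓝 (B (m r f)))) :
    Tendsto (fun x => T x f) l (𝓝 (B f)) := by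
  obtain ⟨C, hC⟩ := hT
  rw [Metric.tendsto_nhds]
  intro ε hε
  set D : ℝ := |C| + ‖B‖ + 1 with hD
  have hD0 : 0 < D := by positivity
  obtain ⟨r, hr⟩ := ((Metric.tendsto_nhds.1 hm) (ε / (2 * D)) (by positivity)).exists
  filter_upwards [(Metric.tendsto_nhds.1 (h r)) (ε / 2) (by positivity)] with x hx
  rw [dist_eq_norm] at hx hr ⊢
  have e : T x f - B f = (T x (m r f) - B (m r f)) - (T x - B) (m r f - f) := by
    simp; abel
  have hb : ‖(T x - B) (m r f - f)‖ ≤ D * ‖m r f - f‖ := by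
    refine (T x - B).le_of_opNorm_le ((norm_sub_le _ _).trans ?_) _
    linarith [hC x, le_abs_self C]
  have hb2 : D * ‖m r f - f‖ < ε / 2 := by
    calc D * ‖m r f - f‖ < D * (ε / (2 * D)) := by gcongr
      _ = ε / 2 := by field_simp
  rw [e]
  linarith [norm_sub_le (T x (m r f) - B (m r f)) ((T x - B) (m r f - f))]

theorem LocTendsto.strong (hm : ∀ f, Tendsto (fun r => m r f) atTop (𝓝 f))
    (hT : ∃ C, ∀ x, ‖T x‖ ≤ C) (h : LocTendsto m l T B) (f : E) :
    Tendsto (fun x => T x f) l (𝓝 (B f)) :=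
  tendsto_of_truncations (hm f) hT fun r =>
    ((ContinuousLinearMap.apply ℂ E f).continuous.tendsto _).comp (h.right r)

theorem tendsto_comp_of_strong {u : ι → E} {v : E} (hT : ∃ C, ∀ x, ‖T x‖ ≤ C)
    (h : ∀ f, Tendsto (fun x => T x f) l (𝓝 (B f))) (hu : Tendsto u l (𝓝 v)) :
    Tendsto (fun x => T x (u x)) l (𝓝 (B v)) := by
  obtain ⟨C, hC⟩ := hT
  have h0 : Tendsto (fun x => T x (u x - v)) l (𝓝 0) := by
    refine squeeze_zero_norm (fun x => (T x).le_of_opNorm_le (hC x) _) ?_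
    simpa using (tendsto_iff_norm_sub_tendsto_zero.1 hu).const_mul C
  simpa using h0.add (h v)

/-- Compact operators map bounded weakly convergent families to norm convergent ones. -/
theorem tendsto_compact_apply {K : E →L[ℂ] E} (hK : IsCompactOperator K) {u : ι → E} {v : E}
    {C : ℝ} (hu : ∀ x, ‖u x‖ ≤ C) (h : ∀ ψ : E →L[ℂ] ℂ, Tendsto (fun x => ψ (u x)) l (𝓝 (ψ v))) :
    Tendsto (fun x => K (u x)) l (𝓝 (K v)) := by
  have hc : IsCompact (closure (K '' Metric.closedBall 0 C)) :=
    IsCompactOperator.isCompact_closure_image_closedBall (f := (K : E →ₗ[ℂ] E)) hK C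
  -- Along an ultrafilter `K (u x)` converges by compactness, and the weak limit of `u` identifies
  -- the limit point.
  rw [tendsto_iff_ultrafilter]
  intro g hg
  obtain ⟨w, -, hw⟩ := hc.ultrafilter_le_nhds (g.map fun x => K (u x)) (by
    rw [le_principal_iff]
    exact Filter.Eventually.of_forall (f := (g : Filter ι))
      fun x => subset_closure ⟨u x, by simpa using hu x, rfl⟩)
  have hw' : Tendsto (fun x => K (u x)) g (𝓝 w) := hw
  have : w = K v := by
    refine (SeparatingDual.eq_iff_forall_dual_eq (R := ℂ)).2 fun ψ => ?_
    refine tendsto_nhds_unique ((ψ.continuous.tendsto _).comp hw') ?_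
    exact (h (ψ ∘L K)).mono_left hg
  rwa [this] at hw'

/-- Strong convergence of bounded families is uniform on compact sets. -/
theorem tendsto_comp_compact {K : E →L[ℂ] E} (hK : IsCompactOperator K)
    (hT : ∃ C, ∀ x, ‖T x‖ ≤ C) (h : ∀ f, Tendsto (fun x => T x f) l (𝓝 (B f))) :
    Tendsto (fun x => T x ∘L K) l (𝓝 (B ∘L K)) := by
  obtain ⟨C, hC⟩ := hT
  have hc : IsCompact (closure (K '' Metric.closedBall 0 1)) :=
    IsCompactOperator.isCompact_closure_image_closedBall (f := (K : E →ₗ[ℂ] E)) hK 1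
  rw [Metric.tendsto_nhds]
  intro ε hε
  set D : ℝ := |C| + ‖B‖ + 1 with hD
  have hD0 : 0 < D := by positivity
  obtain ⟨t, ht, hcov⟩ := Metric.totallyBounded_iff.1
    (hc.totallyBounded.subset subset_closure) (ε / (4 * D)) (by positivity)
  have hev : ∀ᶠ x in l, ∀ v ∈ t, ‖T x v - B v‖ < ε / 4 := by
    rw [Filter.eventually_all_finite ht]
    intro v _
    simpa [dist_eq_norm] using (Metric.tendsto_nhds.1 (h v)) (ε / 4) (by positivity)
  filter_upwards [hev] with x hx
  rw [dist_eq_norm, ← ContinuousLinearMap.sub_comp]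
  refine lt_of_le_of_lt (b := ε / 2) ?_ (by linarith)
  refine ContinuousLinearMap.opNorm_le_of_unit_norm (by positivity) fun u hu => ?_
  have hKu : K u ∈ ⋃ y ∈ t, Metric.ball y (ε / (4 * D)) := hcov ⟨u, by simp [hu], rfl⟩
  simp only [mem_iUnion, Metric.mem_ball, dist_eq_norm] at hKu
  obtain ⟨v, hv, hvu⟩ := hKu
  have e : ((T x - B) ∘L K) u = (T x - B) (K u - v) + (T x v - B v) := by
    simp; abel
  have hb : ‖(T x - B) (K u - v)‖ ≤ D * ‖K u - v‖ := by
    refine (T x - B).le_of_opNorm_le ((norm_sub_le _ _).trans ?_) _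
    linarith [hC x, le_abs_self C]
  have hb2 : D * ‖K u - v‖ ≤ ε / 4 := by
    calc D * ‖K u - v‖ ≤ D * (ε / (4 * D)) := by gcongr
      _ = ε / 4 := by field_simp
  rw [e]
  linarith [norm_add_le ((T x - B) (K u - v)) (T x v - B v), hx v hv]

/-- If `P x` converges locally to a projection-like `P'` with compact truncations, then weak
convergence of a band-dominated family `A x = P x A x P x` on `ran P'` improves to local norm
convergence. -/
theorem UnifBand.locTendsto_of_compact [l.NeBot] {P A : ι → E →L[ℂ] E} {P' A' : E →L[ℂ] E}
    (hm : ∀ f, Tendsto (fun r => m r f) atTop (𝓝 f))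
    (hP : LocTendsto m l P P') (hPbdd : ∃ C, ∀ x, ‖P x‖ ≤ C)
    (hPl : ∀ r, IsCompactOperator (m r ∘L P')) (hPr : ∀ r, IsCompactOperator (P' ∘L m r))
    (hA : UnifBand m A) (hAP : ∀ x, A x ∘L P x = A x) (hPA : ∀ x, P x ∘L A x = A x)
    (hA' : A' ∘L P' = A')
    (h : ∀ (f : E) (ψ : E →L[ℂ] ℂ), Tendsto (fun x => ψ (A x (P' f))) l (𝓝 (ψ (A' f)))) :
    P' ∘L A' = A' ∧ LocTendsto m l A A' := by
  have hPs := hP.strong hm hPbdd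
  obtain ⟨C, hC⟩ := hA.bdd
  -- Weak convergence is given only on `ran P'`. Since `A x f = A x (P x f)` and `P x f → P' f` in
  -- norm, it holds on the whole space.
  have hw : WeakLim l A A' := by
    intro f ψ
    have h1 : Tendsto (fun x => A x (P x f - P' f)) l (𝓝 0) := by
      refine squeeze_zero_norm (fun x => (A x).le_of_opNorm_le (hC x) _) ?_
      simpa using (tendsto_iff_norm_sub_tendsto_zero.1 (hPs f)).const_mul C
    have h2 := ((ψ.continuous.tendsto _).comp h1).add (h f ψ)
    rw [map_zero, zero_add] at h2
    refine h2.congr fun x => ?_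
    have := congrArg (fun G : E →L[ℂ] E => G f) (hAP x)
    simp only [ContinuousLinearMap.comp_apply] at this
    simp [this]
  have hdiff : ∀ r f, Tendsto (fun x => (m r ∘L P x - m r ∘L P') (A x f)) l (𝓝 0) := by
    intro r f
    have h1 := (tendsto_iff_norm_sub_tendsto_zero.1 (hP.left r)).mul_const (C * ‖f‖)
    rw [zero_mul] at h1
    refine squeeze_zero_norm (fun x => ?_) h1
    refine ((m r ∘L P x - m r ∘L P').le_opNorm _).trans ?_
    gcongr
    exact (A x).le_of_opNorm_le (hC x) f
  -- `m r ∘L A x = m r ∘L P x ∘L A x` is norm close to `m r ∘L P' ∘L A x`, and the compact operator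
  -- `m r ∘L P'` turns weak into norm convergence.
  have hml : ∀ r f, Tendsto (fun x => m r (A x f)) l (𝓝 (m r (P' (A' f)))) := by
    intro r f
    have h1 : Tendsto (fun x => (m r ∘L P') (A x f)) l (𝓝 ((m r ∘L P') (A' f))) :=
      tendsto_compact_apply (hPl r) (C := C * ‖f‖)
        (fun x => (A x).le_of_opNorm_le (hC x) f) (hw f)
    have h2 := (hdiff r f).add h1
    rw [zero_add] at h2
    refine h2.congr fun x => ?_
    have := congrArg (fun G : E →L[ℂ] E => G f) (hPA x)
    simp only [ContinuousLinearMap.comp_apply] at this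
    simp [this]
  -- The limit just found must agree with the weak limit of `m r (A x f)`; then let `r → ∞`.
  have hPA' : P' ∘L A' = A' := by
    ext f
    have h1 : ∀ r, m r (P' (A' f)) = m r (A' f) := by
      intro r
      refine (SeparatingDual.eq_iff_forall_dual_eq (R := ℂ)).2 fun ψ => ?_
      exact tendsto_nhds_unique ((ψ.continuous.tendsto _).comp (hml r f)) (hw f (ψ ∘L m r))
    exact tendsto_nhds_unique (hm _) ((hm (A' f)).congr fun r => (h1 r).symm)
  refine ⟨hPA', ?_⟩
  have hPA'f : ∀ f, P' (A' f) = A' f := fun f => congrArg (fun G : E →L[ℂ] E => G f) hPA'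
  simp only [hPA'f] at hml
  -- The left cutoff is removed on truncated vectors, where the part of `A x (m r f)` outside a
  -- large cutoff is uniformly small.
  have hstrong_m : ∀ r f, Tendsto (fun x => A x (m r f)) l (𝓝 (A' (m r f))) := by
    intro r f
    rw [Metric.tendsto_nhds]
    intro ε hε
    obtain ⟨R, hR⟩ := hA.right r (ε / (4 * (‖f‖ + 1))) (by positivity)
    have hR' := (hw.comp (ContinuousLinearMap.id ℂ E - m R) (m r)).norm_le hR
    have hb : ∀ G : E →L[ℂ] E,
        ‖(ContinuousLinearMap.id ℂ E - m R) ∘L G ∘L m r‖ ≤ ε / (4 * (‖f‖ + 1)) →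
        ‖G (m r f) - m R (G (m r f))‖ ≤ ε / 4 := by
      intro G hG
      have := ((ContinuousLinearMap.id ℂ E - m R) ∘L G ∘L m r).le_of_opNorm_le hG f
      calc ‖G (m r f) - m R (G (m r f))‖ ≤ ε / (4 * (‖f‖ + 1)) * ‖f‖ := by simpa using this
        _ ≤ ε / (4 * (‖f‖ + 1)) * (‖f‖ + 1) := by gcongr; linarith
        _ = ε / 4 := by field_simp
    filter_upwards [(Metric.tendsto_nhds.1 (hml R (m r f))) (ε / 4) (by positivity)] with x hx
    rw [dist_eq_norm] at hx ⊢
    have e : A x (m r f) - A' (m r f) = (A x (m r f) - m R (A x (m r f)))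
        + (m R (A x (m r f)) - m R (A' (m r f))) - (A' (m r f) - m R (A' (m r f))) := by abel
    rw [e]
    have h1 := norm_sub_le ((A x (m r f) - m R (A x (m r f)))
        + (m R (A x (m r f)) - m R (A' (m r f)))) (A' (m r f) - m R (A' (m r f)))
    have h2 := norm_add_le (A x (m r f) - m R (A x (m r f)))
      (m R (A x (m r f)) - m R (A' (m r f)))
    linarith [hb _ (hR x), hb _ hR']
  have hstrong : ∀ f, Tendsto (fun x => A x f) l (𝓝 (A' f)) := fun f =>
    tendsto_of_truncations (hm f) hA.bdd fun r => hstrong_m r f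
  -- `A x ∘L m r = A x ∘L P x ∘L m r` is close to `A x ∘L P' ∘L m r`, and strong convergence is
  -- uniform on the relatively compact image of the ball under `P' ∘L m r`.
  have hright : ∀ r, Tendsto (fun x => A x ∘L m r) l (𝓝 (A' ∘L m r)) := by
    intro r
    have h1 := tendsto_comp_compact (hPr r) hA.bdd hstrong
    have h2 : Tendsto (fun x => A x ∘L (P x ∘L m r - P' ∘L m r)) l (𝓝 0) := by
      have h3 := (tendsto_iff_norm_sub_tendsto_zero.1 (hP.right r)).const_mul C
      rw [mul_zero] at h3
      refine squeeze_zero_norm (fun x => ((A x).opNorm_comp_le _).trans ?_) h3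
      gcongr
      exact hC x
    have h4 := h2.add h1
    rw [zero_add, ← ContinuousLinearMap.comp_assoc, hA'] at h4
    refine h4.congr fun x => ?_
    rw [ContinuousLinearMap.comp_sub, sub_add_cancel, ← ContinuousLinearMap.comp_assoc, hAP]
  refine hA.locTendsto hw fun r s => ?_
  exact ((ContinuousLinearMap.postcomp E (m r)).continuous.tendsto _).comp (hright s)

end Limits

/-! ### Nets and measurable partitions in spaces of bounded geometry -/

section Geometry

variable {X : Type*} [MetricSpace X]

/-- Take a maximal `2 * ε`-separated set. An `ε`-ball contains at most one of its points, so a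
covering by `N` such balls bounds their number; maximality makes the set `2 * ε`-dense. -/
theorem BoundedGeometry.exists_net (h : BoundedGeometry X) :
    ∃ (L : Set X) (c : ℝ), L.Countable ∧ UniformlyFinite L ∧ ∀ x, ∃ y ∈ L, dist x y ≤ c := by
  obtain ⟨ε, hε, hcov⟩ := h
  obtain ⟨L, hL⟩ := zorn_subset {N : Set X | N.Pairwise fun x y => 2 * ε ≤ dist x y} (by
    intro C hC hchain
    exact ⟨⋃₀ C, (pairwise_sUnion hchain.directedOn).2 fun s hs => hC hs,
      fun s hs => subset_sUnion_of_mem hs⟩)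
  have hsep : ∀ x ∈ L, ∀ y ∈ L, dist x y < 2 * ε → x = y := by
    intro x hx y hy hxy
    by_contra hne
    exact absurd (hL.1 hx hy hne) (not_le.2 hxy)
  have hfin : UniformlyFinite L := by
    intro r
    -- The radius must be positive for every real `r`, and the open ball must contain the closed
    -- ball of radius `r`.
    obtain ⟨N, hN⟩ := hcov (|r| + 1) (by positivity)
    refine ⟨N, fun k => ?_⟩
    obtain ⟨s, hs, hball⟩ := hN k
    have hmem : ∀ l ∈ Metric.closedBall k r, ∃ y ∈ s, dist (l : X) y < ε := by
      intro l hl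
      have h1 : (l : X) ∈ Metric.ball (k : X) (|r| + 1) := by
        have : dist (l : X) k ≤ r := hl
        have := le_abs_self r
        rw [Metric.mem_ball]
        linarith
      simpa using hball h1
    have : Nonempty X := ⟨k⟩
    choose! y hys hy using hmem
    have hinj : InjOn y (Metric.closedBall k r) := by
      intro a ha b hb hab
      refine Subtype.ext (hsep a a.2 b b.2 ?_)
      have h1 := hy a ha
      have h2 := hy b hb
      rw [← hab] at h2
      have := dist_triangle_right (a : X) b (y a)
      linarith
    have hf : (Metric.closedBall k r).Finite :=
      Set.Finite.of_finite_image (s.finite_toSet.subset (by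
        rintro _ ⟨l, hl, rfl⟩
        exact hys l hl)) hinj
    refine ⟨hf, le_trans ?_ hs⟩
    exact Finset.card_le_card_of_injOn y (fun l hl => hys l (by simpa using hl))
      (fun a ha b hb => hinj (by simpa using ha) (by simpa using hb))
  refine ⟨L, 2 * ε, ?_, hfin, fun x => ?_⟩
  · rcases L.eq_empty_or_nonempty with h0 | ⟨x, hx⟩
    · simp [h0]
    · have hU : (univ : Set L) = ⋃ n : ℕ, Metric.closedBall (⟨x, hx⟩ : L) n := by
        ext y
        simp only [mem_univ, mem_iUnion, true_iff]
        exact exists_nat_ge (dist y ⟨x, hx⟩)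
      have : (univ : Set L).Countable := by
        rw [hU]
        refine countable_iUnion fun n => ?_
        obtain ⟨N, hN⟩ := hfin n
        exact (hN _).choose.countable
      exact countable_univ_iff.1 this
  · by_contra! hx
    have hins : insert x L ∈ {N : Set X | N.Pairwise fun x y => 2 * ε ≤ dist x y} := by
      refine hL.1.insert fun y hy _ => ⟨(hx y hy).le, ?_⟩
      rw [dist_comm]
      exact (hx y hy).le
    have hxL : x ∈ L := hL.2 hins (subset_insert x L) (mem_insert x L)
    have := hx x hxL
    rw [dist_self] at this
    linarith

variable [MeasurableSpace X] [BorelSpace X]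

/-- A space of bounded geometry is partitioned into uniformly bounded measurable cells centred at
the points of a uniformly discrete net. -/
theorem BoundedGeometry.exists_partition (h : BoundedGeometry X) :
    ∃ (L : Set X) (c : ℝ) (Q : L → Set X), L.Countable ∧ UniformlyFinite L ∧
      (∀ l, MeasurableSet (Q l)) ∧ Pairwise (Function.onFun Disjoint Q) ∧ (⋃ l, Q l = univ) ∧
      ∀ l, ∀ x ∈ Q l, dist x l ≤ c := by
  obtain ⟨L, c, hLc, hL, hcov⟩ := h.exists_net
  have := hLc.toEncodable
  have hnat : ∀ l : L, {k : L | Encodable.encode k < Encodable.encode l}.Countable :=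
    fun l => Set.to_countable _
  -- Each point is assigned to the centre of smallest code among those within distance `c`.
  refine ⟨L, c, fun l => Metric.closedBall (l : X) c \
    ⋃ k ∈ {k : L | Encodable.encode k < Encodable.encode l}, Metric.closedBall (k : X) c,
    hLc, hL, fun l => ?_, ?_, ?_, fun l x hx => hx.1⟩
  · exact measurableSet_closedBall.diff
      (MeasurableSet.biUnion (hnat l) fun k _ => measurableSet_closedBall)
  · intro l k hlk
    rw [Function.onFun, Set.disjoint_left]
    rintro x ⟨hx1, hx2⟩ ⟨hx3, hx4⟩
    simp only [mem_ofPred_eq, mem_iUnion, not_exists] at hx2 hx4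
    rcases lt_trichotomy (Encodable.encode l) (Encodable.encode k) with h | h | h
    · exact hx4 l h hx1
    · exact hlk (Encodable.encode_injective h)
    · exact hx2 k h hx3
  · refine eq_univ_of_forall fun x => ?_
    have hne : ∃ n, ∃ l : L, Encodable.encode l = n ∧ dist x l ≤ c := by
      obtain ⟨y, hy, hxy⟩ := hcov x
      exact ⟨_, ⟨y, hy⟩, rfl, hxy⟩
    classical
    obtain ⟨l, hl, hxl⟩ := Nat.find_spec hne
    refine mem_iUnion.2 ⟨l, hxl, ?_⟩
    simp only [mem_ofPred_eq, mem_iUnion, not_exists]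
    intro k hk hxk
    rw [hl] at hk
    exact Nat.find_min hne hk ⟨k, rfl, hxk⟩

omit [BorelSpace X] in
theorem PropertyA'.discrete (h : PropertyA' X) (L : Set X) : DiscretePropertyA L := by
  intro t ht
  obtain ⟨ρ, h1, h2, h3, h4, -⟩ := h t ht
  have h0 : ∀ j x, 0 ≤ ρ j x := fun j x => ((h1 j).2.2 x).1
  refine ⟨fun j l => ρ j l, fun j l => h0 j l, fun l => ?_,
    ⟨(⨆ j, Metric.ediam (tsupport (ρ j))).toReal, fun j l k hl hk => ?_⟩, fun l k hlk => ?_⟩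
  · rw [← ENNReal.ofReal_tsum_of_nonneg (fun j => h0 j l) (h2 l).summable, (h2 l).tsum_eq,
      ENNReal.ofReal_one]
  · rw [Subtype.dist_eq, dist_edist]
    refine ENNReal.toReal_mono h3.ne ?_
    exact (Metric.edist_le_ediam_of_mem (subset_tsupport _ hl) (subset_tsupport _ hk)).trans
      (le_iSup (fun j => Metric.ediam (tsupport (ρ j))) j)
  · obtain ⟨hs, hlt⟩ := h4 l k hlk
    rw [← ENNReal.ofReal_tsum_of_nonneg (fun j => abs_nonneg _) hs]
    exact ENNReal.ofReal_le_ofReal hlt.le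

omit [MeasurableSpace X] [BorelSpace X] in
theorem le_setDist {K K' : Set X} {a : ℝ} (h : ∀ x ∈ K, ∀ y ∈ K', a ≤ dist x y) :
    ENNReal.ofReal a ≤ setDist K K' := by
  refine le_iInf₂ fun x hx => le_iInf₂ fun y hy => ?_
  rw [edist_dist]
  exact ENNReal.ofReal_le_ofReal (h x hx y hy)

end Geometry

/-! ### Multiplication by indicators as a decomposition of `L_p` -/

section Indicators

variable {X : Type*} [MeasurableSpace X] {μ : Measure X} {p : ℝ≥0∞} [Fact (1 ≤ p)]

theorem mulInd_mulInd {K K' : Set X} (hK : MeasurableSet K) (hK' : MeasurableSet K')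
    (f : Lp ℂ p μ) :
    mulInd K hK (mulInd K' hK' f) = mulInd (K ∩ K') (hK.inter hK') f := by
  apply Lp.ext
  filter_upwards [coeFn_mulInd K hK (mulInd K' hK' f), coeFn_mulInd K' hK' f,
    coeFn_mulInd (K ∩ K') (hK.inter hK') f] with x h1 h2 h3
  rw [h1, h3]
  by_cases hx : x ∈ K
  · rw [indicator_of_mem hx, h2]
    by_cases hx' : x ∈ K'
    · rw [indicator_of_mem hx', indicator_of_mem (show x ∈ K ∩ K' from ⟨hx, hx'⟩)]
    · rw [indicator_of_notMem hx', indicator_of_notMem (fun h : x ∈ K ∩ K' => hx' h.2)]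
  · rw [indicator_of_notMem hx, indicator_of_notMem (fun h : x ∈ K ∩ K' => hx h.1)]

/-- Allows the set to be replaced although the measurability proof depends on it. -/
theorem mulInd_congr {K K' : Set X} (hK : MeasurableSet K) (hK' : MeasurableSet K')
    (h : K = K') : (mulInd K hK : Lp ℂ p μ →L[ℂ] Lp ℂ p μ) = mulInd K' hK' := by
  subst h; rfl

theorem norm_mulInd_le {K : Set X} (hK : MeasurableSet K) :
    ‖(mulInd K hK : Lp ℂ p μ →L[ℂ] Lp ℂ p μ)‖ ≤ 1 :=
  LinearMap.mkContinuous_norm_le _ zero_le_one _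

theorem mulInd_empty (f : Lp ℂ p μ) : mulInd ∅ MeasurableSet.empty f = 0 := by
  apply Lp.ext
  filter_upwards [coeFn_mulInd ∅ MeasurableSet.empty f, Lp.coeFn_zero ℂ p μ] with x h1 h2
  rw [h1, h2]; simp

theorem mulInd_compl {K : Set X} (hK : MeasurableSet K) :
    (mulInd Kᶜ hK.compl : Lp ℂ p μ →L[ℂ] Lp ℂ p μ) =
      ContinuousLinearMap.id ℂ (Lp ℂ p μ) - mulInd K hK := by
  ext1 f
  apply Lp.ext
  have e : (ContinuousLinearMap.id ℂ (Lp ℂ p μ) - mulInd K hK :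
      Lp ℂ p μ →L[ℂ] Lp ℂ p μ) f = f - mulInd K hK f := rfl
  rw [e]
  filter_upwards [coeFn_mulInd Kᶜ hK.compl f, coeFn_mulInd K hK f,
    Lp.coeFn_sub f (mulInd K hK f)] with x h1 h2 h3
  rw [h1, h3, Pi.sub_apply, h2]
  by_cases hx : x ∈ K <;> simp [hx]

theorem enorm_Lp_rpow (hp : p ≠ ∞) (f : Lp ℂ p μ) :
    ‖f‖ₑ ^ p.toReal = ∫⁻ x, ‖f x‖ₑ ^ p.toReal ∂μ := by
  have hp0 : p ≠ 0 := (zero_lt_one.trans_le (Fact.out : 1 ≤ p)).ne'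
  have hpr : 0 < p.toReal := ENNReal.toReal_pos hp0 hp
  rw [Lp.enorm_def, eLpNorm_eq_lintegral_rpow_enorm_toReal hp0 hp, ← ENNReal.rpow_mul,
    one_div_mul_cancel hpr.ne', ENNReal.rpow_one]

/-- A countable measurable partition decomposes `L_p` as an `ℓ^p`-sum. -/
theorem decomp_mulInd (hp1 : 1 < p) (hp : p ≠ ∞) {L : Type*} [Countable L] {Q : L → Set X}
    (hQm : ∀ l, MeasurableSet (Q l)) (hQd : Pairwise (Function.onFun Disjoint Q))
    (hQu : ⋃ l, Q l = univ) :
    Decomp p.toReal fun l => (mulInd (Q l) (hQm l) : Lp ℂ p μ →L[ℂ] Lp ℂ p μ) where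
  one_lt := by
    rw [← ENNReal.toReal_one]
    exact (ENNReal.toReal_lt_toReal ENNReal.one_ne_top hp).2 hp1
  idem l f := by
    rw [mulInd_mulInd]
    exact congrArg (fun B : Lp ℂ p μ →L[ℂ] Lp ℂ p μ => B f)
      (mulInd_congr _ (hQm l) (inter_self _))
  orth l k hlk f := by
    rw [mulInd_mulInd, mulInd_congr _ MeasurableSet.empty (hQd hlk).inter_eq, mulInd_empty]
  norm_eq f := by
    have hp0 : p ≠ 0 := (zero_lt_one.trans hp1).ne'
    have hpr : 0 < p.toReal := ENNReal.toReal_pos hp0 hp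
    have h1 : ∀ l, ‖mulInd (Q l) (hQm l) f‖ₑ ^ p.toReal = ∫⁻ x in Q l, ‖f x‖ₑ ^ p.toReal ∂μ := by
      intro l
      rw [enorm_Lp_rpow hp, ← lintegral_indicator (hQm l)]
      refine lintegral_congr_ae ?_
      filter_upwards [coeFn_mulInd (Q l) (hQm l) f] with x hx
      rw [hx]
      by_cases hxl : x ∈ Q l
      · rw [indicator_of_mem hxl, indicator_of_mem hxl]
      · rw [indicator_of_notMem hxl, indicator_of_notMem hxl, enorm_zero,
          ENNReal.zero_rpow_of_pos hpr]
    simp_rw [h1]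
    rw [← lintegral_iUnion hQm hQd, hQu, Measure.restrict_univ, enorm_Lp_rpow hp]

end Indicators

/-- Finite sums of components approximate `f` and are eventually fixed by `m r`; contractivity
controls the remainder. -/
theorem Decomp.tendsto_of_eventually_fixed {L F : Type*} [NormedAddCommGroup F] [NormedSpace ℂ F]
    {s : ℝ} {Q : L → F →L[ℂ] F} (hQ : Decomp s Q) {m : ℕ → F →L[ℂ] F} (hm : ∀ r, ‖m r‖ ≤ 1)
    (h : ∀ l, ∀ᶠ r in atTop, ∀ f, m r (Q l f) = Q l f) (f : F) :
    Tendsto (fun r => m r f) atTop (𝓝 f) := by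
  rw [Metric.tendsto_nhds]
  intro ε hε
  obtain ⟨t, ht⟩ := (Metric.tendsto_nhds.1 (hQ.hasSum f) (ε / 2) (by positivity)).exists
  have hev : ∀ᶠ r in atTop, ∀ l ∈ t, ∀ f, m r (Q l f) = Q l f :=
    (Filter.eventually_all_finset t).2 fun l _ => h l
  filter_upwards [hev] with r hr
  rw [dist_eq_norm] at ht ⊢
  have e : m r f - f = (∑ l ∈ t, Q l f - f) - m r (∑ l ∈ t, Q l f - f) := by
    rw [map_sub, map_sum, Finset.sum_congr rfl fun l hl => hr l hl f]
    abel
  rw [e]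
  have h1 := norm_sub_le (∑ l ∈ t, Q l f - f) (m r (∑ l ∈ t, Q l f - f))
  have h2 := (m r).le_of_opNorm_le (hm r) (∑ l ∈ t, Q l f - f)
  linarith

/-! ### Band-dominated operators on `L_p` -/

section BandDominatedOperators

variable {X : Type*} [MetricSpace X] [MeasurableSpace X] {μ : Measure X}
  {p : ℝ≥0∞} [Fact (1 ≤ p)]

theorem mulInd_comp_mulInd_eq_zero {B : Lp ℂ p μ →L[ℂ] Lp ℂ p μ} {K K' : Set X}
    (hK : MeasurableSet K) (hK' : MeasurableSet K') (h : propagation B < setDist K K') :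
    mulInd K' hK' ∘L B ∘L mulInd K hK = 0 := by
  by_contra hne
  exact absurd (le_sSup (s := {d | _}) ⟨K, K', hK, hK', hne, rfl⟩ : setDist K K' ≤ propagation B)
    (not_le.2 h)

theorem propagation_le {B : Lp ℂ p μ →L[ℂ] Lp ℂ p μ} {a : ℝ≥0∞}
    (h : ∀ (K K' : Set X) (hK : MeasurableSet K) (hK' : MeasurableSet K'), a < setDist K K' →
      mulInd K' hK' ∘L B ∘L mulInd K hK = 0) : propagation B ≤ a := by
  refine sSup_le ?_
  rintro d ⟨K, K', hK, hK', hne, rfl⟩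
  by_contra hlt
  exact hne (h K K' hK hK' (not_le.1 hlt))

theorem add_mem_BDO {B B' : Lp ℂ p μ →L[ℂ] Lp ℂ p μ} (hB : B ∈ BDO μ p) (hB' : B' ∈ BDO μ p) :
    B + B' ∈ BDO μ p := by
  refine map_mem_closure₂ continuous_add hB hB' fun C hC C' hC' => ?_
  have hC : propagation C < ∞ := hC
  have hC' : propagation C' < ∞ := hC'
  refine lt_of_le_of_lt (propagation_le (a := max (propagation C) (propagation C'))
    fun K K' hK hK' hlt => ?_) (max_lt hC hC')
  rw [ContinuousLinearMap.add_comp, ContinuousLinearMap.comp_add,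
    mulInd_comp_mulInd_eq_zero hK hK' ((le_max_left _ _).trans_lt hlt),
    mulInd_comp_mulInd_eq_zero hK hK' ((le_max_right _ _).trans_lt hlt), add_zero]

theorem smul_mem_BDO {B : Lp ℂ p μ →L[ℂ] Lp ℂ p μ} (hB : B ∈ BDO μ p) (c : ℂ) :
    c • B ∈ BDO μ p := by
  refine map_mem_closure (f := fun B : Lp ℂ p μ →L[ℂ] Lp ℂ p μ => c • B)
    (continuous_const_smul c) hB fun C hC => ?_
  have hC : propagation C < ∞ := hC
  refine lt_of_le_of_lt (propagation_le fun K K' hK hK' hlt => ?_) hC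
  rw [ContinuousLinearMap.smul_comp, ContinuousLinearMap.comp_smul,
    mulInd_comp_mulInd_eq_zero hK hK' hlt, smul_zero]

theorem id_mem_BDO : ContinuousLinearMap.id ℂ (Lp ℂ p μ) ∈ BDO μ p := by
  refine subset_closure (lt_of_le_of_lt (propagation_le (a := 0) fun K K' hK hK' hlt => ?_)
    ENNReal.zero_lt_top)
  have hd : K' ∩ K = ∅ := by
    rw [← disjoint_iff_inter_eq_empty, Set.disjoint_left]
    intro x hx hx'
    refine absurd hlt (not_lt.2 ?_)
    exact (iInf₂_le x hx').trans ((iInf₂_le x hx).trans_eq (edist_self x))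
  ext1 f
  change mulInd K' hK' (mulInd K hK f) = 0
  rw [mulInd_mulInd, mulInd_congr _ MeasurableSet.empty hd, mulInd_empty]

theorem sub_mem_BDO {B B' : Lp ℂ p μ →L[ℂ] Lp ℂ p μ} (hB : B ∈ BDO μ p) (hB' : B' ∈ BDO μ p) :
    B - B' ∈ BDO μ p := by
  have := add_mem_BDO hB (smul_mem_BDO hB' (-1))
  rwa [neg_one_smul, ← sub_eq_add_neg] at this

theorem exists_finite_propagation {B : Lp ℂ p μ →L[ℂ] Lp ℂ p μ} (hB : B ∈ BDO μ p) {η : ℝ}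
    (hη : 0 < η) : ∃ (B' : Lp ℂ p μ →L[ℂ] Lp ℂ p μ) (ω : ℝ), ‖B - B'‖ ≤ η ∧
      ∀ (K K' : Set X) (hK : MeasurableSet K) (hK' : MeasurableSet K'),
        (∀ x ∈ K, ∀ y ∈ K', ω ≤ dist x y) → mulInd K' hK' ∘L B' ∘L mulInd K hK = 0 := by
  obtain ⟨B', hB', hd⟩ := Metric.mem_closure_iff.1 hB η hη
  have hB' : propagation B' < ∞ := hB'
  rw [dist_eq_norm] at hd
  -- Vanishing is known only for set distances strictly above the propagation; the summand 1 permits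
  -- the non-strict condition `ω ≤ dist x y`.
  refine ⟨B', (propagation B').toReal + 1, hd.le, fun K K' hK hK' h => ?_⟩
  refine mulInd_comp_mulInd_eq_zero hK hK' (lt_of_lt_of_le ?_ (le_setDist h))
  rw [ENNReal.lt_ofReal_iff_toReal_lt hB'.ne]
  linarith

theorem bandDominated_of_mem_BDO {L : Set X} {Q : L → Set X} (hQm : ∀ l, MeasurableSet (Q l))
    {c : ℝ} (hc : ∀ l, ∀ x ∈ Q l, dist x l ≤ c) {B : Lp ℂ p μ →L[ℂ] Lp ℂ p μ} (hB : B ∈ BDO μ p) :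
    BandDominated (fun l => (mulInd (Q l) (hQm l) : Lp ℂ p μ →L[ℂ] Lp ℂ p μ)) B := by
  intro η hη
  obtain ⟨B', ω, hBB', hω⟩ := exists_finite_propagation hB hη
  -- Points of a cell lie within `c` of its centre, so passing from centres to cells costs `2 * c`.
  refine ⟨B', ⟨ω + 2 * c, fun k l hkl => hω _ _ _ _ fun x hx y hy => ?_⟩, hBB'⟩
  have h1 := hc l x hx
  have h2 := hc k y hy
  have h3 := dist_triangle4_left (k : X) l y x
  have h4 : dist k l = dist (k : X) l := rfl
  rw [dist_comm y x] at h3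
  have h5 := dist_triangle4 (k : X) y x l
  rw [dist_comm (k : X) y, dist_comm y x] at h5
  linarith

end BandDominatedOperators

/-! ### Lower bounds at infinity from limit operators -/

section Infinity

variable {X Y : Type*} [MetricSpace X] [TopologicalSpace Y] {e : X → Y}

/-- Closed balls are compact, so their images are closed and do not contain the boundary point `y`.
-/
theorem eventually_dist_gt [ProperSpace X] [T2Space Y] (he : IsDenseEmbedding e) {y : Y}
    (hy : y ∉ range e) (x₀ : X) (r : ℝ) :
    ∀ᶠ x in comap e (𝓝 y), r < dist x x₀ := by
  have hc : IsCompact (e '' Metric.closedBall x₀ r) :=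
    (isCompact_closedBall x₀ r).image he.isDenseInducing.continuous
  have hy' : y ∈ (e '' Metric.closedBall x₀ r)ᶜ := by
    rintro ⟨x, -, hx⟩
    exact hy ⟨x, hx⟩
  filter_upwards [preimage_mem_comap (hc.isClosed.isOpen_compl.mem_nhds hy')] with x hx
  by_contra h
  exact hx ⟨x, not_lt.1 h, rfl⟩

/-- If all limits at infinity of the shifts of a band-dominated operator are bounded below, then
so is the operator itself on vectors supported far out. -/
theorem Decomp.exists_far_lower_bound [CompactSpace Y] (he : IsDenseEmbedding e)
    {F : Type*} [NormedAddCommGroup F] [NormedSpace ℂ F] {L : Set X} {s : ℝ} {Q : L → F →L[ℂ] F}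
    (hQ : Decomp s Q) (hL : UniformlyFinite L) (hA : DiscretePropertyA L) {T : F →L[ℂ] F}
    (hT : BandDominated Q T) (x₀ : X) (V : X → F →ₗᵢ[ℂ] F) (Tx : X → F →L[ℂ] F)
    (hTx : ∀ x f, Tx x (V x f) = V x (T f)) (m : ℕ → F →L[ℂ] F)
    (hm : ∀ R : ℝ, ∃ r : ℕ, ∀ (z : L) (g : F), (∀ l, Q l g ≠ 0 → dist l z ≤ R) →
      m r (V z g) = V z g)
    (hlim : ∀ y ∉ range e, ∃ T' : F →L[ℂ] F, (∃ c > 0, ∀ f, c * ‖f‖ ≤ ‖T' f‖) ∧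
      ∀ r, Tendsto (fun x => Tx x ∘L m r) (comap e (𝓝 y)) (𝓝 (T' ∘L m r))) :
    ∃ n : ℕ, ∃ c > 0, ∀ f, (∀ l : L, dist (l : X) x₀ ≤ n → Q l f = 0) → c * ‖f‖ ≤ ‖T f‖ := by
  by_contra! hcon
  obtain ⟨R, hR⟩ := hQ.exists_localized_chain hL hA hT
  -- Failure of the bound with constant `(1 / 2) ^ n` on vectors vanishing near `x₀` provides the
  -- input for a localization chain of length `n`.
  choose f hf hTf using fun n : ℕ => hcon n ((1 / 2) ^ n) (by positivity)
  have hf0 : ∀ n, f n ≠ 0 := by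
    intro n h0
    have := hTf n
    simp [h0] at this
  choose z hz hchain using fun n => hR n (f n) (hf0 n) (hTf n).le
  have hzdist : ∀ n : ℕ, (n : ℝ) - R 0 < dist (z n : X) x₀ := by
    intro n
    obtain ⟨l, hl, hne⟩ := hz n
    have h1 : (n : ℝ) < dist (l : X) x₀ := by
      by_contra h
      exact hne (hf n l (not_lt.1 h))
    have h2 : dist (l : X) (z n) ≤ R 0 := hl
    have h3 := dist_triangle (l : X) (z n) x₀
    linarith
  -- `Y` need not be sequentially compact, so the centres are followed along a nonprincipal
  -- ultrafilter. They leave every ball, which puts the limit in the boundary.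
  let 𝓤 : Ultrafilter ℕ := hyperfilter ℕ
  have hU : (𝓤 : Filter ℕ) ≤ atTop := Nat.hyperfilter_le_atTop
  obtain ⟨y, -, hy⟩ := isCompact_univ.ultrafilter_le_nhds (𝓤.map fun n => e (z n)) (by simp)
  have hy' : Tendsto (fun n => e (z n)) 𝓤 (𝓝 y) := hy
  have hfar : ∀ r : ℝ, ∀ᶠ n in (𝓤 : Filter ℕ), r < dist (z n : X) x₀ := by
    intro r
    have h1 : ∀ᶠ n : ℕ in atTop, r + R 0 ≤ n := by
      obtain ⟨N, hN⟩ := exists_nat_ge (r + R 0)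
      filter_upwards [eventually_ge_atTop N] with n hn
      exact hN.trans (by exact_mod_cast hn)
    filter_upwards [hU h1] with n hn
    linarith [hzdist n]
  have hyr : y ∉ range e := by
    rintro ⟨a, rfl⟩
    have h1 : Tendsto (fun n => (z n : X)) 𝓤 (𝓝 a) := by
      rw [he.isDenseInducing.isInducing.nhds_eq_comap, tendsto_comap_iff]
      exact hy'
    obtain ⟨n, hn1, hn2⟩ :=
      ((Metric.tendsto_nhds.1 h1 1 one_pos).and (hfar (1 + dist a x₀))).exists
    linarith [dist_triangle (z n : X) a x₀]
  have hzy : Tendsto (fun n => (z n : X)) 𝓤 (comap e (𝓝 y)) := tendsto_comap_iff.2 hy'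
  obtain ⟨T', ⟨c, hc, hT'⟩, hconv⟩ := hlim y hyr
  -- The quotient `2 * (1 / 2) ^ k` is below `c / 4`, and replacing the shifted operator by `T'`
  -- costs another `c / 4`. The scale `k`, hence the cutoff `r`, is fixed before `n`.
  obtain ⟨k, hk⟩ := exists_pow_lt_of_lt_one (show 0 < c / 8 by positivity)
    (show (1 / 2 : ℝ) < 1 by norm_num)
  obtain ⟨r, hr⟩ := hm (R k)
  obtain ⟨n, hn1, hn2⟩ := ((Metric.tendsto_nhds.1 ((hconv r).comp hzy) (c / 4)
    (by positivity)).and (hU (eventually_ge_atTop k))).exists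
  obtain ⟨g, hg, hgz, hTg⟩ := hchain n k hn2
  set u := V (z n) g with hu
  have hmu : m r u = u := hr (z n) g hgz
  have hnu : ‖u‖ = ‖g‖ := (V (z n)).norm_map g
  have h1 : ‖Tx (z n) u‖ ≤ c / 4 * ‖u‖ := by
    rw [hu, hTx, (V (z n)).norm_map, (V (z n)).norm_map]
    refine hTg.trans ?_
    gcongr
    linarith
  have h2 : ‖T' u - Tx (z n) u‖ ≤ c / 4 * ‖u‖ := by
    have : T' u - Tx (z n) u = -((Tx (z n) ∘L m r - T' ∘L m r) u) := by
      simp [hmu]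
    rw [this, norm_neg]
    refine ContinuousLinearMap.le_of_opNorm_le _ ?_ u
    rw [← dist_eq_norm]
    exact hn1.le
  have h3 := norm_add_le (T' u - Tx (z n) u) (Tx (z n) u)
  rw [sub_add_cancel] at h3
  have h4 := hT' u
  have h5 : 0 < ‖u‖ := by rw [hnu]; exact norm_pos_iff.2 hg
  nlinarith

end Infinity

/-! ### Passing regularizers to the limit -/

section Regularizer

variable {ι E : Type*} [NormedAddCommGroup E] [NormedSpace ℂ E] [CompleteSpace E]

/-- If the operators `A x` have regularizers `B x` up to errors that vanish in the limit, then the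
limit `A'` is bijective on `ran P'`. -/
theorem bijective_limit_of_regularizer {l : Filter ι} [l.NeBot] {m : ℕ → E →L[ℂ] E}
    (hmdual : ∀ ψ : E →L[ℂ] ℂ, Tendsto (fun r => ψ ∘L m r) atTop (𝓝 ψ))
    {P A B K K' : ι → E →L[ℂ] E} {P' A' : E →L[ℂ] E} {C : ℝ} (hB : ∀ x, ‖B x‖ ≤ C)
    (hP : ∀ f, Tendsto (fun x => P x f) l (𝓝 (P' f)))
    (hAs : ∀ f, Tendsto (fun x => A x f) l (𝓝 (A' f))) (hA : LocTendsto m l A A')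
    (hBA : ∀ x, B x ∘L A x = P x - K x) (hAB : ∀ x, A x ∘L B x = P x - K' x)
    (hK : ∀ f, Tendsto (fun x => K x f) l (𝓝 0))
    (hK' : ∀ r f, Tendsto (fun x => m r (K' x f)) l (𝓝 0))
    (hP'P' : P' ∘L P' = P') (hA'P' : A' ∘L P' = A') :
    (∀ f, ‖P' f‖ ≤ C * ‖A' f‖) ∧ ∀ f, P' f = f → ∃ g, P' g = g ∧ A' g = f := by
  have hA'P'f : ∀ f, A' (P' f) = A' f := fun f => congrArg (fun G : E →L[ℂ] E => G f) hA'P'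
  have hP'P'f : ∀ f, P' (P' f) = P' f := fun f => congrArg (fun G : E →L[ℂ] E => G f) hP'P'
  have hC0 : 0 ≤ C := by
    obtain ⟨x⟩ := l.nonempty_of_neBot
    exact (norm_nonneg _).trans (hB x)
  -- Only the uniform bound on `B x` enters, through `B x (A x f) = P x f - K x f`; the family `B`
  -- need not converge.
  have hlow : ∀ f, ‖P' f‖ ≤ C * ‖A' f‖ := by
    intro f
    have h1 : Tendsto (fun x => ‖P x f - K x f‖) l (𝓝 ‖P' f - 0‖) := ((hP f).sub (hK f)).norm
    rw [sub_zero] at h1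
    refine le_of_tendsto_of_tendsto h1 ((hAs f).norm.const_mul C) (Eventually.of_forall fun x => ?_)
    have h2 : P x f - K x f = B x (A x f) := by
      have := congrArg (fun G : E →L[ℂ] E => G f) (hBA x)
      simpa using this.symm
    simp only [h2]
    exact (B x).le_of_opNorm_le (hB x) _
  refine ⟨hlow, fun f hf => ?_⟩
  have hcl : IsClosed (A'.range : Set E) := by
    -- `N = ran P'` is closed, being the kernel of `1 - P'`. There `A'` is bounded below, and `A'`
    -- has the same range as its restriction to `N`.
    set N : Submodule ℂ E := (ContinuousLinearMap.id ℂ E - P').ker with hN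
    have hNmem : ∀ f, f ∈ N ↔ P' f = f := by
      intro f
      rw [hN, LinearMap.mem_ker]
      change f - P' f = 0 ↔ _
      rw [sub_eq_zero, eq_comm]
    have hNc : IsClosed (N : Set E) := ContinuousLinearMap.isClosed_ker _
    have : CompleteSpace N := hNc.completeSpace_coe
    have hanti : AntilipschitzWith (Real.toNNReal C) (A'.domRestrict N) := by
      refine ContinuousLinearMap.antilipschitz_of_bound _ fun f => ?_
      rw [Real.coe_toNNReal _ hC0]
      have := hlow f
      rw [(hNmem f).1 f.2] at this
      exact this
    have h1 := (hanti.isClosedEmbedding (A'.domRestrict N).uniformContinuous).isClosed_range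
    convert h1 using 1
    ext w
    constructor
    · rintro ⟨v, rfl⟩
      exact ⟨⟨P' v, (hNmem _).2 (hP'P'f v)⟩, hA'P'f v⟩
    · rintro ⟨v, rfl⟩
      exact ⟨v, rfl⟩
  suffices h : f ∈ A'.range by
    obtain ⟨g, rfl⟩ := h
    exact ⟨P' g, hP'P'f g, hA'P'f g⟩
  by_contra hnot
  obtain ⟨ψ, hψf, hψ⟩ := exists_functional_of_notMem hcl hnot
  have hψA : ∀ g, ψ (A' g) = 0 := fun g => hψ _ ⟨g, rfl⟩
  -- `B x f` is an approximate preimage of `f`: the errors `v x` are bounded and tend to zero after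
  -- each cutoff. As `ψ` kills `ran A'`, `ψ f = ψ (v x)`, and norm convergence of `ψ ∘L m r` to `ψ`
  -- forces `ψ f = 0`.
  set v : ι → E := fun x => f - A' (B x f) with hv
  set D : ℝ := ‖f‖ + ‖A'‖ * (C * ‖f‖) with hD
  have hvb : ∀ x, ‖v x‖ ≤ D := by
    intro x
    refine (norm_sub_le _ _).trans ?_
    rw [hD]
    gcongr
    exact A'.le_opNorm_of_le ((B x).le_of_opNorm_le (hB x) f)
  have hmv : ∀ r, Tendsto (fun x => m r (v x)) l (𝓝 0) := by
    intro r
    have h1 : Tendsto (fun x => (m r ∘L A x - m r ∘L A') (B x f)) l (𝓝 0) := by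
      have h2 := (tendsto_iff_norm_sub_tendsto_zero.1 (hA.left r)).mul_const (C * ‖f‖)
      rw [zero_mul] at h2
      refine squeeze_zero_norm (fun x => ?_) h2
      refine ((m r ∘L A x - m r ∘L A').le_opNorm _).trans ?_
      gcongr
      exact (B x).le_of_opNorm_le (hB x) f
    have h3 : Tendsto (fun x => m r (P x f)) l (𝓝 (m r f)) := by
      have := ((m r).continuous.tendsto _).comp (hP f)
      rwa [hf] at this
    have h4 := (h1.sub (h3.sub_const (m r f))).add (hK' r f)
    rw [sub_self, sub_zero, add_zero] at h4
    refine h4.congr fun x => ?_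
    have h5 : A x (B x f) = P x f - K' x f := by
      have := congrArg (fun G : E →L[ℂ] E => G f) (hAB x)
      simpa using this
    have h6 : m r (A x (B x f)) = m r (P x f) - m r (K' x f) := by rw [h5, map_sub]
    simp only [hv, sub_apply, ContinuousLinearMap.comp_apply, map_sub, h6]
    abel
  have hbound : ∀ r, ‖ψ f‖ ≤ ‖ψ ∘L m r - ψ‖ * D := by
    intro r
    have h1 : Tendsto (fun x => ‖ψ ∘L m r - ψ‖ * D + ‖ψ (m r (v x))‖) l
        (𝓝 (‖ψ ∘L m r - ψ‖ * D + ‖ψ 0‖)) :=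
      (((ψ.continuous.tendsto _).comp (hmv r)).norm).const_add _
    rw [map_zero, norm_zero, add_zero] at h1
    refine ge_of_tendsto h1 (Eventually.of_forall fun x => ?_)
    have h2 : ψ f = ψ (m r (v x)) - (ψ ∘L m r - ψ) (v x) := by
      simp [hv, hψA]
    have h3 : ‖(ψ ∘L m r - ψ) (v x)‖ ≤ ‖ψ ∘L m r - ψ‖ * D :=
      (ψ ∘L m r - ψ).le_opNorm_of_le (hvb x)
    have h4 := norm_sub_le (ψ (m r (v x))) ((ψ ∘L m r - ψ) (v x))
    rw [← h2] at h4
    linarith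
  have h1 := (tendsto_iff_norm_sub_tendsto_zero.1 (hmdual ψ)).mul_const D
  rw [zero_mul] at h1
  have h2 : ‖ψ f‖ ≤ 0 := ge_of_tendsto' h1 hbound
  exact hψf (norm_le_zero_iff.1 h2)

end Regularizer

/-! ### Cutoffs to balls around the base point -/

section Cutoff

variable {X : Type*} [MetricSpace X] [MeasurableSpace X] [BorelSpace X]

/-- Multiplication by the indicator function of the closed ball of radius `r` around `x₀`. -/
noncomputable def cutoff (μ : Measure X) (p : ℝ≥0∞) [Fact (1 ≤ p)] (x₀ : X) (r : ℕ) :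
    Lp ℂ p μ →L[ℂ] Lp ℂ p μ :=
  mulInd (Metric.closedBall x₀ r) measurableSet_closedBall

variable {μ : Measure X} {p : ℝ≥0∞} [Fact (1 ≤ p)] (x₀ : X)

theorem norm_cutoff_le (r : ℕ) : ‖cutoff μ p x₀ r‖ ≤ 1 := norm_mulInd_le _

theorem norm_id_sub_cutoff_le (r : ℕ) :
    ‖ContinuousLinearMap.id ℂ (Lp ℂ p μ) - cutoff μ p x₀ r‖ ≤ 1 := by
  rw [cutoff, ← mulInd_compl]
  exact norm_mulInd_le _

variable {L : Set X} {Q : L → Set X} (hQm : ∀ l, MeasurableSet (Q l)) {c : ℝ}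
  (hc : ∀ l, ∀ x ∈ Q l, dist x l ≤ c)
include hc

omit [MeasurableSpace X] [BorelSpace X] in
theorem cell_subset_closedBall {l : L} {z : X} {R : ℝ} (h : dist (l : X) z + c ≤ R) :
    Q l ⊆ Metric.closedBall z R := by
  intro x hx
  have := hc l x hx
  have := dist_triangle x l z
  rw [Metric.mem_closedBall]
  linarith

theorem cutoff_cell (l : L) : ∀ᶠ r in atTop, ∀ f : Lp ℂ p μ,
    cutoff μ p x₀ r (mulInd (Q l) (hQm l) f) = mulInd (Q l) (hQm l) f ∧
      mulInd (Q l) (hQm l) (cutoff μ p x₀ r f) = mulInd (Q l) (hQm l) f := by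
  obtain ⟨N, hN⟩ := exists_nat_ge (dist (l : X) x₀ + c)
  filter_upwards [eventually_ge_atTop N] with r hr f
  have hsub : Q l ⊆ Metric.closedBall x₀ r :=
    cell_subset_closedBall hc (hN.trans (by exact_mod_cast hr))
  rw [cutoff, mulInd_mulInd, mulInd_mulInd,
    mulInd_congr _ (hQm l) (inter_eq_right.2 hsub), mulInd_congr _ (hQm l) (inter_eq_left.2 hsub)]
  exact ⟨rfl, rfl⟩

theorem tendsto_cutoff {s : ℝ}
    (hQ : Decomp s fun l => (mulInd (Q l) (hQm l) : Lp ℂ p μ →L[ℂ] Lp ℂ p μ)) (f : Lp ℂ p μ) :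
    Tendsto (fun r => cutoff μ p x₀ r f) atTop (𝓝 f) :=
  hQ.tendsto_of_eventually_fixed (norm_cutoff_le x₀) (fun l => by
    filter_upwards [cutoff_cell (μ := μ) (p := p) x₀ hQm hc l] with r hr f using (hr f).1) f

/-- Norm convergence in the dual space rests on its own `ℓ^s`-decomposition, available for `L_p`
because `1 < p < ∞`. -/
theorem tendsto_cutoff_dual {s : ℝ}
    (hQ : Decomp s fun l => transpose (mulInd (Q l) (hQm l) : Lp ℂ p μ →L[ℂ] Lp ℂ p μ))
    (ψ : Lp ℂ p μ →L[ℂ] ℂ) :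
    Tendsto (fun r => ψ ∘L cutoff μ p x₀ r) atTop (𝓝 ψ) := by
  refine hQ.tendsto_of_eventually_fixed (m := fun r => transpose (cutoff μ p x₀ r))
    (fun r => ?_) (fun l => ?_) ψ
  · refine ContinuousLinearMap.opNorm_le_bound _ zero_le_one fun φ => ?_
    calc ‖φ ∘L cutoff μ p x₀ r‖ ≤ ‖φ‖ * ‖cutoff μ p x₀ r‖ := φ.opNorm_comp_le _
      _ ≤ ‖φ‖ * 1 := by gcongr; exact norm_cutoff_le x₀ r
      _ = 1 * ‖φ‖ := mul_comm _ _
  · filter_upwards [cutoff_cell (μ := μ) (p := p) x₀ hQm hc l] with r hr φ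
    ext1 f
    exact congrArg φ (hr f).2

/-- A vector whose cell components vanish away from `z` is fixed by multiplication with the
indicator function of a large ball. -/
theorem mulInd_closedBall_eq_self {s : ℝ}
    (hQ : Decomp s fun l => (mulInd (Q l) (hQm l) : Lp ℂ p μ →L[ℂ] Lp ℂ p μ)) {z : X} {R R' : ℝ}
    (hR : R + c ≤ R') {g : Lp ℂ p μ}
    (hg : ∀ l : L, mulInd (Q l) (hQm l) g ≠ 0 → dist (l : X) z ≤ R) :
    mulInd (Metric.closedBall z R') measurableSet_closedBall g = g := by
  rw [← sub_eq_zero]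
  refine hQ.eq_zero fun l => ?_
  by_cases h : mulInd (Q l) (hQm l) g = 0
  · have h1 : mulInd (Q l) (hQm l) (mulInd (Metric.closedBall z R') measurableSet_closedBall g) =
        mulInd (Metric.closedBall z R') measurableSet_closedBall (mulInd (Q l) (hQm l) g) := by
      rw [mulInd_mulInd, mulInd_mulInd, mulInd_congr _ _ (inter_comm _ _)]
    rw [map_sub, h1, h, map_zero, sub_zero]
  · have hsub : Q l ⊆ Metric.closedBall z R' := cell_subset_closedBall hc (by linarith [hg l h])
    rw [map_sub, mulInd_mulInd, mulInd_congr _ (hQm l) (inter_eq_left.2 hsub), sub_self]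

theorem comp_mulInd_closedBall_eq_self {s : ℝ}
    (hQ : Decomp s fun l => transpose (mulInd (Q l) (hQm l) : Lp ℂ p μ →L[ℂ] Lp ℂ p μ))
    {z : X} {R R' : ℝ} (hR : R + c ≤ R') {ψ : Lp ℂ p μ →L[ℂ] ℂ}
    (hg : ∀ l : L, transpose (mulInd (Q l) (hQm l)) ψ ≠ 0 → dist (l : X) z ≤ R) :
    ψ ∘L mulInd (Metric.closedBall z R') measurableSet_closedBall = ψ := by
  rw [← sub_eq_zero]
  refine hQ.eq_zero fun l => ?_
  ext1 f
  change ψ (mulInd (Metric.closedBall z R') measurableSet_closedBall (mulInd (Q l) (hQm l) f))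
    - ψ (mulInd (Q l) (hQm l) f) = 0
  by_cases h : transpose (mulInd (Q l) (hQm l)) ψ = 0
  · have h1 : ∀ f, ψ (mulInd (Q l) (hQm l) f) = 0 := fun f =>
      congrArg (fun φ : Lp ℂ p μ →L[ℂ] ℂ => φ f) h
    have h2 : mulInd (Metric.closedBall z R') measurableSet_closedBall (mulInd (Q l) (hQm l) f) =
        mulInd (Q l) (hQm l) (mulInd (Metric.closedBall z R') measurableSet_closedBall f) := by
      rw [mulInd_mulInd, mulInd_mulInd, mulInd_congr _ _ (inter_comm _ _)]
    rw [h2, h1, h1, sub_zero]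
  · have hsub : Q l ⊆ Metric.closedBall z R' := cell_subset_closedBall hc (by linarith [hg l h])
    rw [mulInd_mulInd, mulInd_congr _ (hQm l) (inter_eq_right.2 hsub), sub_self]

end Cutoff

/-! ### Shifted operators and their behaviour at infinity -/

section ShiftedOperators

variable {X : Type*} [MetricSpace X] [MeasurableSpace X] [BorelSpace X] {μ : Measure X}
  {p : ℝ≥0∞} [SigmaFinite μ] [Fact (1 ≤ p)] (S : WeightedShift μ p) (hp : p ≠ ∞)

namespace WeightedShift

omit [SigmaFinite μ] [Fact (1 ≤ p)] in
theorem measurableSet_preimage {K : Set X} (hK : MeasurableSet K) :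
    MeasurableSet (S.φ.symm ⁻¹' K) :=
  S.φ.symm.continuous.measurable hK

/-- The preimage under `φ⁻¹` is `φ(K)`. Thus cutoffs around `x₀` of a shifted operator are shifts of
cutoffs around `φ x₀`. -/
theorem mulInd_U {K : Set X} (hK : MeasurableSet K) (f : Lp ℂ p μ) :
    mulInd K hK (S.U hp f) = S.U hp (mulInd (S.φ.symm ⁻¹' K) (S.measurableSet_preimage hK) f) := by
  apply Lp.ext
  filter_upwards [coeFn_mulInd K hK (S.U hp f), S.coeFn_U hp f,
    S.coeFn_U hp (mulInd (S.φ.symm ⁻¹' K) (S.measurableSet_preimage hK) f),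
    S.qmp.ae (coeFn_mulInd (S.φ.symm ⁻¹' K) (S.measurableSet_preimage hK) f)] with x h1 h2 h3 h4
  rw [h1, h3, h4]
  by_cases hx : x ∈ K
  · rw [indicator_of_mem hx, h2, indicator_of_mem (by simpa using hx)]
  · rw [indicator_of_notMem hx, indicator_of_notMem (by simpa using hx), zero_mul]

theorem U_symm_mulInd {K : Set X} (hK : MeasurableSet K) (f : Lp ℂ p μ) :
    (S.U hp).symm (mulInd K hK f) =
      mulInd (S.φ.symm ⁻¹' K) (S.measurableSet_preimage hK) ((S.U hp).symm f) := by
  rw [LinearIsometryEquiv.symm_apply_eq, ← S.mulInd_U hp hK, LinearIsometryEquiv.apply_symm_apply]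

theorem shifted_apply (B : Lp ℂ p μ →L[ℂ] Lp ℂ p μ) (f : Lp ℂ p μ) :
    S.shifted hp B f = S.U hp (B ((S.U hp).symm f)) := rfl

theorem norm_shifted_le (B : Lp ℂ p μ →L[ℂ] Lp ℂ p μ) : ‖S.shifted hp B‖ ≤ ‖B‖ := by
  refine ContinuousLinearMap.opNorm_le_bound _ (norm_nonneg _) fun f => ?_
  rw [shifted_apply, LinearIsometryEquiv.norm_map]
  refine (B.le_opNorm _).trans_eq ?_
  rw [LinearIsometryEquiv.norm_map]

theorem shifted_sub (B B' : Lp ℂ p μ →L[ℂ] Lp ℂ p μ) :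
    S.shifted hp (B - B') = S.shifted hp B - S.shifted hp B' := by
  ext1 f
  simp only [sub_apply, shifted_apply, map_sub]

theorem shifted_add (B B' : Lp ℂ p μ →L[ℂ] Lp ℂ p μ) :
    S.shifted hp (B + B') = S.shifted hp B + S.shifted hp B' := by
  ext1 f
  simp only [add_apply, shifted_apply, map_add]

theorem shifted_id :
    S.shifted hp (ContinuousLinearMap.id ℂ (Lp ℂ p μ)) = ContinuousLinearMap.id ℂ _ := by
  ext1 f
  simp only [shifted_apply, ContinuousLinearMap.id_apply, LinearIsometryEquiv.apply_symm_apply]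

theorem shifted_comp (B B' : Lp ℂ p μ →L[ℂ] Lp ℂ p μ) :
    S.shifted hp (B ∘L B') = S.shifted hp B ∘L S.shifted hp B' := by
  ext1 f
  simp only [ContinuousLinearMap.comp_apply, shifted_apply, LinearIsometryEquiv.symm_apply_apply]

theorem isCompactOperator_shifted {B : Lp ℂ p μ →L[ℂ] Lp ℂ p μ} (hB : IsCompactOperator B) :
    IsCompactOperator (S.shifted hp B) :=
  (hB.comp_clm (S.U hp).symm.toContinuousLinearEquiv.toContinuousLinearMap).clm_comp
    (S.U hp).toContinuousLinearEquiv.toContinuousLinearMap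

theorem mulInd_comp_shifted {K : Set X} (hK : MeasurableSet K)
    (B : Lp ℂ p μ →L[ℂ] Lp ℂ p μ) : mulInd K hK ∘L S.shifted hp B =
      S.shifted hp (mulInd (S.φ.symm ⁻¹' K) (S.measurableSet_preimage hK) ∘L B) := by
  ext1 f
  simp only [ContinuousLinearMap.comp_apply, shifted_apply, mulInd_U]

theorem shifted_comp_mulInd {K : Set X} (hK : MeasurableSet K)
    (B : Lp ℂ p μ →L[ℂ] Lp ℂ p μ) : S.shifted hp B ∘L mulInd K hK =
      S.shifted hp (B ∘L mulInd (S.φ.symm ⁻¹' K) (S.measurableSet_preimage hK)) := by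
  ext1 f
  simp only [ContinuousLinearMap.comp_apply, shifted_apply, U_symm_mulInd]

omit [BorelSpace X] [SigmaFinite μ] [Fact (1 ≤ p)] in
theorem preimage_closedBall (x₀ : X) (r : ℝ) :
    S.φ.symm ⁻¹' Metric.closedBall x₀ r = Metric.closedBall (S.φ x₀) r := by
  rw [IsometryEquiv.preimage_closedBall, IsometryEquiv.symm_symm]

theorem cutoff_comp_shifted (x₀ : X) (r : ℕ) (B : Lp ℂ p μ →L[ℂ] Lp ℂ p μ) :
    cutoff μ p x₀ r ∘L S.shifted hp B =
      S.shifted hp (mulInd (Metric.closedBall (S.φ x₀) r) measurableSet_closedBall ∘L B) := by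
  rw [cutoff, mulInd_comp_shifted, mulInd_congr _ _ (S.preimage_closedBall x₀ r)]

theorem shifted_comp_cutoff (x₀ : X) (r : ℕ) (B : Lp ℂ p μ →L[ℂ] Lp ℂ p μ) :
    S.shifted hp B ∘L cutoff μ p x₀ r =
      S.shifted hp (B ∘L mulInd (Metric.closedBall (S.φ x₀) r) measurableSet_closedBall) := by
  rw [cutoff, shifted_comp_mulInd, mulInd_congr _ _ (S.preimage_closedBall x₀ r)]

theorem mulInd_comp_shifted_comp_mulInd_eq_zero {B : Lp ℂ p μ →L[ℂ] Lp ℂ p μ} {ω : ℝ}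
    (hω : ∀ (K K' : Set X) (hK : MeasurableSet K) (hK' : MeasurableSet K'),
      (∀ x ∈ K, ∀ y ∈ K', ω ≤ dist x y) → mulInd K' hK' ∘L B ∘L mulInd K hK = 0)
    {K K' : Set X} (hK : MeasurableSet K) (hK' : MeasurableSet K')
    (h : ∀ x ∈ K, ∀ y ∈ K', ω ≤ dist x y) :
    mulInd K' hK' ∘L S.shifted hp B ∘L mulInd K hK = 0 := by
  rw [shifted_comp_mulInd, mulInd_comp_shifted, hω _ _ _ _ fun x hx y hy => ?_]
  · ext1 f
    simp only [shifted_apply, zero_apply, map_zero]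
  · rw [← S.φ.symm.dist_eq]
    exact h _ hx _ hy

end WeightedShift

/-- Isometries preserve propagation and the shifts preserve the norm, so one approximant of finite
propagation serves all shifts at once. -/
theorem unifBand_shifted (S : X → WeightedShift μ p) (x₀ : X) {B : Lp ℂ p μ →L[ℂ] Lp ℂ p μ}
    (hB : B ∈ BDO μ p) : UnifBand (cutoff μ p x₀) fun x => (S x).shifted hp B := by
  have key : ∀ {η : ℝ} {B' : Lp ℂ p μ →L[ℂ] Lp ℂ p μ}, ‖B - B'‖ ≤ η → ∀ (x : X)
      {G H : Lp ℂ p μ →L[ℂ] Lp ℂ p μ}, ‖G‖ ≤ 1 → ‖H‖ ≤ 1 → G ∘L (S x).shifted hp B' ∘L H = 0 →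
      ‖G ∘L (S x).shifted hp B ∘L H‖ ≤ η := by
    intro η B' hη x G H hG hH h0
    have e : G ∘L (S x).shifted hp B ∘L H = G ∘L (S x).shifted hp (B - B') ∘L H := by
      rw [WeightedShift.shifted_sub, ContinuousLinearMap.sub_comp, ContinuousLinearMap.comp_sub, h0,
        sub_zero]
    have h1 : ‖(S x).shifted hp (B - B')‖ ≤ η := ((S x).norm_shifted_le hp _).trans hη
    have hη0 : 0 ≤ η := (norm_nonneg _).trans h1
    rw [e]
    calc ‖G ∘L (S x).shifted hp (B - B') ∘L H‖
        ≤ ‖G‖ * (‖(S x).shifted hp (B - B')‖ * ‖H‖) :=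
          (G.opNorm_comp_le _).trans (by gcongr; exact ContinuousLinearMap.opNorm_comp_le _ _)
      _ ≤ 1 * (η * 1) := by gcongr
      _ = η := by ring
  refine ⟨⟨‖B‖, fun x => (S x).norm_shifted_le hp B⟩, fun r η hη => ?_, fun r η hη => ?_⟩
  · obtain ⟨B', ω, hBB', hω⟩ := exists_finite_propagation hB hη
    obtain ⟨R, hR⟩ := exists_nat_ge (r + ω)
    refine ⟨R, fun x => key hBB' x (norm_cutoff_le x₀ r) (norm_id_sub_cutoff_le x₀ R) ?_⟩
    rw [cutoff, cutoff, ← mulInd_compl]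
    refine (S x).mulInd_comp_shifted_comp_mulInd_eq_zero hp hω _ _ fun a ha b hb => ?_
    have h1 : (R : ℝ) < dist a x₀ := not_le.1 ha
    have h2 : dist b x₀ ≤ r := hb
    have := dist_triangle a b x₀
    linarith
  · obtain ⟨B', ω, hBB', hω⟩ := exists_finite_propagation hB hη
    obtain ⟨R, hR⟩ := exists_nat_ge (r + ω)
    refine ⟨R, fun x => key hBB' x (norm_id_sub_cutoff_le x₀ R) (norm_cutoff_le x₀ r) ?_⟩
    rw [cutoff, cutoff, ← mulInd_compl]
    refine (S x).mulInd_comp_shifted_comp_mulInd_eq_zero hp hω _ _ fun a ha b hb => ?_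
    have h1 : (R : ℝ) < dist b x₀ := not_le.1 hb
    have h2 : dist a x₀ ≤ r := ha
    have := dist_triangle_left b x₀ a
    linarith

/-- Shifts of a compact operator vanish at infinity after truncation. -/
theorem tendsto_cutoff_comp_shifted_compact {l : Filter X} {x₀ : X} {S : X → WeightedShift μ p}
    (hS : ∀ x, (S x).φ x₀ = x) (hfar : ∀ r : ℝ, ∀ᶠ x in l, r < dist x x₀)
    (hm : ∀ f : Lp ℂ p μ, Tendsto (fun r => cutoff μ p x₀ r f) atTop (𝓝 f))
    {K : Lp ℂ p μ →L[ℂ] Lp ℂ p μ} (hK : IsCompactOperator K) (r : ℕ) (f : Lp ℂ p μ) :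
    Tendsto (fun x => cutoff μ p x₀ r ((S x).shifted hp K f)) l (𝓝 0) := by
  -- A compact operator is norm close to its cutoff at some radius `R`; once `x` is far away, the
  -- ball of radius `r` around `x` misses the ball of radius `R`.
  have h1 : Tendsto (fun r => cutoff μ p x₀ r ∘L K) atTop
      (𝓝 (ContinuousLinearMap.id ℂ (Lp ℂ p μ) ∘L K)) :=
    tendsto_comp_compact hK ⟨1, norm_cutoff_le x₀⟩ hm
  rw [ContinuousLinearMap.id_comp] at h1
  rw [Metric.tendsto_nhds]
  intro ε hε
  obtain ⟨R, hR⟩ := ((Metric.tendsto_nhds.1 h1) (ε / (‖f‖ + 1)) (by positivity)).exists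
  filter_upwards [hfar (R + r)] with x hx
  rw [dist_zero_right]
  have hd : Metric.closedBall ((S x).φ x₀) r ∩ Metric.closedBall x₀ R = ∅ := by
    rw [← disjoint_iff_inter_eq_empty, hS]
    exact Metric.closedBall_disjoint_closedBall (by linarith)
  set g := ((S x).U hp).symm f with hg
  have hgn : ‖g‖ = ‖f‖ := LinearIsometryEquiv.norm_map _ _
  have e : cutoff μ p x₀ r ((S x).shifted hp K f) = (S x).U hp
      (mulInd (Metric.closedBall ((S x).φ x₀) r) measurableSet_closedBall
        (-(cutoff μ p x₀ R ∘L K - K) g)) := by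
    have h2 := congrArg (fun G : Lp ℂ p μ →L[ℂ] Lp ℂ p μ => G f)
      ((S x).cutoff_comp_shifted hp x₀ r K)
    refine h2.trans ?_
    have h3 : mulInd (Metric.closedBall ((S x).φ x₀) r) measurableSet_closedBall
        (cutoff μ p x₀ R (K g)) = 0 := by
      rw [cutoff, mulInd_mulInd, mulInd_congr _ MeasurableSet.empty hd, mulInd_empty]
    rw [hg] at h3
    simp only [WeightedShift.shifted_apply, ContinuousLinearMap.comp_apply, sub_apply, neg_sub,
      map_sub, h3, sub_zero, hg]
  rw [e, LinearIsometryEquiv.norm_map]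
  rw [dist_eq_norm] at hR
  calc _ ≤ 1 * ‖-(cutoff μ p x₀ R ∘L K - K) g‖ :=
        ContinuousLinearMap.le_of_opNorm_le _ (norm_mulInd_le _) _
    _ ≤ ε / (‖f‖ + 1) * ‖f‖ := by
        rw [one_mul, norm_neg, ← hgn]
        exact ContinuousLinearMap.le_of_opNorm_le _ (by rw [hgn]; exact hR.le) _
    _ < ε := by
        rw [div_mul_eq_mul_div, div_lt_iff₀ (by positivity)]
        nlinarith [norm_nonneg f]

/-- Shifts of a compact operator tend strongly to zero at infinity. -/
theorem tendsto_shifted_compact {l : Filter X} {x₀ : X} {S : X → WeightedShift μ p}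
    (hS : ∀ x, (S x).φ x₀ = x) (hfar : ∀ r : ℝ, ∀ᶠ x in l, r < dist x x₀)
    (hm : ∀ f : Lp ℂ p μ, Tendsto (fun r => cutoff μ p x₀ r f) atTop (𝓝 f))
    (hmdual : ∀ ψ : Lp ℂ p μ →L[ℂ] ℂ, Tendsto (fun r => ψ ∘L cutoff μ p x₀ r) atTop (𝓝 ψ))
    {K : Lp ℂ p μ →L[ℂ] Lp ℂ p μ} (hK : IsCompactOperator K) (f : Lp ℂ p μ) :
    Tendsto (fun x => (S x).shifted hp K f) l (𝓝 0) := by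
  refine tendsto_of_truncations (B := 0) (m := cutoff μ p x₀) (hm f)
    ⟨‖K‖, fun x => (S x).norm_shifted_le hp K⟩ fun r => ?_
  rw [zero_apply]
  set v : X → Lp ℂ p μ := fun x => ((S x).U hp).symm (cutoff μ p x₀ r f) with hv
  have hve : ∀ x, v x = mulInd (Metric.closedBall ((S x).φ x₀) r) measurableSet_closedBall
      (((S x).U hp).symm f) := by
    intro x
    simp only [hv, cutoff, WeightedShift.U_symm_mulInd]
    rw [mulInd_congr _ _ ((S x).preimage_closedBall x₀ r)]
  have hvb : ∀ x, ‖v x‖ ≤ ‖f‖ := by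
    intro x
    simp only [hv]
    rw [LinearIsometryEquiv.norm_map]
    simpa using (cutoff μ p x₀ r).le_of_opNorm_le (norm_cutoff_le x₀ r) f
  -- The bounded vectors `v x` are supported in balls moving to infinity and `ψ` is nearly
  -- concentrated on a fixed ball, so they are weakly null; `K` makes them norm null.
  have hweak : ∀ ψ : Lp ℂ p μ →L[ℂ] ℂ, Tendsto (fun x => ψ (v x)) l (𝓝 (ψ 0)) := by
    intro ψ
    rw [map_zero, Metric.tendsto_nhds]
    intro ε hε
    obtain ⟨R, hR⟩ := ((Metric.tendsto_nhds.1 (hmdual ψ)) (ε / (‖f‖ + 1)) (by positivity)).exists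
    rw [dist_eq_norm] at hR
    filter_upwards [hfar (R + r)] with x hx
    have hd : Metric.closedBall x₀ R ∩ Metric.closedBall ((S x).φ x₀) r = ∅ := by
      rw [← disjoint_iff_inter_eq_empty, hS, disjoint_comm]
      exact Metric.closedBall_disjoint_closedBall (by linarith)
    have h1 : cutoff μ p x₀ R (v x) = 0 := by
      rw [hve, cutoff, mulInd_mulInd, mulInd_congr _ MeasurableSet.empty hd, mulInd_empty]
    have h2 : ψ (v x) = -(ψ ∘L cutoff μ p x₀ R - ψ) (v x) := by
      simp [h1]
    rw [dist_zero_right, h2, norm_neg]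
    calc _ ≤ ε / (‖f‖ + 1) * ‖v x‖ := ContinuousLinearMap.le_of_opNorm_le _ hR.le _
      _ ≤ ε / (‖f‖ + 1) * ‖f‖ := by gcongr; exact hvb x
      _ < ε := by
        rw [div_mul_eq_mul_div, div_lt_iff₀ (by positivity)]
        nlinarith [norm_nonneg f]
  have h0 : Tendsto (fun x => K (v x)) l (𝓝 (K 0)) := tendsto_compact_apply hK hvb hweak
  rw [map_zero] at h0
  refine squeeze_zero_norm (fun x => ?_) (tendsto_zero_iff_norm_tendsto_zero.1 h0)
  rw [WeightedShift.shifted_apply, LinearIsometryEquiv.norm_map]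

end ShiftedOperators

/-! ### Regularizers of Fredholm operators -/

section Regularizers

variable {M : Type*} [NormedAddCommGroup M] [NormedSpace ℂ M]

theorem isCompactOperator_of_hasFiniteRange {G : M →L[ℂ] M}
    (hG : (G : M →ₗ[ℂ] M).HasFiniteRange) : IsCompactOperator G := by
  have : FiniteDimensional ℂ G.range := (Submodule.fg_iff_finiteDimensional _).1 hG
  have : ProperSpace G.range := FiniteDimensional.proper_rclike ℂ G.range
  exact (isCompactOperator_of_locallyCompactSpace_rng G.range.subtypeL).comp_clm
    (G.codRestrict G.range fun f => ⟨f, rfl⟩)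

open scoped LinearMap.FiniteRangeSetoid in
/-- A Fredholm operator is invertible modulo compact operators. -/
theorem exists_regularizer {A : M →L[ℂ] M} (hA : A.IsFredholm) : ∃ B : M →L[ℂ] M,
    IsCompactOperator (ContinuousLinearMap.id ℂ M - B ∘L A) ∧
      IsCompactOperator (ContinuousLinearMap.id ℂ M - A ∘L B) := by
  obtain ⟨B, h1, h2⟩ := hA.exists_isQuasiInverse
  rw [LinearMap.IsLeftQuasiInverse, Setoid.comm,
    LinearMap.FiniteRangeSetoid.equiv_iff_hasFiniteRange] at h1
  rw [LinearMap.IsRightQuasiInverse, Setoid.comm,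
    LinearMap.FiniteRangeSetoid.equiv_iff_hasFiniteRange] at h2
  exact ⟨B, isCompactOperator_of_hasFiniteRange h1, isCompactOperator_of_hasFiniteRange h2⟩

end Regularizers

/-! ### Extending operators from the range of a projection -/

section ExtendByProj

variable {E : Type*} [NormedAddCommGroup E] [NormedSpace ℂ E] {M : Submodule ℂ E}
  {P : E →L[ℂ] E} (hP : LinearMap.IsProj M (P : E →ₗ[ℂ] E))

/-- The projection `P` as an operator onto its range `M`. -/
def projOnto : E →L[ℂ] M := P.codRestrict M hP.map_mem

theorem projOnto_coe (f : M) : projOnto hP f = f := Subtype.ext (hP.map_id f f.2)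

theorem extendByProj_eq (A : M →L[ℂ] M) :
    extendByProj P hP A = M.subtypeL ∘L A ∘L projOnto hP := rfl

include hP in
theorem proj_comp_self : P ∘L P = P := by
  ext f
  exact hP.map_id _ (hP.map_mem f)

theorem projOnto_comp_proj : projOnto hP ∘L P = projOnto hP := by
  ext1 f
  exact projOnto_coe hP (projOnto hP f)

theorem extendByProj_comp_proj (A : M →L[ℂ] M) :
    extendByProj P hP A ∘L P = extendByProj P hP A := by
  rw [extendByProj_eq, ContinuousLinearMap.comp_assoc, ContinuousLinearMap.comp_assoc,
    projOnto_comp_proj]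

theorem proj_comp_extendByProj (A : M →L[ℂ] M) :
    P ∘L extendByProj P hP A = extendByProj P hP A := by
  ext f
  exact hP.map_id _ (A (projOnto hP f)).2

theorem extendByProj_comp (A B : M →L[ℂ] M) :
    extendByProj P hP (A ∘L B) = extendByProj P hP A ∘L extendByProj P hP B := by
  ext1 f
  change ((A (B (projOnto hP f)) : M) : E) = A (projOnto hP (B (projOnto hP f)))
  rw [projOnto_coe]

theorem extendByProj_id_sub (A : M →L[ℂ] M) :
    extendByProj P hP (ContinuousLinearMap.id ℂ M - A) = P - extendByProj P hP A := by
  ext f; rfl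

theorem extendByProj_sub_smul_id (A : M →L[ℂ] M) (z : ℂ) :
    extendByProj P hP (A - z • ContinuousLinearMap.id ℂ M) = extendByProj P hP A - z • P := by
  ext f; rfl

theorem isCompactOperator_extendByProj {A : M →L[ℂ] M} (hA : IsCompactOperator A) :
    IsCompactOperator (extendByProj P hP A) :=
  (hA.comp_clm (projOnto hP)).clm_comp M.subtypeL

/-- An operator on the range of `P'`, extended by `P'` to the whole space. -/
noncomputable def limitExt (P' : E →L[ℂ] E) (A' : P'.range →L[ℂ] E) : E →L[ℂ] E :=
  A' ∘L P'.codRestrict P'.range fun f => ⟨f, rfl⟩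

theorem limitExt_apply (P' : E →L[ℂ] E) (A' : P'.range →L[ℂ] E) (f : E) :
    limitExt P' A' f = A' ⟨P' f, f, rfl⟩ := rfl

theorem proj_apply_of_mem_range {P' : E →L[ℂ] E} (h : P' ∘L P' = P') (f : P'.range) :
    P' f = f := by
  obtain ⟨_, g, rfl⟩ := f
  exact congrArg (fun G : E →L[ℂ] E => G g) h

theorem limitExt_coe {P' : E →L[ℂ] E} (h : P' ∘L P' = P') (A' : P'.range →L[ℂ] E)
    (f : P'.range) : limitExt P' A' f = A' f := by
  rw [limitExt_apply]
  congr 1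
  exact Subtype.ext (proj_apply_of_mem_range h f)

theorem limitExt_comp {P' : E →L[ℂ] E} (h : P' ∘L P' = P') (A' : P'.range →L[ℂ] E) :
    limitExt P' A' ∘L P' = limitExt P' A' := by
  ext f
  rw [ContinuousLinearMap.comp_apply, limitExt_apply, limitExt_apply]
  congr 2
  exact congrArg (fun G : E →L[ℂ] E => G f) h

end ExtendByProj

/-! ### Limit operators of the projection and of `A` -/

section LimitOperators

variable {X : Type*} [MetricSpace X] [ProperSpace X] [MeasurableSpace X] [BorelSpace X]
  {μ : Measure X} [SigmaFinite μ] {p : ℝ≥0∞} [Fact (1 ≤ p)] (hp : p ≠ ∞)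
  {M : Submodule ℂ (Lp ℂ p μ)} {P : Lp ℂ p μ →L[ℂ] Lp ℂ p μ}
  (hP : LinearMap.IsProj M (P : Lp ℂ p μ →ₗ[ℂ] Lp ℂ p μ))
  {x₀ : X} {S : X → WeightedShift μ p} {l : Filter X} [l.NeBot]
  {P' : Lp ℂ p μ →L[ℂ] Lp ℂ p μ}

/-- The limits of the shifted projection and of the shifted operator, in the local norm sense. -/
theorem limit_operators (hPbdo : P ∈ BDO μ p)
    (hPcpt : ∀ (K : Set X) (hK : IsCompact K),
      IsCompactOperator (mulInd K hK.measurableSet ∘L P) ∧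
      IsCompactOperator (P ∘L mulInd K hK.measurableSet))
    (hm : ∀ f : Lp ℂ p μ, Tendsto (fun r => cutoff μ p x₀ r f) atTop (𝓝 f))
    (hw : WeakLim l (fun x => (S x).shifted hp P) P')
    (hcut : ∀ r s, Tendsto (fun x => cutoff μ p x₀ r ∘L (S x).shifted hp P ∘L cutoff μ p x₀ s) l
      (𝓝 (cutoff μ p x₀ r ∘L P' ∘L cutoff μ p x₀ s)))
    {A : M →L[ℂ] M} (hA : extendByProj P hP A ∈ BDO μ p) {A' : P'.range →L[ℂ] Lp ℂ p μ}
    (hA' : ∀ (f : P'.range) (ψ : Lp ℂ p μ →L[ℂ] ℂ),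
      Tendsto (fun x => ψ ((S x).shifted hp (extendByProj P hP A) f)) l (𝓝 (ψ (A' f)))) :
    P' ∘L P' = P' ∧ P' ∘L limitExt P' A' = limitExt P' A' ∧
      LocTendsto (cutoff μ p x₀) l (fun x => (S x).shifted hp P) P' ∧
      LocTendsto (cutoff μ p x₀) l (fun x => (S x).shifted hp (extendByProj P hP A))
        (limitExt P' A') := by
  have hPband := unifBand_shifted hp S x₀ hPbdo
  have hPloc := hPband.locTendsto hw hcut
  have hPs := hPloc.strong hm hPband.bdd
  -- Weak limits of idempotents need not be idempotent; strong limits of bounded families are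
  -- multiplicative.
  have hP'P' : P' ∘L P' = P' := by
    ext1 f
    have h2 : Tendsto (fun x => (S x).shifted hp P ((S x).shifted hp P f)) l
        (𝓝 (P' (P' f))) := tendsto_comp_of_strong hPband.bdd hPs (hPs f)
    refine tendsto_nhds_unique h2 ?_
    refine (hPs f).congr fun x => ?_
    have h1 := (S x).shifted_comp hp P P
    rw [proj_comp_self hP] at h1
    exact congrArg (fun G : Lp ℂ p μ →L[ℂ] Lp ℂ p μ => G f) h1
  -- A cutoff of a shifted projection is a shift of `P` cut off to a compact ball, hence compact,
  -- and norm limits preserve compactness.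
  have hPl : ∀ r, IsCompactOperator (cutoff μ p x₀ r ∘L P') := by
    intro r
    refine isCompactOperator_of_tendsto (hPloc.left r) (Eventually.of_forall fun x => ?_)
    rw [(S x).cutoff_comp_shifted]
    exact (S x).isCompactOperator_shifted hp (hPcpt _ (isCompact_closedBall _ _)).1
  have hPr : ∀ r, IsCompactOperator (P' ∘L cutoff μ p x₀ r) := by
    intro r
    refine isCompactOperator_of_tendsto (hPloc.right r) (Eventually.of_forall fun x => ?_)
    rw [(S x).shifted_comp_cutoff]
    exact (S x).isCompactOperator_shifted hp (hPcpt _ (isCompact_closedBall _ _)).2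
  obtain ⟨h1, h2⟩ := (unifBand_shifted hp S x₀ hA).locTendsto_of_compact hm hPloc hPband.bdd hPl hPr
    (fun x => by rw [← WeightedShift.shifted_comp, extendByProj_comp_proj])
    (fun x => by rw [← WeightedShift.shifted_comp, proj_comp_extendByProj])
    (limitExt_comp hP'P' A') (fun f ψ => hA' ⟨P' f, f, rfl⟩ ψ)
  exact ⟨hP'P', h1, hPloc, h2⟩

omit [ProperSpace X] in
/-- Limit operators of a Fredholm operator are invertible. -/
theorem bijective_limit_of_isFredholm (hS : ∀ x, (S x).φ x₀ = x)
    (hfar : ∀ r : ℝ, ∀ᶠ x in l, r < dist x x₀)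
    (hm : ∀ f : Lp ℂ p μ, Tendsto (fun r => cutoff μ p x₀ r f) atTop (𝓝 f))
    (hmdual : ∀ ψ : Lp ℂ p μ →L[ℂ] ℂ, Tendsto (fun r => ψ ∘L cutoff μ p x₀ r) atTop (𝓝 ψ))
    {A : M →L[ℂ] M} (hA : A.IsFredholm) {A' : Lp ℂ p μ →L[ℂ] Lp ℂ p μ}
    (hPP : P' ∘L P' = P') (hAP : A' ∘L P' = A')
    (hPloc : LocTendsto (cutoff μ p x₀) l (fun x => (S x).shifted hp P) P')
    (hAloc : LocTendsto (cutoff μ p x₀) l (fun x => (S x).shifted hp (extendByProj P hP A)) A') :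
    ∃ C, (∀ f, ‖P' f‖ ≤ C * ‖A' f‖) ∧ ∀ f, P' f = f → ∃ g, P' g = g ∧ A' g = f := by
  obtain ⟨B, hBA, hAB⟩ := exists_regularizer hA
  have hK := isCompactOperator_extendByProj hP hBA
  have hK' := isCompactOperator_extendByProj hP hAB
  have bdd : ∀ G : Lp ℂ p μ →L[ℂ] Lp ℂ p μ, ∃ C, ∀ x, ‖(S x).shifted hp G‖ ≤ C :=
    fun G => ⟨‖G‖, fun x => (S x).norm_shifted_le hp G⟩
  refine ⟨_, bijective_limit_of_regularizer hmdual
    (fun x => (S x).norm_shifted_le hp (extendByProj P hP B))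
    (hPloc.strong hm (bdd _)) (hAloc.strong hm (bdd _)) hAloc
    (K := fun x => (S x).shifted hp (extendByProj P hP (ContinuousLinearMap.id ℂ M - B ∘L A)))
    (K' := fun x => (S x).shifted hp (extendByProj P hP (ContinuousLinearMap.id ℂ M - A ∘L B)))
    (fun x => ?_) (fun x => ?_) (fun f => tendsto_shifted_compact hp hS hfar hm hmdual hK f)
    (fun r f => tendsto_cutoff_comp_shifted_compact hp hS hfar hm hK' r f) hPP hAP⟩
  · rw [extendByProj_id_sub, WeightedShift.shifted_sub, sub_sub_cancel, extendByProj_comp,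
      WeightedShift.shifted_comp]
  · rw [extendByProj_id_sub, WeightedShift.shifted_sub, sub_sub_cancel, extendByProj_comp,
      WeightedShift.shifted_comp]

end LimitOperators

/-! ### Invertibility on `ran P'` and on the whole space -/

section Complemented

variable {E : Type*} [NormedAddCommGroup E] [NormedSpace ℂ E] {P' A' : E →L[ℂ] E}

/-- An operator that is invertible on `ran P'` becomes invertible on the whole space after adding
`1 - P'`. -/
theorem exists_inverse_add_compl (hPP : P' ∘L P' = P') (hAP : A' ∘L P' = A')
    (hPA : P' ∘L A' = A') {B : P'.range →L[ℂ] P'.range} (hB : ∀ f, (B f : E) = A' f)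
    (hu : IsUnit B) : ∃ G : E →L[ℂ] E,
      G ∘L (A' + (ContinuousLinearMap.id ℂ E - P')) = ContinuousLinearMap.id ℂ E ∧
      (A' + (ContinuousLinearMap.id ℂ E - P')) ∘L G = ContinuousLinearMap.id ℂ E := by
  obtain ⟨⟨B, C, hBC, hCB⟩, rfl⟩ := hu
  dsimp only at hB
  have hPPf : ∀ f, P' (P' f) = P' f := fun f => congrArg (fun G : E →L[ℂ] E => G f) hPP
  have hAPf : ∀ f, A' (P' f) = A' f := fun f => congrArg (fun G : E →L[ℂ] E => G f) hAP
  have hPAf : ∀ f, P' (A' f) = A' f := fun f => congrArg (fun G : E →L[ℂ] E => G f) hPA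
  have hCBf : ∀ f, C (B f) = f := fun f => congrArg (fun G : P'.range →L[ℂ] P'.range => G f) hCB
  have hBCf : ∀ f, B (C f) = f := fun f => congrArg (fun G : P'.range →L[ℂ] P'.range => G f) hBC
  set D : E →L[ℂ] E := limitExt P' (P'.range.subtypeL ∘L C) with hD
  have hDf : ∀ f, D f = C ⟨P' f, f, rfl⟩ := fun f => rfl
  have hDA : ∀ f, D (A' f) = P' f := by
    intro f
    rw [hDf]
    have : (⟨P' (A' f), A' f, rfl⟩ : P'.range) = B ⟨P' f, f, rfl⟩ :=
      Subtype.ext (by rw [hB]; exact (hPAf f).trans (hAPf f).symm)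
    rw [this, hCBf]
  have hAD : ∀ f, A' (D f) = P' f := by
    intro f
    rw [hDf, ← hB, hBCf]
  have hDP : ∀ f, D (P' f) = D f := by
    intro f
    rw [hDf, hDf]
    congr 2
    exact Subtype.ext (hPPf f)
  have hPD : ∀ f, P' (D f) = D f := fun f => proj_apply_of_mem_range hPP (C ⟨P' f, f, rfl⟩)
  refine ⟨D + (ContinuousLinearMap.id ℂ E - P'), ?_, ?_⟩
  · ext f
    simp only [ContinuousLinearMap.comp_apply, add_apply, sub_apply, ContinuousLinearMap.id_apply,
      map_add, map_sub, hDA, hDP, hPAf, hPPf]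
    abel
  · ext f
    simp only [ContinuousLinearMap.comp_apply, add_apply, sub_apply, ContinuousLinearMap.id_apply,
      map_add, map_sub, hAD, hAPf, hPD, hPPf]
    abel

/-- The range of an idempotent is closed, hence complete, so a bijective bounded operator on it is
invertible. -/
theorem isUnit_of_bijective_limit [CompleteSpace E] (hPP : P' ∘L P' = P')
    {B : P'.range →L[ℂ] P'.range} (hB : ∀ f, (B f : E) = A' f) {C : ℝ}
    (h1 : ∀ f, ‖P' f‖ ≤ C * ‖A' f‖) (h2 : ∀ f, P' f = f → ∃ g, P' g = g ∧ A' g = f) :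
    IsUnit B := by
  have hcl : IsClosed (P'.range : Set E) := by
    have : (P'.range : Set E) = ((ContinuousLinearMap.id ℂ E - P').ker : Set E) := by
      ext f
      constructor
      · intro hf
        have := proj_apply_of_mem_range hPP ⟨f, hf⟩
        change f - P' f = 0
        rw [this, sub_self]
      · intro hf
        have hf : f - P' f = 0 := hf
        exact ⟨f, (sub_eq_zero.1 hf).symm⟩
    rw [this]
    exact ContinuousLinearMap.isClosed_ker _
  have : CompleteSpace P'.range := hcl.completeSpace_coe
  rw [ContinuousLinearMap.isUnit_iff_bijective]
  constructor
  · rw [injective_iff_map_eq_zero]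
    intro f hf
    have h3 := h1 f
    rw [proj_apply_of_mem_range hPP, ← hB, hf] at h3
    simpa using h3
  · intro f
    obtain ⟨g, hg, hgf⟩ := h2 f (proj_apply_of_mem_range hPP f)
    refine ⟨⟨g, g, hg⟩, Subtype.ext ?_⟩
    rw [hB]
    exact hgf

end Complemented

/-! ### Norm limits through the Stone-Čech compactification -/

section StoneCechExtension

variable {X E : Type*} [TopologicalSpace X] [NormedAddCommGroup E] [NormedSpace ℂ E]

/-- If `G T_x H` extends to a norm continuous function on the Stone-Čech compactification, then
weak limits of `T` become norm limits after multiplication by `G` and `H`. -/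
theorem WeakLim.tendsto_of_stoneCech {l : Filter X} {T : X → E →L[ℂ] E} {B G H : E →L[ℂ] E}
    (hw : WeakLim l T B) {F : StoneCech X → E →L[ℂ] E} (hF : Continuous F)
    (hFT : ∀ x, F (stoneCechUnit x) = G ∘L T x ∘L H) :
    Tendsto (fun x => G ∘L T x ∘L H) l (𝓝 (G ∘L B ∘L H)) := by
  -- Every ultrafilter on `X` converges in the Stone-Čech compactification. The value of `F` there
  -- is a norm limit, which the weak limit identifies.
  rw [tendsto_iff_ultrafilter]
  intro g hg
  obtain ⟨z, -, hz⟩ := isCompact_univ.ultrafilter_le_nhds (g.map stoneCechUnit) (by simp)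
  have hz' : Tendsto stoneCechUnit (g : Filter X) (𝓝 z) := hz
  have h1 : Tendsto (fun x => G ∘L T x ∘L H) g (𝓝 (F z)) :=
    ((hF.tendsto z).comp hz').congr hFT
  have h2 : WeakLim (g : Filter X) (fun x => G ∘L T x ∘L H) (F z) :=
    WeakLim.of_strong fun f =>
      ((ContinuousLinearMap.apply ℂ E f).continuous.tendsto _).comp h1
  have h3 : WeakLim (g : Filter X) (fun x => G ∘L T x ∘L H) (G ∘L B ∘L H) :=
    fun f ψ => (hw.comp G H f ψ).mono_left hg
  rwa [h2.unique h3] at h1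

end StoneCechExtension

/-! ### From lower bounds far out to Fredholmness on `M` -/

section FredholmCriterion

variable {E : Type*} [NormedAddCommGroup E] [NormedSpace ℂ E] {M : Submodule ℂ E} [CompleteSpace M]
  {P : E →L[ℂ] E} (hP : LinearMap.IsProj M (P : E →ₗ[ℂ] E))

/-- `T` agrees with `A` on `M`, and its transpose acts like that of `A` on functionals factoring
through the projection. Splitting `f = (f - m f) + m f`, the bound handles the first part, and the
second is compact on `M`; dually for functionals. -/
theorem isFredholm_of_lower_bounds_compl {A : M →L[ℂ] M} {m m' : E →L[ℂ] E}
    (hm : ∀ f, m (m f) = m f) (hm' : ∀ f, m' (m' f) = m' f)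
    (hK : IsCompactOperator (m ∘L P)) (hK' : IsCompactOperator (P ∘L m'))
    (hM : IsClosed (M : Set E))
    {c c' : ℝ} (hc : 0 < c) (hc' : 0 < c')
    (h : ∀ f, m f = 0 →
      c * ‖f‖ ≤ ‖(extendByProj P hP A + (ContinuousLinearMap.id ℂ E - P)) f‖)
    (h' : ∀ ψ : E →L[ℂ] ℂ, ψ ∘L m' = 0 →
      c' * ‖ψ‖ ≤ ‖ψ ∘L (extendByProj P hP A + (ContinuousLinearMap.id ℂ E - P))‖) :
    A.IsFredholm := by
  set T := extendByProj P hP A + (ContinuousLinearMap.id ℂ E - P) with hT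
  have hTf : ∀ f : M, T f = A f := by
    intro f
    have h1 : P f = f := hP.map_id f f.2
    have h2 : extendByProj P hP A f = A f := by
      rw [extendByProj_eq, ContinuousLinearMap.comp_apply, ContinuousLinearMap.comp_apply,
        projOnto_coe]
      rfl
    simp [hT, h1, h2]
  have hψT : ∀ ψ : M →L[ℂ] ℂ, (ψ ∘L projOnto hP) ∘L T = (ψ ∘L A) ∘L projOnto hP := by
    intro ψ
    ext1 f
    have h1 : projOnto hP (extendByProj P hP A f) = A (projOnto hP f) := projOnto_coe hP _
    have h2 : projOnto hP (P f) = projOnto hP f := projOnto_coe hP (projOnto hP f)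
    simp [hT, h1, h2]
  have hJ : ‖M.subtypeL‖ ≤ 1 := M.norm_subtypeL_le
  -- The factor of `‖m f‖` in `‖f‖ ≤ (‖A f‖ + ‖T‖ * ‖m f‖) / c + ‖m f‖`.
  set a : ℝ := 1 + ‖T‖ / c with ha
  set a' : ℝ := 1 + ‖T‖ / c' with ha'
  have ha0 : 0 ≤ a := by positivity
  have ha0' : 0 ≤ a' := by positivity
  have hcK : IsCompactOperator (projOnto hP ∘L m') := by
    have := hK'.codRestrict (V := M) (fun f => hP.map_mem _) hM
    exact this
  refine isFredholm_of_lower_bounds (K := (a : ℂ) • (m ∘L P ∘L M.subtypeL))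
    (K' := (a' : ℂ) • (projOnto hP ∘L m')) (C := 1 / c) (C' := ‖projOnto hP‖ / c')
    ((hK.comp_clm M.subtypeL).smul _) (hcK.smul (a' : ℂ)) (fun f => ?_) (fun ψ => ?_)
  · have h1 := h (f - m f) (by rw [map_sub, hm, sub_self])
    have h2 : ‖T (f - m f)‖ ≤ ‖A f‖ + ‖T‖ * ‖m f‖ := by
      rw [map_sub, hTf]
      exact (norm_sub_le _ _).trans (add_le_add le_rfl (T.le_opNorm _))
    have h3 : ‖(f : E)‖ ≤ ‖(f : E) - m f‖ + ‖m f‖ := norm_le_norm_sub_add _ _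
    have h4 : ‖(f : E) - m f‖ ≤ (‖A f‖ + ‖T‖ * ‖m f‖) / c := by
      rw [le_div_iff₀ hc, mul_comm]
      exact h1.trans h2
    have h5 : ‖((a : ℂ) • (m ∘L P ∘L M.subtypeL)) f‖ = a * ‖m f‖ := by
      have h6 : P f = f := hP.map_id f f.2
      simp [norm_smul, h6, abs_of_nonneg ha0]
    rw [h5, ha]
    calc ‖(f : E)‖ ≤ (‖A f‖ + ‖T‖ * ‖m f‖) / c + ‖m f‖ := h3.trans (by gcongr)
      _ = _ := by ring
  · set Ψ := ψ ∘L projOnto hP with hΨ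
    have h1 := h' (Ψ - Ψ ∘L m') (by
      ext f
      simp [hm'])
    have h2 : ‖(Ψ - Ψ ∘L m') ∘L T‖ ≤ ‖ψ ∘L A‖ * ‖projOnto hP‖ + ‖Ψ ∘L m'‖ * ‖T‖ := by
      rw [ContinuousLinearMap.sub_comp, hψT]
      exact (norm_sub_le _ _).trans
        (add_le_add (ContinuousLinearMap.opNorm_comp_le _ _)
          (ContinuousLinearMap.opNorm_comp_le _ _))
    have h3 : ‖Ψ‖ ≤ ‖Ψ - Ψ ∘L m'‖ + ‖Ψ ∘L m'‖ := norm_le_norm_sub_add _ _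
    have h4 : ‖Ψ - Ψ ∘L m'‖ ≤ (‖ψ ∘L A‖ * ‖projOnto hP‖ + ‖Ψ ∘L m'‖ * ‖T‖) / c' := by
      rw [le_div_iff₀ hc', mul_comm]
      exact h1.trans h2
    have h5 : ‖ψ ∘L ((a' : ℂ) • (projOnto hP ∘L m'))‖ = a' * ‖Ψ ∘L m'‖ := by
      rw [ContinuousLinearMap.comp_smul, norm_smul, Complex.norm_real, Real.norm_of_nonneg ha0']
      rfl
    have h6 : ‖ψ‖ ≤ ‖Ψ‖ := by
      have h7 : ψ = Ψ ∘L M.subtypeL := by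
        ext f
        exact congrArg ψ (projOnto_coe hP f).symm
      calc ‖ψ‖ = ‖Ψ ∘L M.subtypeL‖ := congrArg _ h7
        _ ≤ ‖Ψ‖ * ‖M.subtypeL‖ := ContinuousLinearMap.opNorm_comp_le _ _
        _ ≤ ‖Ψ‖ * 1 := by gcongr
        _ = ‖Ψ‖ := mul_one _
    rw [h5, ha']
    calc ‖ψ‖ ≤ (‖ψ ∘L A‖ * ‖projOnto hP‖ + ‖Ψ ∘L m'‖ * ‖T‖) / c' + ‖Ψ ∘L m'‖ :=
          h6.trans (h3.trans (by gcongr))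
      _ = _ := by ring

end FredholmCriterion

/-! ### Lower bounds far out for operators on `L_p` and their transposes -/

section FarLowerBounds

/-- Precomposition with the inverse of a surjective isometry, as an isometry of the dual. -/
noncomputable def dualIsometry {E : Type*} [NormedAddCommGroup E] [NormedSpace ℂ E]
    (U : E ≃ₗᵢ[ℂ] E) : (E →L[ℂ] ℂ) →ₗᵢ[ℂ] (E →L[ℂ] ℂ) where
  toLinearMap :=
    (transpose (U.symm.toContinuousLinearEquiv.toContinuousLinearMap)).toLinearMap
  norm_map' ψ := ψ.opNorm_comp_linearIsometryEquiv U.symm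

theorem transpose_comp {E : Type*} [NormedAddCommGroup E] [NormedSpace ℂ E] (A B : E →L[ℂ] E) :
    transpose (A ∘L B) = transpose B ∘L transpose A := rfl

theorem continuous_transpose {E : Type*} [NormedAddCommGroup E] [NormedSpace ℂ E] :
    Continuous (transpose : (E →L[ℂ] E) → _) :=
  ((ContinuousLinearMap.compL ℂ E E ℂ).flip).continuous

theorem exists_lower_bound_of_leftInverse {E : Type*} [NormedAddCommGroup E] [NormedSpace ℂ E]
    {G T : E →L[ℂ] E} (h : G ∘L T = ContinuousLinearMap.id ℂ E) :
    ∃ c > 0, ∀ f, c * ‖f‖ ≤ ‖T f‖ := by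
  refine ⟨1 / (‖G‖ + 1), by positivity, fun f => ?_⟩
  have h1 : G (T f) = f := congrArg (fun H : E →L[ℂ] E => H f) h
  rw [div_mul_eq_mul_div, one_mul, div_le_iff₀ (by positivity), mul_comm]
  calc ‖f‖ = ‖G (T f)‖ := by rw [h1]
    _ ≤ ‖G‖ * ‖T f‖ := G.le_opNorm _
    _ ≤ (‖G‖ + 1) * ‖T f‖ := by gcongr; linarith

variable {X : Type*} [MetricSpace X] [MeasurableSpace X] [BorelSpace X]
  {μ : Measure X} [SigmaFinite μ] {p : ℝ≥0∞} [Fact (1 ≤ p)] (hp : p ≠ ∞)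
  {x₀ : X} {S : X → WeightedShift μ p} (hS : ∀ x, (S x).φ x₀ = x)
  {Y : Type*} [TopologicalSpace Y] [CompactSpace Y] {e : X → Y} (he : IsDenseEmbedding e)
  {L : Set X} {Q : L → Set X} (hL : UniformlyFinite L) (hD : DiscretePropertyA L)
  (hQm : ∀ l, MeasurableSet (Q l)) {b : ℝ} (hb : ∀ l, ∀ x ∈ Q l, dist x l ≤ b)
  {T : Lp ℂ p μ →L[ℂ] Lp ℂ p μ} (hT : T ∈ BDO μ p)
  (hlim : ∀ y ∉ range e, ∃ T' G : Lp ℂ p μ →L[ℂ] Lp ℂ p μ, G ∘L T' = ContinuousLinearMap.id ℂ _ ∧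
    T' ∘L G = ContinuousLinearMap.id ℂ _ ∧
    LocTendsto (cutoff μ p x₀) (comap e (𝓝 y)) (fun x => (S x).shifted hp T) T')
include hS he hL hD hb hT hlim

theorem exists_far_lower_bound {s : ℝ}
    (hQ : Decomp s fun l => (mulInd (Q l) (hQm l) : Lp ℂ p μ →L[ℂ] Lp ℂ p μ)) :
    ∃ N : ℕ, ∃ c > 0, ∀ f, cutoff μ p x₀ N f = 0 → c * ‖f‖ ≤ ‖T f‖ := by
  obtain ⟨n, c, hc, h⟩ := hQ.exists_far_lower_bound he hL hD (bandDominated_of_mem_BDO hQm hb hT)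
    x₀ (fun x => ((S x).U hp).toLinearIsometry) (fun x => (S x).shifted hp T)
    (fun x f => by
      change (S x).shifted hp T ((S x).U hp f) = (S x).U hp (T f)
      rw [WeightedShift.shifted_apply, LinearIsometryEquiv.symm_apply_apply])
    (cutoff μ p x₀)
    (fun R => by
      obtain ⟨r, hr⟩ := exists_nat_ge (R + b)
      refine ⟨r, fun z g hg => ?_⟩
      change cutoff μ p x₀ r ((S z).U hp g) = (S z).U hp g
      rw [cutoff, WeightedShift.mulInd_U]
      congr 1
      rw [mulInd_congr _ measurableSet_closedBall ((S (z : X)).preimage_closedBall x₀ r)]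
      refine mulInd_closedBall_eq_self hQm hb hQ hr fun l hl => ?_
      rw [hS]
      exact hg l hl)
    (fun y hy => by
      obtain ⟨T', G, h1, -, h2⟩ := hlim y hy
      exact ⟨T', exists_lower_bound_of_leftInverse h1, h2.right⟩)
  -- A cell whose centre is within `n` of `x₀` lies in the ball of radius `n + b`, so a vanishing
  -- cutoff at `N` kills all these components.
  obtain ⟨N, hN⟩ := exists_nat_ge (n + b)
  refine ⟨N, c, hc, fun f hf => h f fun l hl => ?_⟩
  have hsub : Q l ⊆ Metric.closedBall x₀ N := cell_subset_closedBall hb (by linarith)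
  have h1 : mulInd (Q l) (hQm l) (cutoff μ p x₀ N f) = mulInd (Q l) (hQm l) f := by
    rw [cutoff, mulInd_mulInd, mulInd_congr _ (hQm l) (inter_eq_left.2 hsub)]
  rw [← h1, hf, map_zero]

/-- Transposition reverses products: here the right inverse of `T'` gives the lower bound for the
limit, and the left truncations of `T` give the convergence. -/
theorem exists_far_lower_bound_transpose {q : ℝ}
    (hQd : Decomp q fun l => transpose (mulInd (Q l) (hQm l) : Lp ℂ p μ →L[ℂ] Lp ℂ p μ)) :
    ∃ N : ℕ, ∃ c > 0, ∀ ψ : Lp ℂ p μ →L[ℂ] ℂ, ψ ∘L cutoff μ p x₀ N = 0 →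
      c * ‖ψ‖ ≤ ‖ψ ∘L T‖ := by
  obtain ⟨n, c, hc, h⟩ := hQd.exists_far_lower_bound he hL hD
    (bandDominated_of_mem_BDO hQm hb hT).transpose
    x₀ (fun x => dualIsometry ((S x).U hp)) (fun x => transpose ((S x).shifted hp T))
    (fun x ψ => by
      ext1 f
      change ψ (((S x).U hp).symm ((S x).U hp (T (((S x).U hp).symm f)))) =
        ψ (T (((S x).U hp).symm f))
      rw [LinearIsometryEquiv.symm_apply_apply])
    (fun r => transpose (cutoff μ p x₀ r))
    (fun R => by
      obtain ⟨r, hr⟩ := exists_nat_ge (R + b)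
      refine ⟨r, fun z ψ hψ => ?_⟩
      have h1 := comp_mulInd_closedBall_eq_self hQm hb hQd hr (z := (S (z : X)).φ x₀) (ψ := ψ)
        fun l hl => by
          rw [hS]
          exact hψ l hl
      ext1 f
      change ψ (((S z).U hp).symm (cutoff μ p x₀ r f)) = ψ (((S z).U hp).symm f)
      rw [cutoff, WeightedShift.U_symm_mulInd,
        mulInd_congr _ measurableSet_closedBall ((S (z : X)).preimage_closedBall x₀ r)]
      exact congrArg (fun φ : Lp ℂ p μ →L[ℂ] ℂ => φ (((S z).U hp).symm f)) h1)
    (fun y hy => by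
      obtain ⟨T', G, -, h1, h2⟩ := hlim y hy
      refine ⟨transpose T', exists_lower_bound_of_leftInverse (G := transpose G) ?_, fun r => ?_⟩
      · rw [← transpose_comp, h1]
        rfl
      · simp only [← transpose_comp]
        exact (continuous_transpose.tendsto _).comp (h2.left r))
  obtain ⟨N, hN⟩ := exists_nat_ge (n + b)
  refine ⟨N, c, hc, fun ψ hψ => h ψ fun l hl => ?_⟩
  have hsub : Q l ⊆ Metric.closedBall x₀ N := cell_subset_closedBall hb (by linarith)
  ext1 f
  change ψ (mulInd (Q l) (hQm l) f) = 0
  have h1 : cutoff μ p x₀ N (mulInd (Q l) (hQm l) f) = mulInd (Q l) (hQm l) f := by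
    rw [cutoff, mulInd_mulInd, mulInd_congr _ (hQm l) (inter_eq_right.2 hsub)]
  rw [← h1]
  exact congrArg (fun φ : Lp ℂ p μ →L[ℂ] ℂ => φ (mulInd (Q l) (hQm l) f)) hψ

end FarLowerBounds

/-! ### The Fredholm equivalence and the essential spectrum -/

section Main

variable {X : Type*} [MetricSpace X] [ProperSpace X] [MeasurableSpace X] [BorelSpace X]
  {μ : Measure X} [SigmaFinite μ] {p : ℝ≥0∞} [Fact (1 ≤ p)] (hp : p ≠ ∞)
  {M : Submodule ℂ (Lp ℂ p μ)} {P : Lp ℂ p μ →L[ℂ] Lp ℂ p μ}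
  (hP : LinearMap.IsProj M (P : Lp ℂ p μ →ₗ[ℂ] Lp ℂ p μ)) {x₀ : X} {S : X → WeightedShift μ p}
  {Y : Type*} [TopologicalSpace Y] [CompactSpace Y] [T2Space Y] {e : X → Y}

/-- The range of each `P_y` is invariant under the limit operator `A_y`, and `A` is Fredholm if
and only if all `A_y` are invertible there. -/
theorem isFredholm_iff_forall_limit_isUnit (hgeom : BoundedGeometry X) (hA' : PropertyA' X)
    (hp1 : 1 < p) (hM : IsClosed (M : Set (Lp ℂ p μ))) (hPbdo : P ∈ BDO μ p)
    (hPcpt : ∀ (K : Set X) (hK : IsCompact K),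
      IsCompactOperator (mulInd K hK.measurableSet ∘L P) ∧
      IsCompactOperator (P ∘L mulInd K hK.measurableSet))
    (hS : ∀ x, (S x).φ x₀ = x)
    (hext : ∀ (K K' : Set X) (hK : IsCompact K) (hK' : IsCompact K'),
      ∃ F : StoneCech X → (Lp ℂ p μ →L[ℂ] Lp ℂ p μ), Continuous F ∧
        ∀ x, F (stoneCechUnit x) = mulInd K hK.measurableSet ∘L
          (S x).shifted hp P ∘L mulInd K' hK'.measurableSet)
    (he : IsDenseEmbedding e) {A : M →L[ℂ] M} (hA : extendByProj P hP A ∈ BDO μ p)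
    {Plim : ((range e)ᶜ : Set Y) → (Lp ℂ p μ →L[ℂ] Lp ℂ p μ)}
    (hPlim : ∀ y : ((range e)ᶜ : Set Y),
      WeakLim (comap e (𝓝 (y : Y))) (fun x => (S x).shifted hp P) (Plim y))
    {Alim : ∀ y : ((range e)ᶜ : Set Y), (Plim y).range →L[ℂ] Lp ℂ p μ}
    (hAlim : ∀ (y : ((range e)ᶜ : Set Y)) (f : (Plim y).range) (ψ : Lp ℂ p μ →L[ℂ] ℂ),
      Tendsto (fun x => ψ ((S x).shifted hp (extendByProj P hP A) f)) (comap e (𝓝 (y : Y)))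
        (𝓝 (ψ (Alim y f)))) :
    (∀ y, Plim y ∘L Plim y = Plim y) ∧ (∀ y f, Alim y f ∈ (Plim y).range) ∧
      ∀ B : ∀ y : ((range e)ᶜ : Set Y), (Plim y).range →L[ℂ] (Plim y).range,
        (∀ y f, (B y f : Lp ℂ p μ) = Alim y f) → (A.IsFredholm ↔ ∀ y, IsUnit (B y)) := by
  obtain ⟨L, b, Q, hLc, hL, hQm, hQd, hQu, hb⟩ := hgeom.exists_partition
  have : Countable L := hLc.to_subtype
  have hQ : Decomp p.toReal fun l => (mulInd (Q l) (hQm l) : Lp ℂ p μ →L[ℂ] Lp ℂ p μ) :=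
    decomp_mulInd hp1 hp hQm hQd hQu
  have hQ' := hQ.dual (Real.HolderConjugate.conjExponent hQ.one_lt)
  have hm := tendsto_cutoff (μ := μ) (p := p) x₀ hQm hb hQ
  have hmd := tendsto_cutoff_dual (μ := μ) (p := p) x₀ hQm hb hQ'
  have hne : ∀ y : Y, (comap e (𝓝 y)).NeBot := fun y => he.toIsDenseInducing.comap_nhds_neBot y
  have hcut : ∀ (y : ((range e)ᶜ : Set Y)) (r s : ℕ),
      Tendsto (fun x => cutoff μ p x₀ r ∘L (S x).shifted hp P ∘L cutoff μ p x₀ s)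
        (comap e (𝓝 (y : Y))) (𝓝 (cutoff μ p x₀ r ∘L Plim y ∘L cutoff μ p x₀ s)) := by
    intro y r s
    obtain ⟨F, hF, hFx⟩ := hext _ _ (isCompact_closedBall x₀ (r : ℝ))
      (isCompact_closedBall x₀ (s : ℝ))
    exact (hPlim y).tendsto_of_stoneCech hF hFx
  have key := fun y : ((range e)ᶜ : Set Y) => limit_operators (l := comap e (𝓝 (y : Y)))
    hp hP hPbdo hPcpt hm (hPlim y) (hcut y) hA (hAlim y)
  have hfar : ∀ (y : ((range e)ᶜ : Set Y)) (r : ℝ), ∀ᶠ x in comap e (𝓝 (y : Y)), r < dist x x₀ :=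
    fun y => eventually_dist_gt he y.2 x₀
  refine ⟨fun y => (key y).1, fun y f => ?_, fun B hB => ⟨fun hFr y => ?_, fun hu => ?_⟩⟩
  · obtain ⟨h1, h2, -, -⟩ := key y
    rw [← limitExt_coe h1, ← h2]
    exact ⟨_, rfl⟩
  · obtain ⟨h1, h2, h3, h4⟩ := key y
    obtain ⟨C, hC, hsurj⟩ := bijective_limit_of_isFredholm hp hP hS (hfar y) hm hmd hFr h1
      (limitExt_comp h1 _) h3 h4
    exact isUnit_of_bijective_limit h1 (fun f => by rw [hB, limitExt_coe h1]) hC hsurj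
  -- Adding `1 - P` yields a band-dominated operator on all of `L_p` with invertible limits, to
  -- which localization applies.
  · have hT : extendByProj P hP A + (ContinuousLinearMap.id ℂ (Lp ℂ p μ) - P) ∈ BDO μ p :=
      add_mem_BDO hA (sub_mem_BDO id_mem_BDO hPbdo)
    have hlim : ∀ y ∉ range e, ∃ T' G : Lp ℂ p μ →L[ℂ] Lp ℂ p μ,
        G ∘L T' = ContinuousLinearMap.id ℂ _ ∧ T' ∘L G = ContinuousLinearMap.id ℂ _ ∧
        LocTendsto (cutoff μ p x₀) (comap e (𝓝 y)) (fun x => (S x).shifted hp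
          (extendByProj P hP A + (ContinuousLinearMap.id ℂ (Lp ℂ p μ) - P))) T' := by
      intro y hy
      obtain ⟨h1, h2, h3, h4⟩ := key ⟨y, hy⟩
      obtain ⟨G, hG, hG'⟩ := exists_inverse_add_compl h1 (limitExt_comp h1 _) h2
        (fun f => by rw [hB, limitExt_coe h1]) (hu ⟨y, hy⟩)
      refine ⟨_, G, hG, hG', ?_⟩
      simp only [WeightedShift.shifted_add, WeightedShift.shifted_sub, WeightedShift.shifted_id]
      exact h4.add (LocTendsto.const.sub h3)
    have hD := hA'.discrete L
    obtain ⟨N, c, hc, hN⟩ := exists_far_lower_bound hp hS he hL hD hQm hb hT hlim hQ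
    obtain ⟨N', c', hc', hN'⟩ := exists_far_lower_bound_transpose hp hS he hL hD hQm hb hT hlim hQ'
    have hidem : ∀ (r : ℕ) (f : Lp ℂ p μ), cutoff μ p x₀ r (cutoff μ p x₀ r f) =
        cutoff μ p x₀ r f := by
      intro r f
      rw [cutoff, mulInd_mulInd, mulInd_congr _ measurableSet_closedBall (inter_self _)]
    have : CompleteSpace M := hM.completeSpace_coe
    exact isFredholm_of_lower_bounds_compl hP (hidem N) (hidem N')
      (hPcpt _ (isCompact_closedBall x₀ (N : ℝ))).1 (hPcpt _ (isCompact_closedBall x₀ (N' : ℝ))).2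
      hM hc hc' hN hN'

end Main

end LimitOp

theorem proposition5p1
    -- the space
    {X : Type*} [MetricSpace X] [ProperSpace X] [MeasurableSpace X] [BorelSpace X]
    (hgeom : LimitOp.BoundedGeometry X) (hA' : LimitOp.PropertyA' X)
    (hunb : ¬ Bornology.IsBounded (Set.univ : Set X))
    (μ : Measure X) [μ.Regular]
    -- the subspace and the projection
    (p : ℝ≥0∞) [Fact (1 ≤ p)] (hp1 : 1 < p) (hp : p ≠ ∞)
    (M : Submodule ℂ (Lp ℂ p μ)) (hM : IsClosed (M : Set (Lp ℂ p μ)))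
    (P : Lp ℂ p μ →L[ℂ] Lp ℂ p μ) (hP : LinearMap.IsProj M (P : Lp ℂ p μ →ₗ[ℂ] Lp ℂ p μ))
    (hPbdo : P ∈ LimitOp.BDO μ p)
    (hPcpt : ∀ (K : Set X) (hK : IsCompact K),
      IsCompactOperator (LimitOp.mulInd K hK.measurableSet ∘L P) ∧
      IsCompactOperator (P ∘L LimitOp.mulInd K hK.measurableSet))
    -- the shifts
    (x₀ : X) (S : X → LimitOp.WeightedShift μ p) (hSx₀ : ∀ x, (S x).φ x₀ = x)
    (hφcont : ∀ᵐ y ∂μ, Continuous fun x => (S x).φ y)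
    (hhcont : ∀ᵐ y ∂μ, Continuous fun x => (S x).h y)
    (hext : ∀ (K K' : Set X) (hK : IsCompact K) (hK' : IsCompact K'),
      ∃ F : StoneCech X → (Lp ℂ p μ →L[ℂ] Lp ℂ p μ), Continuous F ∧
        ∀ x, F (stoneCechUnit x) = LimitOp.mulInd K hK.measurableSet ∘L
          (S x).shifted hp P ∘L LimitOp.mulInd K' hK'.measurableSet)
    -- the compactification
    {Y : Type*} [TopologicalSpace Y] [CompactSpace Y] [T2Space Y]
    (e : X → Y) (he : IsDenseEmbedding e)
    -- the band-dominated operator and its limit operators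
    (A : M →L[ℂ] M) (hA : LimitOp.extendByProj P hP A ∈ LimitOp.BDO μ p)
    (Plim : ((Set.range e)ᶜ : Set Y) → (Lp ℂ p μ →L[ℂ] Lp ℂ p μ))
    (hPlim : ∀ y : ((Set.range e)ᶜ : Set Y),
      LimitOp.IsWeakLimitAt e (y : Y) (fun x => (S x).shifted hp P) (Plim y))
    (Alim : ∀ y : ((Set.range e)ᶜ : Set Y), (Plim y).range →L[ℂ] Lp ℂ p μ)
    (hAlim : ∀ y : ((Set.range e)ᶜ : Set Y),
      LimitOp.IsWeakLimitAt e (y : Y)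
        (fun x => (S x).shifted hp (LimitOp.extendByProj P hP A) ∘L (Plim y).range.subtypeL)
        (Alim y)) :
    -- each limit operator maps `ran P_y` to itself, so that it is an operator `B y` on `ran P_y`
    ∃ B : ∀ y : ((Set.range e)ᶜ : Set Y), (Plim y).range →L[ℂ] (Plim y).range,
      (∀ y f, (B y f : Lp ℂ p μ) = Alim y f) ∧
      (A.IsFredholm ↔ ∀ y, IsUnit (B y)) ∧
      (⋃ y, spectrum ℂ (B y)) = LimitOp.essSpectrum A := by
  have hPw : ∀ y : ((Set.range e)ᶜ : Set Y),
      LimitOp.WeakLim (comap e (𝓝 (y : Y))) (fun x => (S x).shifted hp P) (Plim y) := fun y =>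
    ContinuousLinearMapWOT.tendsto_iff_forall_dual_apply_tendsto.1 (hPlim y)
  have hAw : ∀ (y : ((Set.range e)ᶜ : Set Y)) (f : (Plim y).range) (ψ : Lp ℂ p μ →L[ℂ] ℂ),
      Tendsto (fun x => ψ ((S x).shifted hp (LimitOp.extendByProj P hP A) f))
        (comap e (𝓝 (y : Y))) (𝓝 (ψ (Alim y f))) := fun y =>
    ContinuousLinearMapWOT.tendsto_iff_forall_dual_apply_tendsto.1 (hAlim y)
  obtain ⟨hPP, hran, hiff⟩ := LimitOp.isFredholm_iff_forall_limit_isUnit hp hP hgeom hA' hp1 hM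
    hPbdo hPcpt hSx₀ hext he hA hPw hAw
  refine ⟨fun y => (Alim y).codRestrict (Plim y).range (hran y), fun y f => rfl,
    hiff _ fun y f => rfl, ?_⟩
  ext z
  -- The same equivalence for `A - z`: its extension is `AP - z • P`, so on `ran P_y` its limit
  -- operators are `A_y - z`.
  have hz := (LimitOp.isFredholm_iff_forall_limit_isUnit hp hP hgeom hA' hp1 hM hPbdo hPcpt hSx₀
    hext he (A := A - z • ContinuousLinearMap.id ℂ M)
    (by
      rw [LimitOp.extendByProj_sub_smul_id]
      exact LimitOp.sub_mem_BDO hA (LimitOp.smul_mem_BDO hPbdo z))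
    hPw (Alim := fun y => Alim y - z • (Plim y).range.subtypeL)
    (fun y f ψ => by
      have h1 := (hAw y f ψ).sub ((hPw y f ψ).const_mul z)
      rw [LimitOp.proj_apply_of_mem_range (hPP y)] at h1
      convert h1 using 2
      · rw [LimitOp.extendByProj_sub_smul_id]
        simp [LimitOp.WeightedShift.shifted_apply]
      · simp)).2.2
    (fun y => (Alim y).codRestrict (Plim y).range (hran y) - z • 1) (fun y f => rfl)
  rw [LimitOp.essSpectrum, mem_ofPred_eq, hz, not_forall, mem_iUnion]
  refine exists_congr fun y => ?_
  -- The spectrum is defined through `z - B`, the Fredholm statement through `B - z`.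
  rw [spectrum.mem_iff, Algebra.algebraMap_eq_smul_one, ← IsUnit.neg_iff, neg_sub]
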